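/- All graphs are finite and undirected. A connected (multi)graph $G$ with Betti number $\beta(G)=|E(G)|-|V(G)|+1$ is called upper-embeddable if its maximum genus, i.e. the largest $g$ such that $G$ has a cellular embedding in the orientable closed surface of genus $g$, equals $\lfloor \beta(G)/2\rfloor$. The following graphs are upper-embeddable: (1) the Cartesian product $G\times P_n$ of any connected simple graph $G$ with the path $P_n$ with $n$ edges, for every $n\ge 1$; (2) every graph obtained from two disjoint Halin graphs $H_1$ and $H_2$ by adding $k\ge 2$ edges $e_1,\dots,e_k$, each joining a vertex of $H_1$ to a vertex of $H_2$ (parallel edges are allowed). Here a Halin graph is a graph obtained from a plane tree with at least three leaves by joining its leaves by a cycle in the cyclic order in which they occur around the tree (vertices of degree two in the tree are allowed); (3) the $n$-cube $Q_n$, for every $n\ge 0$, whose vertices are the 0-1-words of length $n$, two of them being adjacent if they differ in exactly one position; (4) the generalized Petersen graphs $P(n,k)$ for all $n\ge 3$ and $1\le k<n$, i.e. the simple graphs with the vertices $u_1,\dots,u_n,v_1,\dots,v_n$ and the edges $u_iu_{i+1}$, $u_iv_i$ and $v_iv_{i+k}$ for $1\le i\le n$, with indices taken modulo $n$. -/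

import Mathlib

/-- A multigraph (loops and parallel edges allowed) with vertex type `V`, given by its darts
(half-edges, i.e. edges with a chosen direction). Every edge `{d, rev d}` consists of exactly two
darts, `src d` is the initial vertex of `d`, and `src (rev d)` is its terminal vertex. -/
structure DartGraph (V D : Type*) where
  /-- initial vertex of a dart -/
  src : D → V
  /-- the same edge in the opposite direction -/
  rev : D → D
  rev_rev : ∀ d, rev (rev d) = d
  rev_ne : ∀ d, rev d ≠ d

namespace DartGraph

variable {V D : Type*}

/-- Dart reversal as a permutation. -/
def revPerm (G : DartGraph V D) : Equiv.Perm D where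
  toFun := G.rev
  invFun := G.rev
  left_inv := G.rev_rev
  right_inv := G.rev_rev

/-- Any two vertices are joined by a walk, and there is at least one vertex. -/
def Connected (G : DartGraph V D) : Prop :=
  Nonempty V ∧
    ∀ u v : V, Relation.ReflTransGen (fun a b => ∃ d, G.src d = a ∧ G.src (G.rev d) = b) u v

/-- The number of edges; each edge consists of two darts. -/
noncomputable def numEdges (_G : DartGraph V D) : ℕ := Nat.card D / 2

/-- The Betti number `|E| - |V| + 1` of a connected graph. -/
noncomputable def betti (G : DartGraph V D) : ℤ := (G.numEdges : ℤ) - (Nat.card V : ℤ) + 1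

/-- `σ` is a rotation system of `G`: its cycles are exactly the sets of darts with a common
initial vertex, so `σ` puts a cyclic order on the darts leaving each vertex. By the
Heffter-Edmonds principle the rotation systems of a connected finite graph are its cellular
embeddings in oriented closed surfaces, up to orientation preserving equivalence. -/
def IsRotation (G : DartGraph V D) (σ : Equiv.Perm D) : Prop :=
  ∀ d d' : D, σ.SameCycle d d' ↔ G.src d = G.src d'

/-- The face-tracing permutation: go along the dart `d`, then leave its terminal vertex by the
dart that follows `rev d` in the rotation there. Its cycles are the facial walks. -/
def facePerm (G : DartGraph V D) (σ : Equiv.Perm D) : Equiv.Perm D := σ * G.revPerm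

/-- The number of faces of the embedding with rotation system `σ`: one for each facial walk.
A vertex without darts (for a connected graph, this is the one-vertex graph on the sphere)
has a trivial facial walk, which has no darts and is counted separately. -/
noncomputable def numFaces (G : DartGraph V D) (σ : Equiv.Perm D) : ℕ :=
  Nat.card (Quotient (Equiv.Perm.SameCycle.setoid (G.facePerm σ))) +
    Nat.card {v : V // ∀ d, G.src d ≠ v}

/-- `G` (connected, finite) has a cellular embedding in the orientable closed surface of
genus `g`: there is a rotation system whose faces satisfy Euler's formula
`|V| - |E| + |F| = 2 - 2 g`. -/
def EmbedsInGenus (G : DartGraph V D) (g : ℕ) : Prop :=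
  ∃ σ : Equiv.Perm D, G.IsRotation σ ∧
    (Nat.card V : ℤ) - (G.numEdges : ℤ) + (G.numFaces σ : ℤ) = 2 - 2 * (g : ℤ)

/-- `g` is the maximum genus of `G`. -/
def IsMaximumGenus (G : DartGraph V D) (g : ℕ) : Prop :=
  IsGreatest {g : ℕ | G.EmbedsInGenus g} g

/-- `G` is connected and its maximum genus equals `⌊β(G) / 2⌋` (floor division in `ℤ`). -/
def UpperEmbeddable (G : DartGraph V D) : Prop :=
  G.Connected ∧ ∃ g : ℕ, G.IsMaximumGenus g ∧ (g : ℤ) = G.betti / 2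

/-- A simple graph as a multigraph. -/
def ofSimple (G : SimpleGraph V) : DartGraph V G.Dart where
  src d := d.fst
  rev d := d.symm
  rev_rev d := d.symm_symm
  rev_ne d := d.symm_ne

/-- The disjoint union of `G₁` and `G₂` together with `k` further edges, the `i`-th of which joins
the vertex `(e i).1` of `G₁` to the vertex `(e i).2` of `G₂`. -/
def join {V₁ D₁ V₂ D₂ : Type*} (G₁ : DartGraph V₁ D₁) (G₂ : DartGraph V₂ D₂) {k : ℕ}
    (e : Fin k → V₁ × V₂) : DartGraph (V₁ ⊕ V₂) (D₁ ⊕ D₂ ⊕ (Fin k × Bool)) where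
  src
    | .inl d => .inl (G₁.src d)
    | .inr (.inl d) => .inr (G₂.src d)
    | .inr (.inr (i, false)) => .inl (e i).1
    | .inr (.inr (i, true)) => .inr (e i).2
  rev
    | .inl d => .inl (G₁.rev d)
    | .inr (.inl d) => .inr (.inl (G₂.rev d))
    | .inr (.inr (i, b)) => .inr (.inr (i, !b))
  rev_rev := by
    rintro (d | d | ⟨i, b⟩) <;> simp [G₁.rev_rev, G₂.rev_rev]
  rev_ne := by
    rintro (d | d | ⟨i, b⟩) <;> simp [G₁.rev_ne, G₂.rev_ne]

end DartGraph

namespace SimpleGraph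

variable {V : Type*}

/-- A leaf (1-valent vertex). -/
def IsLeafVertex (T : SimpleGraph V) (v : V) : Prop := ∃! w, T.Adj v w

/-- For a plane tree, i.e. a tree `T` with a rotation system `σ` (every rotation system of a tree
is an embedding in the sphere): `b` is the first leaf met after the leaf `a` when one walks
around the tree along its only facial walk. -/
def IsNextLeaf (T : SimpleGraph V) (σ : Equiv.Perm T.Dart) (a b : V) : Prop :=
  T.IsLeafVertex a ∧ T.IsLeafVertex b ∧
    ∃ (d : T.Dart) (m : ℕ), d.fst = a ∧ 0 < m ∧
      ((((DartGraph.ofSimple T).facePerm σ) ^ m) d).fst = b ∧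
      ∀ j, 0 < j → j < m →
        ¬ T.IsLeafVertex ((((DartGraph.ofSimple T).facePerm σ) ^ j) d).fst

/-- `H` is a Halin graph: it is obtained from a plane tree with at least three leaves by joining
the leaves by a cycle, in the cyclic order in which they occur around the tree. -/
def IsHalin (H : SimpleGraph V) : Prop :=
  ∃ (T : SimpleGraph V) (σ : Equiv.Perm T.Dart),
    T.IsTree ∧ (DartGraph.ofSimple T).IsRotation σ ∧ 3 ≤ {v | T.IsLeafVertex v}.ncard ∧
      ∀ u v, H.Adj u v ↔ T.Adj u v ∨ T.IsNextLeaf σ u v ∨ T.IsNextLeaf σ v u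

/-- The `n`-cube: vertices are the 0-1-words of length `n`, and two of them are adjacent when they
differ in exactly one position. -/
def nCube (n : ℕ) : SimpleGraph (Fin n → Bool) where
  Adj x y := hammingDist x y = 1
  symm := ⟨fun x y h => by rwa [hammingDist_comm]⟩
  loopless := ⟨fun x h => by simp at h⟩

/-- The generalized Petersen graph `P(n, k)`: `Sum.inl i` is the vertex `u i` and `Sum.inr i` the
vertex `v i`, indices modulo `n`; the edges are `u i, u (i + 1)`, and `u i, v i`, and
`v i, v (i + k)`. -/
def generalizedPetersen (n k : ℕ) : SimpleGraph (ZMod n ⊕ ZMod n) :=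
  SimpleGraph.fromRel fun x y =>
    (∃ i, x = Sum.inl i ∧ y = Sum.inl (i + 1)) ∨
    (∃ i, x = Sum.inl i ∧ y = Sum.inr i) ∨
    (∃ i, x = Sum.inr i ∧ y = Sum.inr (i + (k : ZMod n)))

end SimpleGraph

/-! Every embedding of a nonempty graph has a face, so Euler's formula bounds the genus by `⌊β / 2⌋`
(`le_betti_of_embedsInGenus`). The bound is attained once the graph, possibly after the removal of
one edge, has an embedding with a single face: putting the missing edge back splits that face in
two, which only accounts for an odd `β` (`Unicellular.upperEmbeddable`).

One-face embeddings are built from a single vertex by two moves. A pendant edge to a new vertex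
keeps the face in one piece (`Unicellular.pendant`). Two new edges with a common end can also be
added together (`Unicellular.pair`): the first cuts the face in two, and both parts have a corner at
the common end, so the second edge can be placed to run from one part to the other and reunite them.
In terms of rotation systems, adding an edge multiplies the face permutation by a transposition,
which splits a cycle or merges two. It remains to arrange, in each family, the edges into pendant
edges and adjacent pairs, with at most one edge left over. A basic tool is that the edges of a
connected graph can be paired up to at most one, which may be chosen at a prescribed vertex
(`SimpleGraph.paired_of_treeGrow`).

Products with a path are built layer by layer (`Layered.step`). In layer 0, a spanning tree and a
maximal paired set leave a matching; each matching edge is paired with a vertical edge, whose role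
in the tree is taken over by the copy of the matching edge in layer 1. The same exchange later
disposes of a single leftover edge. Cubes of positive dimension are such products.

In a generalized Petersen graph the parity of the length of the inner cycles decides the tree: even
cycles are paired completely, while odd ones give one edge each to the tree.

A Halin graph is a tree plus a leaf cycle. An even leaf cycle is paired completely; for an odd one,
an exchange of tree edges moves the leftover edge to any desired vertex (`IsHalin.exists_isTree`).
Given two such graphs, `Unicellular.attach_tree` absorbs an odd number of joining edges, and
leftover edges of the Halin graphs are paired with joining edges that were held back. -/

/-! ### Cycles of a permutation times a transposition -/

namespace Equiv.Perm

variable {α : Type*} [Finite α] [DecidableEq α] {f : Perm α} {x y a b : α}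

/-- The two permutations differ only at `x` and `y`, so the orbits of `a` agree until one of these
points is met. -/
theorem SameCycle.mul_swap_or (h : SameCycle f a x) (y : α) :
    SameCycle (f * swap x y) a x ∨ SameCycle (f * swap x y) a y := by
  obtain ⟨n, hn⟩ := h.exists_nat_pow_eq
  induction n generalizing a with
  | zero => left; obtain rfl : a = x := hn; exact .refl _ _
  | succ n ih =>
    by_cases hax : a = x
    · left; rw [hax]
    by_cases hay : a = y
    · right; rw [hay]
    have h1 : (f * swap x y) a = f a := by simp [swap_apply_of_ne_of_ne hax hay]
    rw [pow_succ, mul_apply] at hn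
    have := ih (sameCycle_apply_left.2 h) hn
    rwa [← h1, sameCycle_apply_left, sameCycle_apply_left] at this

/-- The new permutation sends `x` to `f y`, and from there it follows the old cycle of `y`, which
avoids `x`, all the way round to `y`. -/
theorem sameCycle_mul_swap_of_not (h : ¬ SameCycle f x y) : SameCycle (f * swap x y) x y := by
  have key : ∀ (n : ℕ) (a : α), ¬ SameCycle f a x → (f ^ n) a = y →
      SameCycle (f * swap x y) a y := by
    intro n
    induction n with
    | zero => intro a _ hn; obtain rfl : a = y := hn; exact .refl _ _
    | succ n ih =>
      intro a ha hn
      have hax : a ≠ x := by rintro rfl; exact ha (SameCycle.refl _ _)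
      by_cases hay : a = y
      · rw [hay]
      have h1 : (f * swap x y) a = f a := by simp [swap_apply_of_ne_of_ne hax hay]
      rw [pow_succ, mul_apply] at hn
      have := ih (f a) (by rwa [sameCycle_apply_left]) hn
      rwa [← h1, sameCycle_apply_left] at this
  have h1 : (f * swap x y) x = f y := by simp
  have hy : SameCycle f (f y) y := sameCycle_apply_left.2 (SameCycle.refl _ _)
  obtain ⟨n, hn⟩ := hy.exists_nat_pow_eq
  have := key n (f y) (by rw [sameCycle_apply_left]; exact fun h' => h h'.symm) hn
  rwa [← h1, sameCycle_apply_left] at this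

theorem SameCycle.of_mul_swap (hx : ¬ SameCycle f a x) (hy : ¬ SameCycle f a y)
    (h : SameCycle (f * swap x y) a b) : SameCycle f a b := by
  obtain ⟨n, hn⟩ := h.exists_nat_pow_eq
  clear h
  induction n generalizing a with
  | zero => obtain rfl : a = b := hn; exact .refl _ _
  | succ n ih =>
    have hax : a ≠ x := by rintro rfl; exact hx (SameCycle.refl _ _)
    have hay : a ≠ y := by rintro rfl; exact hy (SameCycle.refl _ _)
    have h1 : (f * swap x y) a = f a := by simp [swap_apply_of_ne_of_ne hax hay]
    rw [pow_succ, mul_apply, h1] at hn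
    have := ih (a := f a) (by rwa [sameCycle_apply_left]) (by rwa [sameCycle_apply_left]) hn
    rwa [sameCycle_apply_left] at this

theorem SameCycle.mul_swap_of_not (hx : ¬ SameCycle f a x) (hy : ¬ SameCycle f a y)
    (h : SameCycle f a b) : SameCycle (f * swap x y) a b := by
  obtain ⟨n, hn⟩ := h.exists_nat_pow_eq
  clear h
  induction n generalizing a with
  | zero => obtain rfl : a = b := hn; exact .refl _ _
  | succ n ih =>
    have hax : a ≠ x := by rintro rfl; exact hx (SameCycle.refl _ _)
    have hay : a ≠ y := by rintro rfl; exact hy (SameCycle.refl _ _)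
    have h1 : (f * swap x y) a = f a := by simp [swap_apply_of_ne_of_ne hax hay]
    rw [pow_succ, mul_apply] at hn
    have := ih (a := f a) (by rwa [sameCycle_apply_left]) (by rwa [sameCycle_apply_left]) hn
    rwa [← h1, sameCycle_apply_left] at this

/-- Multiplying by a transposition merges two different cycles. -/
theorem sameCycle_mul_swap_merge (h : ¬ SameCycle f x y)
    (ha : SameCycle f a x ∨ SameCycle f a y) : SameCycle (f * swap x y) a x := by
  have hxy := sameCycle_mul_swap_of_not h
  rcases ha with ha | ha
  · rcases ha.mul_swap_or y with h' | h'
    exacts [h', h'.trans hxy.symm]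
  · have := ha.mul_swap_or x
    rw [swap_comm] at this
    rcases this with h' | h'
    exacts [h'.trans hxy.symm, h']

/-- Multiplying by a transposition splits a cycle. -/
theorem SameCycle.not_mul_swap (h : SameCycle f x y) (hne : x ≠ y) :
    ¬ SameCycle (f * swap x y) x y := by
  obtain ⟨k, hk, hmin⟩ : ∃ k, (f ^ k) x = y ∧ ∀ j < k, (f ^ j) x ≠ y := by
    classical
    have hex := h.exists_nat_pow_eq
    exact ⟨Nat.find hex, Nat.find_spec hex, fun j hj => Nat.find_min hex hj⟩
  -- An earlier return to `x` would give a shorter way from `x` to `y`, against the minimality of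
  -- `k`.
  have hx : ∀ j, 1 ≤ j → j ≤ k → (f ^ j) x ≠ x := by
    intro j hj hjk hjx
    apply hmin (k - j) (by omega)
    rw [← hk]
    conv_rhs => rw [← Nat.sub_add_cancel hjk, pow_add, mul_apply, hjx]
  have hk0 : 1 ≤ k := by
    rcases Nat.eq_zero_or_pos k with rfl | h0
    · exact absurd hk hne
    · exact h0
  -- The new orbit of `y` is trapped in the arc `f x, …, f ^ k x = y`, which omits `x`: at its end,
  -- `y` is sent back to `f x`.
  have key : ∀ n : ℕ, ∃ j, 1 ≤ j ∧ j ≤ k ∧ ((f * swap x y) ^ n) y = (f ^ j) x := by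
    intro n
    induction n with
    | zero => exact ⟨k, hk0, le_rfl, by simp [hk]⟩
    | succ n ih =>
      obtain ⟨j, h1, h2, h3⟩ := ih
      rw [pow_succ', mul_apply, h3]
      rcases h2.lt_or_eq with h4 | h4
      · refine ⟨j + 1, by omega, h4, ?_⟩
        rw [mul_apply, swap_apply_of_ne_of_ne (hx j h1 h2) (hmin j h4), pow_succ', mul_apply]
      · refine ⟨1, le_rfl, hk0, ?_⟩
        rw [h4, hk]; simp
  intro hc
  obtain ⟨n, hn⟩ := hc.symm.exists_nat_pow_eq
  obtain ⟨j, h1, h2, h3⟩ := key n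
  exact hx j h1 h2 (h3.symm.trans hn)

/-- Cutting the element `z = f q` out of its cycle. -/
theorem SameCycle.cut {q z : α} (hq : f q = z) (ha : a ≠ z) (hb : b ≠ z)
    (h : SameCycle f a b) : SameCycle (f * swap q z) a b := by
  have hfix : (f * swap q z) z = z := by simp [hq]
  have hqz : SameCycle f q z := by rw [← hq, sameCycle_apply_right]
  have key : ∀ c, c ≠ z → SameCycle f c q → SameCycle (f * swap q z) c q := by
    intro c hc hcq
    rcases hcq.mul_swap_or z with h' | h'
    · exact h'
    · exact absurd (h'.eq_of_right hfix) hc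
  by_cases haq : SameCycle f a q
  · exact (key a ha haq).trans (key b hb (h.symm.trans haq)).symm
  · exact h.mul_swap_of_not haq (fun h' => haq (h'.trans hqz.symm))

end Equiv.Perm

/-! ### Embeddings with a single face: pendant edges and adjacent pairs -/

namespace DartGraph

open Equiv Equiv.Perm

variable {V D E : Type*}

open Classical in
/-- Reversal of the darts of `S`, all other darts being fixed: these are half-edges that dangle
inside a face. -/
noncomputable def partialRev (G : DartGraph V D) (S : Set D) : Perm D where
  toFun d := if d ∈ S ∧ G.rev d ∈ S then G.rev d else d
  invFun d := if d ∈ S ∧ G.rev d ∈ S then G.rev d else d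
  left_inv d := by by_cases h : d ∈ S ∧ G.rev d ∈ S <;> simp [h, G.rev_rev]
  right_inv d := by by_cases h : d ∈ S ∧ G.rev d ∈ S <;> simp [h, G.rev_rev]

/-- `ε` labels the darts in such a way that exactly the two darts of an edge share their label. -/
def IsEdgeLabel (G : DartGraph V D) (ε : D → E) : Prop :=
  ∀ d d', ε d = ε d' ↔ d = d' ∨ d = G.rev d'

/-- The edge labelled `m` leads from `u` to `w`. -/
def Joins (G : DartGraph V D) (ε : D → E) (m : E) (u w : V) : Prop :=
  ∃ d, ε d = m ∧ G.src d = u ∧ G.src (G.rev d) = w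

/-- The subgraph with vertex set `U` whose edges are those with label in `F` is connected and has
an embedding with a single face; it extends to a rotation system of the whole graph in which the
darts outside of `F` dangle inside that face. -/
structure Unicellular (G : DartGraph V D) (ε : D → E) (U : Set V) (F : Set E) : Prop where
  nonempty : U.Nonempty
  connected : ∀ u ∈ U, ∀ v ∈ U,
    Relation.ReflTransGen (fun a b => ∃ d, G.src d = a ∧ G.src (G.rev d) = b) u v
  src_mem : ∀ d, ε d ∈ F → G.src d ∈ U
  card : ∃ g : ℕ, (ε ⁻¹' F).ncard + 2 = 2 * U.ncard + 4 * g
  rotation : ∃ σ, G.IsRotation σ ∧ ∀ d d', G.src d ∈ U → G.src d' ∈ U →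
    SameCycle (σ * G.partialRev (ε ⁻¹' F)) d d'

variable {G : DartGraph V D} {ε : D → E} {U : Set V} {F : Set E}

theorem Joins.symm (hε : G.IsEdgeLabel ε) {m : E} {u w : V} (h : G.Joins ε m u w) :
    G.Joins ε m w u := by
  obtain ⟨d, h1, h2, h3⟩ := h
  refine ⟨G.rev d, ?_, h3, by rw [G.rev_rev, h2]⟩
  rw [← h1, hε]; right; rfl

theorem IsEdgeLabel.rev (hε : G.IsEdgeLabel ε) (d : D) : ε (G.rev d) = ε d :=
  (hε _ _).2 (Or.inr rfl)

theorem preimage_insert_label (hε : G.IsEdgeLabel ε) (d : D) :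
    ε ⁻¹' (insert (ε d) F) = insert d (insert (G.rev d) (ε ⁻¹' F)) := by
  ext a
  simp only [Set.mem_preimage, Set.mem_insert_iff, hε a d]
  tauto

theorem partialRev_insert [DecidableEq D] (hε : G.IsEdgeLabel ε) {d : D} (hd : ε d ∉ F) :
    G.partialRev (ε ⁻¹' (insert (ε d) F)) =
      G.partialRev (ε ⁻¹' F) * swap d (G.rev d) := by
  ext a
  by_cases h1 : a = d
  · subst h1; simp [partialRev, hε.rev, hd]
  by_cases h2 : a = G.rev d
  · subst h2; simp [partialRev, hε.rev, hd, G.rev_rev]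
  have h3 : ε a ≠ ε d := fun h => by rcases (hε a d).1 h with h | h <;> tauto
  rw [mul_apply, swap_apply_of_ne_of_ne h1 h2]
  have h4 : ε a ∈ insert (ε d) F ↔ ε a ∈ F := by simp [h3]
  by_cases h5 : ε a ∈ F
  · simp [partialRev, hε.rev, h5]
  · simp [partialRev, hε.rev, h3, h5]

theorem ncard_preimage_insert [Finite D] (hε : G.IsEdgeLabel ε) {d : D} (hd : ε d ∉ F) :
    (ε ⁻¹' (insert (ε d) F)).ncard = (ε ⁻¹' F).ncard + 2 := by
  rw [preimage_insert_label hε, Set.ncard_insert_of_notMem, Set.ncard_insert_of_notMem]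
  · simpa [hε.rev] using hd
  · simp only [Set.mem_insert_iff, not_or]
    exact ⟨(G.rev_ne d).symm, hd⟩

theorem partialRev_apply_of_notMem (S : Set D) {d : D} (hd : d ∉ S) : G.partialRev S d = d := by
  simp [partialRev, hd]

theorem partialRev_apply_of_mem (hε : G.IsEdgeLabel ε) {d : D} (hd : ε d ∈ F) :
    G.partialRev (ε ⁻¹' F) d = G.rev d := by
  simp [partialRev, hd, hε.rev]

/-- Each fibre of `src` carries a cyclic permutation; these are glued together along the
decomposition of the darts into fibres. -/
theorem exists_isRotation [Finite D] (G : DartGraph V D) : ∃ σ, G.IsRotation σ := by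
  classical
  have h : ∀ v, ∃ c : Perm {d // G.src d = v}, c.IsCycleOn Set.univ := fun v => by
    obtain ⟨c, hc, -⟩ := (Set.to_countable (Set.univ : Set {d // G.src d = v})).exists_cycleOn
    exact ⟨c, hc⟩
  choose c hc using h
  let e := Equiv.sigmaFiberEquiv G.src
  have key : ∀ (n : ℤ) (d : D), ((e.permCongr (Equiv.Perm.sigmaCongrRight c)) ^ n) d =
      (((c (G.src d)) ^ n) ⟨d, rfl⟩ : {d' // G.src d' = G.src d}) := by
    intro n d
    have h1 : (e.permCongr (Equiv.Perm.sigmaCongrRight c)) ^ n =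
        e.permCongr ((Equiv.Perm.sigmaCongrRight c) ^ n) :=
      (map_zpow e.permCongrHom (Equiv.Perm.sigmaCongrRight c) n).symm
    have h2 : (Equiv.Perm.sigmaCongrRight c) ^ n = Equiv.Perm.sigmaCongrRight (c ^ n) :=
      (map_zpow (Equiv.Perm.sigmaCongrRightHom _) c n).symm
    rw [h1, h2]
    rfl
  refine ⟨e.permCongr (Equiv.Perm.sigmaCongrRight c), fun d d' => ⟨?_, ?_⟩⟩
  · rintro ⟨n, rfl⟩
    rw [key]
    exact (Subtype.prop (((c (G.src d)) ^ n) ⟨d, rfl⟩)).symm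
  · intro hdd
    obtain ⟨n, hn⟩ := (hc (G.src d)).2 (Set.mem_univ ⟨d, rfl⟩) (Set.mem_univ ⟨d', hdd.symm⟩)
    exact ⟨n, by rw [key, hn]⟩

theorem Unicellular.single [Finite D] (G : DartGraph V D) (ε : D → E) (v : V) :
    G.Unicellular ε {v} ∅ where
  nonempty := Set.singleton_nonempty v
  connected := by rintro u rfl w rfl; exact .refl
  src_mem d hd := by simp at hd
  card := ⟨0, by simp⟩
  rotation := by
    obtain ⟨σ, hσ⟩ := G.exists_isRotation
    refine ⟨σ, hσ, ?_⟩
    have : G.partialRev (ε ⁻¹' ∅) = 1 := by ext d; simp [partialRev]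
    rintro d d' hd hd'
    rw [this, mul_one, hσ, hd, hd']

variable [Finite V] [Finite D]

/-- No edge of `F` reaches `w`, so all darts at `w` dangle and form a cycle of their own, namely the
rotation at `w`. The new edge contributes a transposition of one dart from this cycle and one from
the face, which merges the two. The rotation system itself does not change. -/
theorem Unicellular.pendant (hε : G.IsEdgeLabel ε) (h : G.Unicellular ε U F) {m : E} {u w : V}
    (hm : G.Joins ε m u w) (hu : u ∈ U) (hw : w ∉ U) :
    G.Unicellular ε (insert w U) (insert m F) := by
  classical
  obtain ⟨d, rfl, rfl, rfl⟩ := hm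
  have hdF : ε d ∉ F := fun hd => hw (h.src_mem _ (by rwa [hε.rev]))
  obtain ⟨σ, hσ, hc⟩ := h.rotation
  have hW : ∀ a, G.src a = G.src (G.rev d) →
      (σ * G.partialRev (ε ⁻¹' F)) a = σ a ∧ G.src (σ a) = G.src (G.rev d) := by
    intro a ha
    refine ⟨?_, ?_⟩
    · rw [mul_apply, partialRev_apply_of_notMem]
      intro ha'
      exact hw (ha ▸ h.src_mem _ ha')
    · rw [← ha, ← hσ, sameCycle_apply_left]
  have hWpow : ∀ (n : ℕ) a, G.src a = G.src (G.rev d) →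
      ((σ * G.partialRev (ε ⁻¹' F)) ^ n) a = (σ ^ n) a := by
    intro n
    induction n with
    | zero => intro a _; rfl
    | succ n ih =>
      intro a ha
      rw [pow_succ, mul_apply, (hW a ha).1, ih _ (hW a ha).2, pow_succ, mul_apply]
  have hWc : ∀ a, G.src a = G.src (G.rev d) →
      SameCycle (σ * G.partialRev (ε ⁻¹' F)) a (G.rev d) := by
    intro a ha
    obtain ⟨n, hn⟩ := ((hσ a (G.rev d)).2 ha).exists_nat_pow_eq
    exact ⟨n, by rw [zpow_natCast, hWpow n a ha, hn]⟩
  have hnot : ¬ SameCycle (σ * G.partialRev (ε ⁻¹' F)) d (G.rev d) := by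
    intro hs
    obtain ⟨n, hn⟩ := hs.symm.exists_nat_pow_eq
    rw [hWpow n _ rfl] at hn
    have : SameCycle σ (G.rev d) d := ⟨n, by rw [zpow_natCast, hn]⟩
    rw [hσ] at this
    exact hw (this ▸ hu)
  refine ⟨Set.insert_nonempty _ _, ?_, ?_, ?_, σ, hσ, ?_⟩
  · have h1 := fun a ha => h.connected a ha _ hu
    have h2 := fun a ha => h.connected _ hu a ha
    rintro a (rfl | ha) b (rfl | hb)
    · exact .refl
    · exact .head ⟨G.rev d, rfl, by rw [G.rev_rev]⟩ (h2 b hb)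
    · exact (h1 a ha).tail ⟨d, rfl, rfl⟩
    · exact h.connected a ha b hb
  · intro a ha
    rcases ha with ha | ha
    · rcases (hε _ _).1 ha with rfl | rfl
      exacts [Or.inr hu, Or.inl rfl]
    · exact Or.inr (h.src_mem a ha)
  · obtain ⟨g, hg⟩ := h.card
    refine ⟨g, ?_⟩
    rw [ncard_preimage_insert hε hdF, Set.ncard_insert_of_notMem hw]
    omega
  · rw [partialRev_insert hε hdF, ← mul_assoc]
    have key : ∀ a, G.src a ∈ insert (G.src (G.rev d)) U →
        SameCycle (σ * G.partialRev (ε ⁻¹' F) * swap d (G.rev d)) a d := by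
      intro a ha
      apply sameCycle_mul_swap_merge hnot
      rcases ha with ha | ha
      · exact Or.inr (hWc a ha)
      · exact Or.inl (hc _ _ ha hu)
    intro a b ha hb
    exact (key a ha).trans (key b hb).symm

end DartGraph

namespace DartGraph

open Equiv Equiv.Perm

variable {V D E : Type*} {G : DartGraph V D} {ε : D → E} {U : Set V} {F : Set E}

theorem src_eq_of_sameCycle [Finite D] {τ : Perm D} (h : ∀ a, G.src (τ a) = G.src a) {a b : D}
    (hab : SameCycle τ a b) : G.src a = G.src b := by
  obtain ⟨n, rfl⟩ := hab.exists_nat_pow_eq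
  clear hab
  induction n with
  | zero => rfl
  | succ n ih => rw [pow_succ', mul_apply, h, ih]

theorem IsRotation.src_apply {σ : Perm D} (hσ : G.IsRotation σ) (a : D) :
    G.src (σ a) = G.src a := by
  rw [← hσ, sameCycle_apply_left]

theorem src_swap_apply [DecidableEq D] {x y : D} (h : G.src x = G.src y) (a : D) :
    G.src (swap x y a) = G.src a := by
  rw [swap_apply_def]; split_ifs <;> simp_all

/-- Moving the dart `f` to another place of the rotation at its vertex. -/
theorem IsRotation.move [Finite D] [DecidableEq D] {σ : Perm D} (hσ : G.IsRotation σ)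
    {p f x : D} (hp : σ p = f) (hx : G.src x = G.src f) (hxf : x ≠ f) :
    G.IsRotation (σ * swap p f * swap x f) := by
  have hpf : G.src p = G.src f := by rw [← hp, hσ.src_apply]
  have hs0 : ∀ a, G.src ((σ * swap p f) a) = G.src a := fun a => by
    rw [mul_apply, hσ.src_apply, src_swap_apply hpf]
  have hfix : (σ * swap p f) f = f := by simp [hp]
  have hnot : ¬ SameCycle (σ * swap p f) x f := fun h => hxf (h.eq_of_right hfix)
  have key : ∀ c, G.src c = G.src f → SameCycle (σ * swap p f * swap x f) c x := by
    intro c hc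
    apply sameCycle_mul_swap_merge hnot
    by_cases hcf : c = f
    · exact Or.inr (hcf ▸ SameCycle.refl _ _)
    · exact Or.inl (SameCycle.cut hp hcf hxf ((hσ c x).2 (hc.trans hx.symm)))
  intro a b
  constructor
  · apply src_eq_of_sameCycle
    intro a
    rw [mul_apply, hs0, src_swap_apply hx]
  · intro hab
    by_cases ha : G.src a = G.src f
    · exact (key a ha).trans (key b (hab ▸ ha)).symm
    · have haf : a ≠ f := fun h => ha (h ▸ rfl)
      have hbf : b ≠ f := fun h => ha (h ▸ hab)
      refine SameCycle.mul_swap_of_not (fun h => ha ?_) (fun h => ha ?_)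
        (SameCycle.cut hp haf hbf ((hσ a b).2 hab))
      · exact (src_eq_of_sameCycle hs0 h).trans hx
      · exact src_eq_of_sameCycle hs0 h

theorem partialRev_partialRev (S : Set D) (a : D) :
    G.partialRev S (G.partialRev S a) = a :=
  (G.partialRev S).left_inv a

/-- Translates a change of the rotation into a change of the faces: the transposition is conjugated
by the partial reversal. -/
theorem mul_swap_mul_partialRev [DecidableEq D] (τ : Perm D) (S : Set D) (x y : D) :
    τ * swap x y * G.partialRev S =
      τ * G.partialRev S * swap (G.partialRev S x) (G.partialRev S y) := by
  have h := swap_mul_eq_mul_swap (G.partialRev S) x y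
  rw [mul_assoc, h, ← mul_assoc]
  rfl

variable [Finite D]

/-- Two adjacent new edges can be added to an embedding with a single face in such a way that there
is still a single face. -/
theorem Unicellular.pair (hε : G.IsEdgeLabel ε) (h : G.Unicellular ε U F) {m m' : E} {v x y : V}
    (hm : G.Joins ε m v x) (hm' : G.Joins ε m' v y) (hne : m ≠ m') (hmF : m ∉ F) (hmF' : m' ∉ F)
    (hv : v ∈ U) (hx : x ∈ U) (hy : y ∈ U) :
    G.Unicellular ε U (insert m (insert m' F)) := by
  classical
  obtain ⟨d, rfl, hd, rfl⟩ := hm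
  obtain ⟨f, rfl, hf, rfl⟩ := hm'
  obtain ⟨σ, hσ, hc⟩ := h.rotation
  have hdf : d ≠ f := fun h => hne (h ▸ rfl)
  have hdf' : G.rev d ≠ f := fun h => hne (by rw [← h, hε.rev])
  have hrf : G.rev f ≠ f := G.rev_ne f
  set ρ := G.partialRev (ε ⁻¹' F) with hρ
  set ρ₁ := G.partialRev (ε ⁻¹' (insert (ε d) F)) with hρ₁
  have hρ₁d : ρ₁ = ρ * swap d (G.rev d) := partialRev_insert hε hmF
  have hmF'' : ε f ∉ insert (ε d) F := by
    rintro (h | h)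
    exacts [hne h.symm, hmF' h]
  have hρ₁f : ρ₁ f = f := partialRev_apply_of_notMem _ hmF''
  have hρf : ρ f = f := partialRev_apply_of_notMem _ hmF'
  obtain ⟨p, hp⟩ := σ.surjective f
  set σ₀ := σ * swap p f with hσ₀
  have hσ₀f : σ₀ f = f := by simp [hσ₀, hp]
  have hpf : G.src p = G.src f := by rw [← hp, hσ.src_apply]
  have hs0 : ∀ a, G.src (σ₀ a) = G.src a := fun a => by
    rw [hσ₀, mul_apply, hσ.src_apply, src_swap_apply hpf]
  -- Taking the dangling dart `f` out of the rotation only cuts it out of the face; the other darts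
  -- stay together.
  have hc₀ : ∀ a b, G.src a ∈ U → G.src b ∈ U → a ≠ f → b ≠ f → SameCycle (σ₀ * ρ) a b := by
    intro a b ha hb haf hbf
    rw [hσ₀, hρ, mul_swap_mul_partialRev, ← hρ, hρf]
    refine SameCycle.cut ?_ haf hbf (hc a b ha hb)
    rw [mul_apply, hρ, partialRev_partialRev, hp]
  set φ₁ := σ₀ * ρ₁ with hφ₁
  have hφ₁' : φ₁ = σ₀ * ρ * swap d (G.rev d) := by rw [hφ₁, hρ₁d, ← mul_assoc]
  have hφ₁f : φ₁ f = f := by rw [hφ₁, mul_apply, hρ₁f, hσ₀f]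
  have hdU : G.src d ∈ U := hd ▸ hv
  have hfU : G.src f ∈ U := hf ▸ hv
  -- The edge of `d` cuts the face into two parts, one with `d` and one with `rev d`.
  have hnd : ¬ SameCycle φ₁ d (G.rev d) := by
    rw [hφ₁']
    exact (hc₀ _ _ hdU hx hdf hdf').not_mul_swap (G.rev_ne d).symm
  have hor : ∀ a, G.src a ∈ U → a ≠ f → SameCycle φ₁ a d ∨ SameCycle φ₁ a (G.rev d) := by
    intro a ha haf
    rw [hφ₁']
    exact (hc₀ a d ha hdU haf hdf).mul_swap_or _
  have hρρ : ∀ a, ρ₁ (ρ₁ a) = a := partialRev_partialRev _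
  -- The corner after a dart `x` lies on the part of `ρ₁ x`. At the common end, the corner after `d`
  -- lies on the part of `rev d`, and the corner before `d` on the part of `d`. Hence `f` can be
  -- inserted in the part that does not contain `rev f`.
  obtain ⟨x, hxv, hxf, hxn, hxor⟩ : ∃ x, G.src x = G.src f ∧ x ≠ f ∧
      ¬ SameCycle φ₁ (ρ₁ x) (G.rev f) ∧ ∀ a, G.src a ∈ U → a ≠ f →
        SameCycle φ₁ a (ρ₁ x) ∨ SameCycle φ₁ a (G.rev f) := by
    rcases hor (G.rev f) hy hrf with h' | h'
    · have h1 : ρ₁ d = G.rev d := partialRev_apply_of_mem hε (by simp)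
      refine ⟨d, hd.trans hf.symm, hdf, ?_, ?_⟩ <;> rw [h1]
      · exact fun h2 => hnd (h2.trans h').symm
      · intro a ha haf
        rcases hor a ha haf with h2 | h2
        exacts [Or.inr (h2.trans h'.symm), Or.inl h2]
    · obtain ⟨x, hx⟩ := σ₀.surjective d
      have h1 : SameCycle φ₁ (ρ₁ x) d := by
        have : φ₁ (ρ₁ x) = d := by rw [hφ₁, mul_apply, hρρ, hx]
        rw [← sameCycle_apply_left, this]
      refine ⟨x, ?_, ?_, ?_, ?_⟩
      · rw [← hs0, hx, hd, hf]
      · rintro rfl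
        exact hdf (hx.symm.trans hσ₀f)
      · exact fun h2 => hnd (h1.symm.trans (h2.trans h'))
      · intro a ha haf
        rcases hor a ha haf with h2 | h2
        exacts [Or.inl (h2.trans h1.symm), Or.inr (h2.trans h'.symm)]
  have hrot : G.IsRotation (σ₀ * swap x f) := hσ.move hp hxv hxf
  set r := ρ₁ x with hr
  have hrff : r ≠ f := fun h1 => hxf (by rw [← hρρ x, ← hr, h1, hρ₁f])
  have hrfr : r ≠ G.rev f := fun h1 => hxn (h1 ▸ SameCycle.refl _ _)
  -- Rewritten as two successive merges: the fixed point `f` joins the part of `rev f`, and the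
  -- result joins the part of `r`.
  have hfin : σ₀ * swap x f * G.partialRev (ε ⁻¹' (insert (ε f) (insert (ε d) F))) =
      φ₁ * swap f (G.rev f) * swap r (G.rev f) := by
    rw [partialRev_insert hε hmF'', ← mul_assoc, mul_swap_mul_partialRev, ← hρ₁, hρ₁f, ← hr, ← hφ₁]
    have h1 := mul_swap_eq_swap_mul (swap f (G.rev f)) r (G.rev f)
    rw [swap_apply_of_ne_of_ne hrff hrfr, swap_apply_right] at h1
    rw [mul_assoc, ← h1, ← mul_assoc]
  have hff : ¬ SameCycle φ₁ f (G.rev f) := fun h1 => hrf (h1.eq_of_left hφ₁f).symm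
  have hrn : ¬ SameCycle (φ₁ * swap f (G.rev f)) r (G.rev f) := fun h1 =>
    hxn (h1.of_mul_swap (fun h2 => hrff (h2.eq_of_right hφ₁f)) hxn)
  have hff' := sameCycle_mul_swap_of_not hff
  have key : ∀ a, G.src a ∈ U →
      SameCycle (φ₁ * swap f (G.rev f) * swap r (G.rev f)) a r := by
    intro a ha
    apply sameCycle_mul_swap_merge hrn
    by_cases haf : a = f
    · exact Or.inr (haf ▸ hff')
    by_cases har : SameCycle φ₁ a (G.rev f)
    · exact Or.inr ((sameCycle_mul_swap_merge hff (Or.inr har)).trans hff')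
    · have h1 := (hxor a ha haf).resolve_right har
      exact Or.inl (h1.mul_swap_of_not (fun h2 => haf (h2.eq_of_right hφ₁f)) har)
  rw [Set.insert_comm]
  refine ⟨h.nonempty, h.connected, ?_, ?_, σ₀ * swap x f, hrot, ?_⟩
  · intro a ha
    rcases ha with ha | ha | ha
    · rcases (hε _ _).1 ha with rfl | rfl
      exacts [hfU, hy]
    · rcases (hε _ _).1 ha with rfl | rfl
      exacts [hdU, hx]
    · exact h.src_mem a ha
  · obtain ⟨g, hg⟩ := h.card
    refine ⟨g + 1, ?_⟩
    rw [ncard_preimage_insert hε hmF'', ncard_preimage_insert hε hmF]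
    omega
  · rw [hfin]
    intro a b ha hb
    exact (key a ha).trans (key b hb).symm

variable [Finite V]

/-- Any vertex provides a face: through one of its darts, or as an isolated vertex with its trivial
facial walk. Euler's formula then gives `2 g ≤ β`. -/
theorem le_betti_of_embedsInGenus (hV : Nonempty V) {g : ℕ} (hg : G.EmbedsInGenus g) :
    (g : ℤ) ≤ G.betti / 2 := by
  obtain ⟨σ, hσ, h⟩ := hg
  have hF : 1 ≤ G.numFaces σ := by
    obtain ⟨v⟩ := hV
    unfold numFaces
    by_cases hv : ∀ d, G.src d ≠ v
    · have : 0 < Nat.card {v : V // ∀ d, G.src d ≠ v} := by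
        have : Nonempty {v : V // ∀ d, G.src d ≠ v} := ⟨⟨v, hv⟩⟩
        exact Nat.card_pos
      omega
    · push Not at hv
      obtain ⟨d, -⟩ := hv
      have : 0 < Nat.card (Quotient (SameCycle.setoid (G.facePerm σ))) := by
        have : Nonempty (Quotient (SameCycle.setoid (G.facePerm σ))) := ⟨Quotient.mk _ d⟩
        exact Nat.card_pos
      omega
  have hF' : (1 : ℤ) ≤ (G.numFaces σ : ℤ) := by exact_mod_cast hF
  unfold betti
  omega

/-- A graph with a unicellular embedding, possibly after the removal of one edge, is
upper-embeddable. -/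
theorem Unicellular.upperEmbeddable (hε : G.IsEdgeLabel ε) (h : G.Unicellular ε Set.univ F)
    (hF : ∀ d d', ε d ∉ F → ε d' ∉ F → ε d = ε d') : G.UpperEmbeddable := by
  classical
  obtain ⟨v₀, -⟩ := h.nonempty
  have hV : Nonempty V := ⟨v₀⟩
  refine ⟨⟨hV, fun u v => h.connected u trivial v trivial⟩, ?_⟩
  suffices hg : ∃ g : ℕ, G.EmbedsInGenus g ∧ (g : ℤ) = G.betti / 2 by
    obtain ⟨g, hg, hb⟩ := hg
    refine ⟨g, ⟨hg, fun g' hg' => ?_⟩, hb⟩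
    have := le_betti_of_embedsInGenus hV hg'
    rw [← hb] at this
    exact_mod_cast this
  obtain ⟨g, hg⟩ := h.card
  obtain ⟨σ, hσ, hc⟩ := h.rotation
  rw [Set.ncard_univ] at hg
  have hiso : Nonempty D → Nat.card {v : V // ∀ d, G.src d ≠ v} = 0 := by
    rintro ⟨d⟩
    have : IsEmpty {v : V // ∀ d, G.src d ≠ v} := by
      refine ⟨fun ⟨v, hv⟩ => ?_⟩
      rcases (h.connected v trivial (G.src d) trivial).cases_head with h' | ⟨_, ⟨d', h', -⟩, -⟩
      exacts [hv d h'.symm, hv d' h']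
    exact Nat.card_of_isEmpty
  refine ⟨g, ?_⟩
  -- A missing edge splits the face, giving two faces and `β = 2 g + 1`; otherwise there is one face
  -- and `β = 2 g`.
  by_cases hex : ∃ d, ε d ∉ F
  · obtain ⟨d, hd⟩ := hex
    have huniv : ε ⁻¹' (insert (ε d) F) = Set.univ := by
      ext a
      simp only [Set.mem_preimage, Set.mem_insert_iff, Set.mem_univ, iff_true]
      by_cases ha : ε a ∈ F
      exacts [Or.inr ha, Or.inl (hF a d ha hd)]
    have hcard : Nat.card D + 2 = 2 * Nat.card V + 4 * g + 2 := by
      rw [← Set.ncard_univ, ← huniv, ncard_preimage_insert hε hd, hg]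
    have hrev : G.partialRev Set.univ = G.revPerm := by ext a; simp [partialRev, revPerm]
    have hface : G.facePerm σ = σ * G.partialRev (ε ⁻¹' F) * swap d (G.rev d) := by
      rw [facePerm, ← hrev, ← huniv, partialRev_insert hε hd, mul_assoc]
    have hfaces : G.numFaces σ = 2 := by
      have h1 : Nat.card (Quotient (SameCycle.setoid (G.facePerm σ))) = 2 := by
        rw [Nat.card_eq_two_iff]
        refine ⟨Quotient.mk _ d, Quotient.mk _ (G.rev d), ?_, ?_⟩
        · intro h1
          have h2 : SameCycle (G.facePerm σ) d (G.rev d) := Quotient.exact h1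
          rw [hface] at h2
          exact (hc d (G.rev d) trivial trivial).not_mul_swap (G.rev_ne d).symm h2
        · ext q
          simp only [Set.mem_insert_iff, Set.mem_singleton_iff, Set.mem_univ, iff_true]
          induction q using Quotient.inductionOn with
          | h a =>
            have := (hc a d trivial trivial).mul_swap_or (G.rev d)
            rw [← hface] at this
            exact this.imp (fun h => Quotient.sound h) (fun h => Quotient.sound h)
      rw [numFaces, h1, hiso ⟨d⟩]
    have hE : G.numEdges = Nat.card V + 2 * g := by unfold numEdges; omega
    refine ⟨⟨σ, hσ, ?_⟩, ?_⟩
    · rw [hfaces, hE]; push_cast; ring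
    · unfold betti; rw [hE]; push_cast; omega
  · push Not at hex
    have huniv : ε ⁻¹' F = Set.univ := by ext a; simp [hex a]
    rw [huniv, Set.ncard_univ] at hg
    have hrev : G.partialRev Set.univ = G.revPerm := by ext a; simp [partialRev, revPerm]
    have hface : G.facePerm σ = σ * G.partialRev (ε ⁻¹' F) := by
      rw [facePerm, ← hrev, ← huniv]
    have hfaces : G.numFaces σ = 1 := by
      -- Without darts, the edge count forces a single vertex, and its trivial facial walk is the
      -- only face.
      rcases isEmpty_or_nonempty D with hD | ⟨⟨d⟩⟩
      · have h1 : Nat.card (Quotient (SameCycle.setoid (G.facePerm σ))) = 0 := by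
          have : IsEmpty (Quotient (SameCycle.setoid (G.facePerm σ))) :=
            ⟨fun q => Quotient.inductionOn q fun a => hD.elim a⟩
          exact Nat.card_of_isEmpty
        have h2 : Nat.card {v : V // ∀ d, G.src d ≠ v} = Nat.card V :=
          Nat.card_congr (Equiv.subtypeUnivEquiv fun v d => hD.elim d)
        rw [Nat.card_of_isEmpty (α := D)] at hg
        have : 0 < Nat.card V := Nat.card_pos
        rw [numFaces, h1, h2]
        omega
      · have h1 : Nat.card (Quotient (SameCycle.setoid (G.facePerm σ))) = 1 := by
          rw [Nat.card_eq_one_iff_unique]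
          refine ⟨⟨fun p q => ?_⟩, ⟨Quotient.mk _ d⟩⟩
          induction p, q using Quotient.inductionOn₂ with
          | h a b =>
            apply Quotient.sound
            show SameCycle _ a b
            rw [hface]
            exact hc a b trivial trivial
        rw [numFaces, h1, hiso ⟨d⟩]
    have : 0 < Nat.card V := Nat.card_pos
    have hE : G.numEdges + 1 = Nat.card V + 2 * g := by unfold numEdges; omega
    refine ⟨⟨σ, hσ, ?_⟩, ?_⟩
    · rw [hfaces]; push_cast; omega
    · unfold betti; omega

end DartGraph

/-! ### Pairing edges, and growing trees -/

/-- `M` is partitioned into pairs of adjacent edges, where `J m u w` says that the edge `m` joins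
`u` and `w`. -/
inductive Paired {V E : Type*} (J : E → V → V → Prop) : Set E → Prop
  | empty : Paired J ∅
  | insert {M : Set E} {m m' : E} {v x y : V} : Paired J M → J m v x → J m' v y → m ≠ m' →
      m ∉ M → m' ∉ M → Paired J (insert m (insert m' M))

/-- The vertex set `W` and the edge set `T` of a tree with root `r` that is built by adding pendant
edges. -/
inductive TreeGrow {V E : Type*} (J : E → V → V → Prop) (r : V) : Set V → Set E → Prop
  | root : TreeGrow J r {r} ∅
  | insert {W : Set V} {T : Set E} {m : E} {x y : V} : TreeGrow J r W T → J m x y → x ∉ W →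
      y ∈ W → TreeGrow J r (insert x W) (insert m T)

section

variable {V E : Type*} {J : E → V → V → Prop} {M N : Set E}

theorem Paired.union (hM : Paired J M) (hN : Paired J N) (h : Disjoint M N) :
    Paired J (M ∪ N) := by
  induction hM with
  | empty => simpa using hN
  | @insert M m m' v x y _ hm hm' hne hmM hmM' ih =>
    rw [Set.disjoint_insert_left, Set.disjoint_insert_left] at h
    rw [Set.insert_union, Set.insert_union]
    exact (ih h.2.2).insert hm hm' hne (by simp [hmM, h.1]) (by simp [hmM', h.2.1])

theorem Paired.image {V' E' : Type*} {J' : E' → V' → V' → Prop} (hM : Paired J M) (φ : E → E')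
    (p : V → V') (hφ : Set.InjOn φ M) (hJ : ∀ m ∈ M, ∀ u w, J m u w → J' (φ m) (p u) (p w)) :
    Paired J' (φ '' M) := by
  induction hM with
  | empty => simpa using Paired.empty
  | @insert M m m' v x y _ hm hm' hne hmM hmM' ih =>
    have hsub : M ⊆ Insert.insert m (Insert.insert m' M) := fun a ha => Or.inr (Or.inr ha)
    rw [Set.image_insert_eq, Set.image_insert_eq]
    refine (ih (hφ.mono hsub) fun a ha => hJ a (hsub ha)).insert (hJ m (by simp) _ _ hm)
      (hJ m' (by simp) _ _ hm') ?_ ?_ ?_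
    · exact fun h => hne (hφ (by simp) (by simp) h)
    · rintro ⟨a, ha, h⟩
      exact hmM (hφ (hsub ha) (by simp) h ▸ ha)
    · rintro ⟨a, ha, h⟩
      exact hmM' (hφ (hsub ha) (by simp) h ▸ ha)

theorem Paired.mono {J' : E → V → V → Prop} (hM : Paired J M)
    (hJ : ∀ m u w, J m u w → J' m u w) : Paired J' M := by
  simpa using hM.image (J' := J') id id (Set.injOn_id _) fun m _ => hJ m

/-- An even number of edges with a common end can be paired. -/
theorem paired_star (r : V) (hM : M.Finite) (hJ : ∀ m ∈ M, ∃ x, J m r x) (he : Even M.ncard) :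
    Paired J M := by
  obtain ⟨k, hk⟩ := he
  induction k generalizing M with
  | zero =>
    rw [(Set.ncard_eq_zero hM).1 (by omega)]
    exact .empty
  | succ k ih =>
    obtain ⟨m, hm⟩ : M.Nonempty := (Set.ncard_pos hM).1 (by omega)
    have h1 := Set.ncard_sdiff_singleton_add_one hm hM
    obtain ⟨m', hm', hne⟩ : (M \ {m}).Nonempty := (Set.ncard_pos hM.sdiff).1 (by omega)
    have h2 := Set.ncard_sdiff_singleton_add_one (s := M \ {m}) ⟨hm', hne⟩ hM.sdiff
    obtain ⟨x, hx⟩ := hJ m hm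
    obtain ⟨y, hy⟩ := hJ m' hm'
    have h3 := ih (M := (M \ {m}) \ {m'}) hM.sdiff.sdiff (fun a ha => hJ a ha.1.1) (by omega)
    have h4 := h3.insert hx hy (Ne.symm hne) (by simp) (by simp)
    rwa [Set.insert_sdiff_singleton, Set.insert_eq_of_mem (show m' ∈ M \ {m} from ⟨hm', hne⟩),
      Set.insert_sdiff_singleton, Set.insert_eq_of_mem hm] at h4

theorem paired_family {ι : Type*} {I : Set ι} (hI : I.Finite) (a b : ι → E) (v x y : ι → V)
    (ha : ∀ i ∈ I, J (a i) (v i) (x i)) (hb : ∀ i ∈ I, J (b i) (v i) (y i))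
    (hai : Set.InjOn a I) (hbi : Set.InjOn b I) (hab : ∀ i ∈ I, ∀ j ∈ I, a i ≠ b j) :
    Paired J (a '' I ∪ b '' I) := by
  induction I, hI using Set.Finite.induction_on with
  | empty => simpa using Paired.empty
  | @insert i I hi _ ih =>
    have hsub := Set.subset_insert i I
    have h1 := ih (fun j hj => ha j (hsub hj)) (fun j hj => hb j (hsub hj)) (hai.mono hsub)
      (hbi.mono hsub) fun j hj k hk => hab j (hsub hj) k (hsub hk)
    have h2 := h1.insert (ha i (by simp)) (hb i (by simp)) (hab i (by simp) i (by simp)) ?_ ?_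
    · convert h2 using 1
      rw [Set.image_insert_eq, Set.image_insert_eq]
      ext; simp only [Set.mem_union, Set.mem_insert_iff]; tauto
    · rintro (⟨j, hj, h⟩ | ⟨j, hj, h⟩)
      · exact hi (hai (hsub hj) (by simp) h ▸ hj)
      · exact hab i (by simp) j (hsub hj) h.symm
    · rintro (⟨j, hj, h⟩ | ⟨j, hj, h⟩)
      · exact hab j (hsub hj) i (by simp) h
      · exact hi (hbi (hsub hj) (by simp) h ▸ hj)

theorem TreeGrow.mem_root {r : V} {W : Set V} {T : Set E} (h : TreeGrow J r W T) : r ∈ W := by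
  induction h with
  | root => rfl
  | insert _ _ _ _ ih => exact Or.inr ih

end

namespace SimpleGraph

variable {V : Type*} {H : SimpleGraph V}

/-- The edge `m` of `H` joins `u` and `w`. -/
def Link (H : SimpleGraph V) (m : Sym2 V) (u w : V) : Prop := H.Adj u w ∧ m = s(u, w)

variable {r : V} {W : Set V} {T : Set (Sym2 V)}

theorem _root_.TreeGrow.subset_edgeSet (h : TreeGrow H.Link r W T) :
    T ⊆ H.edgeSet := by
  induction h with
  | root => simp
  | insert _ hm _ _ ih =>
    rintro a (rfl | ha)
    · rw [hm.2]; exact hm.1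
    · exact ih ha

theorem _root_.TreeGrow.mem_of_mem (h : TreeGrow H.Link r W T) {e : Sym2 V}
    (he : e ∈ T) {a : V} (ha : a ∈ e) : a ∈ W := by
  induction h with
  | root => simp at he
  | insert _ hm _ hy ih =>
    rcases he with rfl | he
    · rw [hm.2, Sym2.mem_iff] at ha
      rcases ha with rfl | rfl
      exacts [Or.inl rfl, Or.inr hy]
    · exact Or.inr (ih he)

theorem _root_.TreeGrow.ncard_add_one [Finite V] (h : TreeGrow H.Link r W T) :
    T.ncard + 1 = W.ncard := by
  induction h with
  | root => simp
  | @insert W T m x y h hm hx hy ih =>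
    rw [Set.ncard_insert_of_notMem hx, Set.ncard_insert_of_notMem, ih]
    intro hmT
    exact hx (h.mem_of_mem hmT (by rw [hm.2]; simp))

theorem exists_link_of_mem {e : Sym2 V} (he : e ∈ H.edgeSet) {a : V} (ha : a ∈ e) :
    ∃ b, H.Link e a b := by
  obtain ⟨b, rfl⟩ := ha
  exact ⟨b, he, rfl⟩

/-- The edges of a connected edge set `M` can be paired if their number is even, and otherwise one
edge at a prescribed vertex `r` is left over. Here it is enough that the edges touch the vertex set
of a tree in `M`. -/
theorem paired_of_treeGrow (h : TreeGrow H.Link r W T) {M : Set (Sym2 V)} (hM : M ⊆ H.edgeSet)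
    (hfin : M.Finite) (hT : T ⊆ M) (hW : ∀ m ∈ M, ∃ a ∈ m, a ∈ W) :
    (Even M.ncard → Paired H.Link M) ∧
      (Odd M.ncard → ∃ m₀ ∈ M, r ∈ m₀ ∧ Paired H.Link (M \ {m₀})) := by
  induction h generalizing M with
  | root =>
    have hr : ∀ m ∈ M, r ∈ m := fun m hm => by
      obtain ⟨a, ha, rfl⟩ := hW m hm; exact ha
    have hJ : ∀ m ∈ M, ∃ x, H.Link m r x := fun m hm => exists_link_of_mem (hM hm) (hr m hm)
    refine ⟨paired_star r hfin hJ, fun ho => ?_⟩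
    obtain ⟨m, hm⟩ : M.Nonempty := (Set.ncard_pos hfin).1 ho.pos
    refine ⟨m, hm, hr m hm, paired_star r hfin.sdiff (fun a ha => hJ a ha.1) ?_⟩
    have h1 := Set.ncard_sdiff_singleton_add_one hm hfin
    rw [← h1] at ho
    simpa [Nat.odd_add_one] using ho
  | @insert W T m x y h hm hx hy ih =>
    have hmM : m ∈ M := hT (by simp)
    set S : Set (Sym2 V) := {e ∈ M | x ∈ e} with hS
    have hmS : m ∈ S := ⟨hmM, by rw [hm.2]; simp⟩
    have hSfin : S.Finite := hfin.subset fun a ha => ha.1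
    -- The edges at the last leaf `x` are paired at `x`. If their number is odd, the tree edge `m`
    -- is kept back and handled from its other end `y`, inside the smaller tree.
    obtain ⟨S₀, hS₀, hSS, hSe⟩ : ∃ S₀ ⊆ S, S \ {m} ⊆ S₀ ∧ Even S₀.ncard := by
      by_cases he : Even (S \ {m}).ncard
      · exact ⟨S \ {m}, Set.sdiff_subset, subset_rfl, he⟩
      · refine ⟨S, subset_rfl, Set.sdiff_subset, ?_⟩
        rw [← Set.ncard_sdiff_singleton_add_one hmS hSfin]
        simpa [Nat.even_add_one] using he
    have hP : Paired H.Link S₀ := paired_star x (hSfin.subset hS₀)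
      (fun e he => exists_link_of_mem (hM (hS₀ he).1) (hS₀ he).2) hSe
    have hSM : S₀ ⊆ M := fun a ha => (hS₀ ha).1
    have hcard : (M \ S₀).ncard + S₀.ncard = M.ncard := Set.ncard_sdiff_add_ncard_of_subset hSM hfin
    obtain ⟨ih1, ih2⟩ := ih (M := M \ S₀) (fun a ha => hM ha.1) hfin.sdiff
      (fun a ha => ⟨hT (Or.inr ha), fun ha' => hx (h.mem_of_mem ha (hS₀ ha').2)⟩) (by
        rintro e ⟨heM, heS⟩
        by_cases hxe : x ∈ e
        · have : e = m := by
            by_contra hne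
            exact heS (hSS ⟨⟨heM, hxe⟩, hne⟩)
          exact ⟨y, by rw [this, hm.2]; simp, hy⟩
        · obtain ⟨a, ha, rfl | haW⟩ := hW e heM
          exacts [absurd ha hxe, ⟨a, ha, haW⟩])
    constructor
    · intro he
      have := (ih1 (by rw [← hcard, Nat.even_add] at he; tauto)).union hP Set.disjoint_sdiff_left
      rwa [Set.sdiff_union_of_subset hSM] at this
    · intro ho
      obtain ⟨m₀, hm₀, hr, hp⟩ := ih2 (by
        rw [← hcard, Nat.odd_add] at ho; tauto)
      refine ⟨m₀, hm₀.1, hr, ?_⟩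
      have := hp.union hP (Set.disjoint_sdiff_left.mono_left Set.sdiff_subset)
      convert this using 1
      ext a
      simp only [Set.mem_sdiff, Set.mem_singleton_iff, Set.mem_union]
      by_cases ha : a ∈ S₀
      · have : a ≠ m₀ := fun h' => hm₀.2 (h' ▸ ha)
        simp [ha, hSM ha, this]
      · simp [ha]

/-- A maximal grown tree is spanning: otherwise a walk from `r` to a missed vertex leaves it along
an edge by which it could grow. -/
theorem Connected.exists_treeGrow [Finite V] (hH : H.Connected) (r : V) :
    ∃ T, TreeGrow H.Link r Set.univ T := by
  obtain ⟨W, ⟨T, hT⟩, hmax⟩ := Set.Finite.exists_maximal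
    (s := {W : Set V | ∃ T, TreeGrow H.Link r W T}) (Set.toFinite _) ⟨_, _, .root⟩
  by_cases hW : W = Set.univ
  · exact ⟨T, hW ▸ hT⟩
  obtain ⟨x, hx⟩ := (Set.ne_univ_iff_exists_notMem W).1 hW
  obtain ⟨p⟩ := hH.preconnected r x
  obtain ⟨d, -, hd1, hd2⟩ := p.exists_boundary_dart W hT.mem_root hx
  have hle := hmax ⟨_, hT.insert (m := s(d.snd, d.fst)) ⟨d.adj.symm, rfl⟩ hd2 hd1⟩
    (Set.subset_insert _ _)
  exact absurd (hle (Set.mem_insert _ _)) hd2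

/-- A grown spanning tree has as many edges as the tree itself, so it uses all of them. -/
theorem IsTree.treeGrow [Finite V] (hH : H.IsTree) (r : V) :
    TreeGrow H.Link r Set.univ H.edgeSet := by
  classical
  have := Fintype.ofFinite V
  obtain ⟨T, hT⟩ := hH.connected.exists_treeGrow r
  have h1 := hT.ncard_add_one
  have h2 := hH.card_edgeFinset
  have : T = H.edgeSet := by
    apply Set.eq_of_subset_of_ncard_le hT.subset_edgeSet
    rw [Set.ncard_univ, Nat.card_eq_fintype_card, ← h2] at h1
    rw [← coe_edgeFinset, Set.ncard_coe_finset]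
    omega
  rwa [← this]

theorem isEdgeLabel_edge (H : SimpleGraph V) :
    (DartGraph.ofSimple H).IsEdgeLabel (fun d : H.Dart => d.edge) := fun d d' => by
  rw [dart_edge_eq_iff]; rfl

theorem Link.joins {m : Sym2 V} {u w : V} (h : H.Link m u w) :
    (DartGraph.ofSimple H).Joins (fun d : H.Dart => d.edge) m u w :=
  ⟨⟨(u, w), h.1⟩, h.2.symm, rfl, rfl⟩

end SimpleGraph

namespace DartGraph

variable {V D E : Type*} {G : DartGraph V D} {ε : D → E} {U : Set V} {F M : Set E} [Finite D]

theorem Unicellular.union_paired (hε : G.IsEdgeLabel ε) (h : G.Unicellular ε U F)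
    (hM : Paired (G.Joins ε) M) (hMF : Disjoint M F)
    (hU : ∀ m ∈ M, ∀ u w, G.Joins ε m u w → u ∈ U) : G.Unicellular ε U (F ∪ M) := by
  induction hM with
  | empty => simpa using h
  | @insert M m m' v x y _ hm hm' hne hmM hmM' ih =>
    rw [Set.disjoint_insert_left, Set.disjoint_insert_left] at hMF
    have h1 := ih hMF.2.2 fun a ha => hU a (Or.inr (Or.inr ha))
    have h2 := h1.pair hε hm hm' hne (by simp [hmM, hMF.1]) (by simp [hmM', hMF.2.1])
      (hU m (by simp) _ _ hm) (hU m (by simp) _ _ (hm.symm hε)) (hU m' (by simp) _ _ (hm'.symm hε))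
    rwa [Set.union_insert, Set.union_insert]

/-- Adding several pendant edges. -/
theorem Unicellular.pendants [Finite V] (hε : G.IsEdgeLabel ε) (h : G.Unicellular ε U F)
    {ι : Type*} {I : Set ι} (hI : I.Finite) (m : ι → E) (u w : ι → V)
    (hm : ∀ i ∈ I, G.Joins ε (m i) (u i) (w i)) (hu : ∀ i ∈ I, u i ∈ U)
    (hw : ∀ i ∈ I, w i ∉ U) (hwi : Set.InjOn w I) :
    G.Unicellular ε (U ∪ w '' I) (F ∪ m '' I) := by
  induction I, hI using Set.Finite.induction_on with
  | empty => simpa using h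
  | @insert i I hi _ ih =>
    have hsub := Set.subset_insert i I
    have h1 := ih (fun j hj => hm j (hsub hj)) (fun j hj => hu j (hsub hj))
      (fun j hj => hw j (hsub hj)) (hwi.mono hsub)
    have h2 := h1.pendant hε (hm i (by simp)) (Or.inl (hu i (by simp))) (w := w i) (by
      rintro (h3 | ⟨j, hj, h3⟩)
      · exact hw i (by simp) h3
      · exact hi (hwi (hsub hj) (by simp) h3 ▸ hj))
    rwa [Set.image_insert_eq, Set.image_insert_eq, Set.union_insert, Set.union_insert]

/-- Growing a tree from a vertex of `U`. -/
theorem Unicellular.treeGrow [Finite V] (hε : G.IsEdgeLabel ε) {V' E' : Type*}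
    {J : E' → V' → V' → Prop} {r : V'} {W : Set V'} {T : Set E'} (hT : TreeGrow J r W T)
    (p : V' → V) (φ : E' → E) (hp : Function.Injective p)
    (hJ : ∀ m u w, J m u w → G.Joins ε (φ m) (p u) (p w))
    (h : G.Unicellular ε U F) (hr : p r ∈ U) (hU : ∀ x ∈ W, x ≠ r → p x ∉ U) :
    G.Unicellular ε (U ∪ p '' W) (F ∪ φ '' T) := by
  induction hT with
  | root => simpa [hr] using h
  | @insert W T m x y hT hm hx hy ih =>
    have h1 := ih fun a ha => hU a (Or.inr ha)
    have h2 := h1.pendant hε ((hJ _ _ _ hm).symm hε) (Or.inr ⟨y, hy, rfl⟩) (by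
      rintro (h3 | ⟨a, ha, h3⟩)
      · exact hU x (by simp) (fun h4 => hx (h4 ▸ hT.mem_root)) h3
      · exact hx (hp h3 ▸ ha))
    rwa [Set.image_insert_eq, Set.image_insert_eq, Set.union_insert, Set.union_insert]

end DartGraph

/-! ### Layered graphs -/

/-- `Γ` consists of the layers `0, …, n`, each a copy of `G`, where `p x i` is the vertex `x` of
layer `i`, together with vertical edges between consecutive layers. The edge `e` of layer `i` has
the label `Sum.inl (e, i)`, and the vertical edge between `p x i` and `p x (i + 1)` has the label
`Sum.inr (x, i)`. -/
structure Layered {V X D : Type*} (G : SimpleGraph V) (n : ℕ) (Γ : DartGraph X D)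
    (ε : D → (Sym2 V × ℕ) ⊕ (V × ℕ)) (p : V → ℕ → X) : Prop where
  isEdgeLabel : Γ.IsEdgeLabel ε
  link : ∀ i ≤ n, ∀ e a b, G.Link e a b → Γ.Joins ε (.inl (e, i)) (p a i) (p b i)
  vert : ∀ i < n, ∀ x, Γ.Joins ε (.inr (x, i)) (p x i) (p x (i + 1))
  inj : ∀ i ≤ n, ∀ j ≤ n, ∀ x y, p x i = p y j → x = y ∧ i = j
  surj : ∀ u, ∃ x, ∃ i ≤ n, p x i = u
  labels : ∀ d, (∃ e ∈ G.edgeSet, ∃ i ≤ n, ε d = .inl (e, i)) ∨ ∃ x, ∃ i < n, ε d = .inr (x, i)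

namespace Layered

variable {V X D : Type*} {G : SimpleGraph V} {n : ℕ} {Γ : DartGraph X D}
  {ε : D → (Sym2 V × ℕ) ⊕ (V × ℕ)} {p : V → ℕ → X}

/-- The vertices of the layers `0, …, i`. -/
def verts (p : V → ℕ → X) (i : ℕ) : Set X := {u | ∃ x, ∃ j ≤ i, p x j = u}

/-- The edges within the layers `0, …, i`. -/
def edges (G : SimpleGraph V) (i : ℕ) : Set ((Sym2 V × ℕ) ⊕ (V × ℕ)) :=
  {m | (∃ e ∈ G.edgeSet, ∃ j ≤ i, m = .inl (e, j)) ∨ ∃ x, ∃ j < i, m = .inr (x, j)}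

variable [Finite V] [Finite X] [Finite D]

/-- Adding a layer: the vertices outside of `Z` are attached by the vertical edges, each vertex
`x ∈ Z` by the edge to `q x`, while the vertical edge at `x` is paired with a missing edge `ℓ x`. -/
theorem step (h : Layered G n Γ ε p) {i : ℕ} (hi : i < n)
    {F : Set ((Sym2 V × ℕ) ⊕ (V × ℕ))} (hF : Γ.Unicellular ε (verts p i) F)
    (hFi : F ⊆ edges G i) (Z : Set V) (ℓ : V → Sym2 V) (q : V → V)
    (hℓ : ∀ x ∈ Z, ℓ x ∈ G.edgeSet ∧ x ∈ ℓ x ∧ .inl (ℓ x, i) ∉ F) (hℓi : Set.InjOn ℓ Z)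
    (hq : ∀ x ∈ Z, G.Adj x (q x) ∧ q x ∉ Z) {Q : Set (Sym2 V)} (hQ : Paired G.Link Q)
    (hQG : Q ⊆ G.edgeSet) (hQq : ∀ x ∈ Z, s(x, q x) ∉ Q) :
    ∃ F', Γ.Unicellular ε (verts p (i + 1)) F' ∧ ∀ m, m ∈ F' ↔ m ∈ F ∨ (∃ x, m = .inr (x, i)) ∨
      (∃ x ∈ Z, m = .inl (ℓ x, i)) ∨
        ∃ e, (e ∈ Q ∨ ∃ x ∈ Z, e = s(x, q x)) ∧ m = .inl (e, i + 1) := by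
  have hε := h.isEdgeLabel
  have hpi : ∀ x y, p x (i + 1) = p y (i + 1) → x = y := fun x y hxy =>
    (h.inj _ hi _ hi _ _ hxy).1
  have hnew : ∀ x, p x (i + 1) ∉ verts p i := by
    rintro x ⟨y, j, hj, hxy⟩
    have := (h.inj j (by omega) (i + 1) hi _ _ hxy).2
    omega
  have h1 := hF.pendants hε (Set.toFinite Zᶜ) (fun x => .inr (x, i)) (fun x => p x i)
    (fun x => p x (i + 1)) (fun x _ => h.vert i hi x) (fun x _ => ⟨x, i, le_rfl, rfl⟩)
    (fun x _ => hnew x) (fun x _ y _ hxy => hpi x y hxy)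
  -- Since `q x ∉ Z`, its copy in the new layer has already been attached vertically, so `x` can
  -- hang on it. This frees the vertical edge at `x`.
  have h2 := h1.pendants hε (Set.toFinite Z) (fun x => .inl (s(x, q x), i + 1))
    (fun x => p (q x) (i + 1)) (fun x => p x (i + 1))
    (fun x hx => h.link _ hi _ _ _ ⟨(hq x hx).1.symm, Sym2.eq_swap⟩)
    (fun x hx => Or.inr ⟨q x, (hq x hx).2, rfl⟩)
    (by
      rintro x hx (h3 | ⟨y, hy, h3⟩)
      · exact hnew x h3
      · exact hy (hpi _ _ h3 ▸ hx)) (fun x _ y _ hxy => hpi x y hxy)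
  have hU : verts p i ∪ (fun x => p x (i + 1)) '' Zᶜ ∪ (fun x => p x (i + 1)) '' Z =
      verts p (i + 1) := by
    rw [Set.union_assoc, ← Set.image_union, Set.compl_union_self, Set.image_univ]
    ext u
    constructor
    · rintro (⟨x, j, hj, rfl⟩ | ⟨x, rfl⟩)
      exacts [⟨x, j, by omega, rfl⟩, ⟨x, i + 1, le_rfl, rfl⟩]
    · rintro ⟨x, j, hj, rfl⟩
      rcases hj.lt_or_eq with hj | rfl
      exacts [Or.inl ⟨x, j, by omega, rfl⟩, Or.inr ⟨x, rfl⟩]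
  rw [hU] at h2
  have hUi : ∀ x, ∀ j ≤ i + 1, p x j ∈ verts p (i + 1) := fun x j hj => ⟨x, j, hj, rfl⟩
  have hJU : ∀ m, (∃ a b, Γ.Joins ε m a b ∧ a ∈ verts p (i + 1) ∧ b ∈ verts p (i + 1)) →
      ∀ u w, Γ.Joins ε m u w → u ∈ verts p (i + 1) := by
    rintro m ⟨_, _, ⟨d, hd, rfl, rfl⟩, ha, hb⟩ _ _ ⟨d', hd', rfl, rfl⟩
    rcases (hε d' d).1 (hd'.trans hd.symm) with rfl | rfl
    exacts [ha, hb]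
  have hℓ' : ∀ x : V, ∃ y, x ∈ Z → G.Link (ℓ x) x y := by
    intro x
    by_cases hx : x ∈ Z
    · obtain ⟨y, hy⟩ := SimpleGraph.exists_link_of_mem (hℓ x hx).1 (hℓ x hx).2.1
      exact ⟨y, fun _ => hy⟩
    · exact ⟨x, fun h => absurd h hx⟩
  choose y hy using hℓ'
  -- The freed vertical edge and the missing edge `ℓ x` meet at the copy of `x` in layer `i`.
  have hP : Paired (Γ.Joins ε) ((fun x => .inl (ℓ x, i)) '' Z ∪ (fun x => .inr (x, i)) '' Z) :=
    paired_family (Set.toFinite Z) _ _ (fun x => p x i) (fun x => p (y x) i)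
      (fun x => p x (i + 1)) (fun x hx => h.link i hi.le _ _ _ (hy x hx))
      (fun x _ => h.vert i hi x) (fun a ha b hb hab => hℓi ha hb (by simpa using hab))
      (fun a _ b _ hab => by simpa using hab) (by simp)
  have h3 := h2.union_paired hε hP (by
    rw [Set.disjoint_left]
    rintro _ (⟨x, hx, rfl⟩ | ⟨x, hx, rfl⟩) hm
    · have := (hℓ x hx).2.2
      simp_all
    · rcases hm with (hm | hm) | hm
      · have := hFi hm
        simp [edges] at this
      · simp_all
      · simp_all) (by
    rintro m (⟨x, hx, rfl⟩ | ⟨x, hx, rfl⟩) <;> refine hJU _ ?_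
    · exact ⟨_, _, h.link i hi.le _ _ _ (hy x hx), hUi _ _ (by omega), hUi _ _ (by omega)⟩
    · exact ⟨_, _, h.vert i hi x, hUi _ _ (by omega), hUi _ _ (by omega)⟩)
  have hP' : Paired (Γ.Joins ε) ((fun e => .inl (e, i + 1)) '' Q) :=
    hQ.image _ (fun x => p x (i + 1)) (fun a _ b _ hab => by simpa using hab)
      fun e _ a b hab => h.link _ hi _ _ _ hab
  have h4 := h3.union_paired hε hP' (by
    rw [Set.disjoint_left]
    rintro _ ⟨e, he, rfl⟩ (((hm | hm) | hm) | hm)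
    · have := hFi hm
      simp [edges] at this
    · simp_all
    · obtain ⟨x, hx, hxe⟩ := hm
      simp only [Sum.inl.injEq, Prod.mk.injEq, and_true] at hxe
      exact hQq x hx (hxe ▸ he)
    · simp_all) (by
    rintro m ⟨e, he, rfl⟩
    refine hJU _ ?_
    induction e using Sym2.inductionOn with
    | hf a b => exact ⟨_, _, h.link _ hi _ a b ⟨hQG he, rfl⟩, hUi _ _ le_rfl, hUi _ _ le_rfl⟩)
  refine ⟨_, h4, fun m => ?_⟩
  simp only [Set.mem_union, Set.mem_image, Set.mem_compl_iff]
  constructor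
  · rintro ((((hm | ⟨x, hx, rfl⟩) | ⟨x, hx, rfl⟩) | (⟨x, hx, rfl⟩ | ⟨x, hx, rfl⟩)) | ⟨e, he, rfl⟩)
    · exact Or.inl hm
    · exact Or.inr (Or.inl ⟨x, rfl⟩)
    · exact Or.inr (Or.inr (Or.inr ⟨_, Or.inr ⟨x, hx, rfl⟩, rfl⟩))
    · exact Or.inr (Or.inr (Or.inl ⟨x, hx, rfl⟩))
    · exact Or.inr (Or.inl ⟨x, rfl⟩)
    · exact Or.inr (Or.inr (Or.inr ⟨_, Or.inl he, rfl⟩))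
  · rintro (hm | ⟨x, rfl⟩ | ⟨x, hx, rfl⟩ | ⟨e, he | ⟨x, hx, rfl⟩, rfl⟩)
    · exact Or.inl (Or.inl (Or.inl (Or.inl hm)))
    · by_cases hx : x ∈ Z
      · exact Or.inl (Or.inr (Or.inr ⟨x, hx, rfl⟩))
      · exact Or.inl (Or.inl (Or.inl (Or.inr ⟨x, hx, rfl⟩)))
    · exact Or.inl (Or.inr (Or.inl ⟨x, hx, rfl⟩))
    · exact Or.inr ⟨e, he, rfl⟩
    · exact Or.inl (Or.inl (Or.inr ⟨x, hx, rfl⟩))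

/-- The first `i + 1` layers have a unicellular embedding from which at most one edge is missing;
it belongs to the last layer if `G` has an odd number of edges. -/
def Nearly (G : SimpleGraph V) (Γ : DartGraph X D) (ε : D → (Sym2 V × ℕ) ⊕ (V × ℕ))
    (p : V → ℕ → X) (i : ℕ) : Prop :=
  ∃ F, Γ.Unicellular ε (verts p i) F ∧ F ⊆ edges G i ∧
    (edges G i ⊆ F ∨ ∃ e ∈ G.edgeSet, ∃ j ≤ i, .inl (e, j) ∉ F ∧
      edges G i ⊆ insert (.inl (e, j)) F ∧ (Odd G.edgeSet.ncard → j = i))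

/-- Layer 0 alone may miss many edges, but they can be taken to form a matching `L`, and layer 1
repairs all of them at once. The remaining edges of layer 1 include a copy of the spanning tree, so
they can be paired with at most one exception. -/
theorem nearly_one (h : Layered G n Γ ε p) (hG : G.Connected) (hn : 1 ≤ n) :
    Nearly G Γ ε p 1 := by
  have hε := h.isEdgeLabel
  obtain ⟨r⟩ := hG.nonempty
  obtain ⟨T, hT⟩ := hG.exists_treeGrow r
  have hTG := hT.subset_edgeSet
  have h0 := (DartGraph.Unicellular.single Γ ε (p r 0)).treeGrow hε hT (fun x => p x 0)
    (fun e => .inl (e, 0)) (fun x y hxy => (h.inj 0 (by omega) 0 (by omega) x y hxy).1)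
    (fun m u w hm => h.link 0 (by omega) m u w hm) rfl
    (fun x _ hx hx' => hx (h.inj 0 (by omega) 0 (by omega) x r hx').1)
  have hU0 : {p r 0} ∪ (fun x => p x 0) '' Set.univ = verts p 0 := by
    ext u
    simp only [Set.image_univ, verts, nonpos_iff_eq_zero, exists_eq_left, Set.mem_ofPred_eq]
    constructor
    · rintro (rfl | ⟨x, rfl⟩)
      exacts [⟨r, rfl⟩, ⟨x, rfl⟩]
    · rintro ⟨x, rfl⟩
      exact Or.inr ⟨x, rfl⟩
  rw [hU0, Set.empty_union] at h0
  obtain ⟨P, ⟨hP, hPT⟩, hmax⟩ := Set.Finite.exists_maximal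
    (s := {P : Set (Sym2 V) | Paired G.Link P ∧ P ⊆ G.edgeSet \ T}) (Set.toFinite _)
    ⟨∅, .empty, Set.empty_subset _⟩
  set L := (G.edgeSet \ T) \ P with hL
  -- Two adjacent edges left over would enlarge the maximal paired set `P`.
  have hmatch : ∀ e ∈ L, ∀ e' ∈ L, ∀ x, x ∈ e → x ∈ e' → e = e' := by
    intro e he e' he' x hx hx'
    by_contra hne
    obtain ⟨a, ha⟩ := SimpleGraph.exists_link_of_mem he.1.1 hx
    obtain ⟨b, hb⟩ := SimpleGraph.exists_link_of_mem he'.1.1 hx'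
    have hle := hmax ⟨hP.insert ha hb hne he.2 he'.2,
      Set.insert_subset he.1 (Set.insert_subset he'.1 hPT)⟩
      ((Set.subset_insert _ _).trans (Set.subset_insert _ _))
    exact he.2 (hle (Set.mem_insert _ _))
  have h1 := h0.union_paired hε (hP.image (fun e => .inl (e, 0)) (fun x => p x 0)
    (fun a _ b _ hab => by simpa using hab) fun e _ a b hab => h.link 0 (by omega) _ _ _ hab) (by
      rw [Set.disjoint_left]
      rintro _ ⟨e, he, rfl⟩ ⟨e', he', hee⟩
      simp only [Sum.inl.injEq, Prod.mk.injEq, and_true] at hee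
      exact (hPT he).2 (hee ▸ he')) (by
      rintro _ ⟨e, he, rfl⟩ _ _ ⟨d', hd', rfl, rfl⟩
      induction e using Sym2.inductionOn with
      | hf a b =>
        obtain ⟨d, hd, ha, hb⟩ := h.link 0 (by omega) _ a b ⟨(hPT he).1, rfl⟩
        rcases (hε d' d).1 (hd'.trans hd.symm) with rfl | rfl
        exacts [⟨a, 0, le_rfl, ha.symm⟩, ⟨b, 0, le_rfl, hb.symm⟩])
  rw [← Set.image_union] at h1
  -- `Z` takes one end of each matching edge; at `x ∈ Z`, this edge will be `ℓ x` and its other end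
  -- `q x`.
  set Z : Set V := (fun e : Sym2 V => e.out.1) '' L with hZ
  have hex : ∀ x : V, ∃ (e : Sym2 V) (y : V), x ∈ Z → e ∈ L ∧ G.Link e x y ∧ y ∉ Z := by
    intro x
    by_cases hx : x ∈ Z
    · obtain ⟨e, he, rfl⟩ := hx
      obtain ⟨y, hy⟩ := SimpleGraph.exists_link_of_mem he.1.1 e.out_fst_mem
      refine ⟨e, y, fun _ => ⟨he, hy, ?_⟩⟩
      rintro ⟨e', he', hee⟩
      have hye : y ∈ e := by rw [hy.2]; simp
      have hye' : y ∈ e' := by rw [← hee]; exact e'.out_fst_mem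
      obtain rfl := hmatch e he e' he' y hye hye'
      exact hy.1.ne hee
    · exact ⟨s(x, x), x, fun h => absurd h hx⟩
  choose ℓ q hℓq using hex
  have hLℓ : ∀ e ∈ L, ∃ x ∈ Z, ℓ x = e := by
    intro e he
    have hx : e.out.1 ∈ Z := ⟨e, he, rfl⟩
    refine ⟨_, hx, hmatch _ (hℓq _ hx).1 _ he e.out.1 ?_ e.out_fst_mem⟩
    rw [(hℓq _ hx).2.1.2]; simp
  have hTL : T ⊆ G.edgeSet \ L := fun e he => ⟨hTG he, fun h' => h'.1.2 he⟩
  obtain ⟨hev, hod⟩ := SimpleGraph.paired_of_treeGrow hT (M := G.edgeSet \ L) Set.sdiff_subset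
    (Set.toFinite _) hTL (fun m _ => ⟨m.out.1, m.out_fst_mem, trivial⟩)
  obtain ⟨Q, hQ, hQG, hQmiss⟩ : ∃ Q, Paired G.Link Q ∧ Q ⊆ G.edgeSet \ L ∧
      (Q = G.edgeSet \ L ∨ ∃ m₀ ∈ G.edgeSet \ L, Q = (G.edgeSet \ L) \ {m₀}) := by
    rcases Nat.even_or_odd (G.edgeSet \ L).ncard with he | ho
    · exact ⟨_, hev he, subset_rfl, Or.inl rfl⟩
    · obtain ⟨m₀, hm₀, -, hp⟩ := hod ho
      exact ⟨_, hp, Set.sdiff_subset, Or.inr ⟨m₀, hm₀, rfl⟩⟩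
  have hF0 : (fun e => Sum.inl (e, 0)) '' (T ∪ P) ⊆ edges G 0 := by
    rintro _ ⟨e, he, rfl⟩
    exact Or.inl ⟨e, he.elim (fun h => hTG h) (fun h => (hPT h).1), 0, le_rfl, rfl⟩
  obtain ⟨F, hF, hmem⟩ := h.step hn h1 hF0 Z ℓ q
    (fun x hx => ⟨(hℓq x hx).1.1.1, by rw [(hℓq x hx).2.1.2]; simp, by
      rintro ⟨e, he, hee⟩
      simp only [Sum.inl.injEq, Prod.mk.injEq, and_true] at hee
      have := (hℓq x hx).1
      rw [← hee] at this
      exact he.elim this.1.2 this.2⟩)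
    (by
      intro x hx y hy hxy
      have h1 := (hℓq x hx).2.1.2
      rw [hxy, (hℓq y hy).2.1.2] at h1
      rcases Sym2.eq_iff.1 h1 with h2 | h2
      · exact h2.1.symm
      · exact absurd hx (h2.2 ▸ (hℓq y hy).2.2))
    (fun x hx => ⟨(hℓq x hx).2.1.1, (hℓq x hx).2.2⟩) hQ (hQG.trans Set.sdiff_subset)
    (fun x hx hmem => (hQG hmem).2 ((hℓq x hx).2.1.2 ▸ (hℓq x hx).1))
  have hfZ : ∀ x ∈ Z, s(x, q x) ∈ L := fun x hx => (hℓq x hx).2.1.2 ▸ (hℓq x hx).1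
  have hLf : ∀ e ∈ L, ∃ x ∈ Z, e = s(x, q x) := by
    intro e he
    obtain ⟨x, hx, rfl⟩ := hLℓ e he
    exact ⟨x, hx, (hℓq x hx).2.1.2⟩
  refine ⟨F, hF, ?_, ?_⟩
  · intro m hm
    rcases (hmem m).1 hm with hm | ⟨x, rfl⟩ | ⟨x, hx, rfl⟩ | ⟨e, he, rfl⟩
    · rcases hF0 hm with ⟨e, he, j, hj, rfl⟩ | ⟨x, j, hj, rfl⟩
      exacts [Or.inl ⟨e, he, j, by omega, rfl⟩, Or.inr ⟨x, j, by omega, rfl⟩]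
    · exact Or.inr ⟨x, 0, by omega, rfl⟩
    · exact Or.inl ⟨_, (hℓq x hx).1.1.1, 0, by omega, rfl⟩
    · refine Or.inl ⟨e, ?_, 1, le_rfl, rfl⟩
      rcases he with he | ⟨x, hx, rfl⟩
      exacts [(hQG he).1, (hfZ x hx).1.1]
  · have hcov : ∀ m ∈ edges G 1, m ∈ F ∨ ∃ e ∈ G.edgeSet, m = .inl (e, 1) := by
      rintro m (⟨e, he, j, hj, rfl⟩ | ⟨x, j, hj, rfl⟩)
      · rcases hj.lt_or_eq with hj | rfl
        · obtain rfl : j = 0 := by omega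
          left
          rw [hmem]
          by_cases heL : e ∈ L
          · obtain ⟨x, hx, rfl⟩ := hLℓ e heL
            exact Or.inr (Or.inr (Or.inl ⟨x, hx, rfl⟩))
          · refine Or.inl ⟨e, ?_, rfl⟩
            by_cases heT : e ∈ T
            · exact Or.inl heT
            · right
              by_contra heP
              exact heL ⟨⟨he, heT⟩, heP⟩
        · exact Or.inr ⟨e, he, rfl⟩
      · obtain rfl : j = 0 := by omega
        exact Or.inl ((hmem _).2 (Or.inr (Or.inl ⟨x, rfl⟩)))
    have hcov1 : ∀ e ∈ G.edgeSet, e ∈ L ∨ e ∈ Q → .inl (e, 1) ∈ F := by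
      rintro e he (heL | heQ)
      · exact (hmem _).2 (Or.inr (Or.inr (Or.inr ⟨e, Or.inr (hLf e heL), rfl⟩)))
      · exact (hmem _).2 (Or.inr (Or.inr (Or.inr ⟨e, Or.inl heQ, rfl⟩)))
    rcases hQmiss with rfl | ⟨m₀, hm₀, rfl⟩
    · left
      intro m hm
      rcases hcov m hm with hm | ⟨e, he, rfl⟩
      · exact hm
      · exact hcov1 e he (by by_cases heL : e ∈ L; exacts [Or.inl heL, Or.inr ⟨he, heL⟩])
    · right
      refine ⟨m₀, hm₀.1, 1, le_rfl, ?_, ?_, fun _ => rfl⟩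
      · rw [hmem]
        rintro (hm | ⟨x, hx⟩ | ⟨x, hx, hx'⟩ | ⟨e, he, hee⟩)
        · have := hF0 hm
          simp [edges] at this
        · simp at hx
        · simp at hx'
        · simp only [zero_add, Sum.inl.injEq, Prod.mk.injEq, and_true] at hee
          subst hee
          rcases he with he | ⟨x, hx, he⟩
          · exact he.2 rfl
          · exact hm₀.2 (he ▸ hfZ x hx)
      · intro m hm
        rcases hcov m hm with hm | ⟨e, he, rfl⟩
        · exact Or.inr hm
        · by_cases hee : e = m₀
          · exact Or.inl (by rw [hee])
          · exact Or.inr (hcov1 e he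
              (by by_cases heL : e ∈ L; exacts [Or.inl heL, Or.inr ⟨⟨he, heL⟩, hee⟩]))

/-- If `G` has an even number of edges, the new layer is paired completely and an old missing edge
stays missing. If the number is odd, each new layer has one surplus edge: it becomes the missing
edge if there was none, and otherwise it serves to absorb the one from the layer before. This is why
`Nearly` records the layer of the missing edge in the odd case. -/
theorem nearly_succ (h : Layered G n Γ ε p) (hG : G.Connected) {i : ℕ} (hi : i < n)
    (ih : Nearly G Γ ε p i) : Nearly G Γ ε p (i + 1) := by
  obtain ⟨F, hF, hFi, hmiss⟩ := ih
  have hce : ∀ r, (Even G.edgeSet.ncard → Paired G.Link G.edgeSet) ∧ (Odd G.edgeSet.ncard →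
      ∃ m₀ ∈ G.edgeSet, r ∈ m₀ ∧ Paired G.Link (G.edgeSet \ {m₀})) := by
    intro r
    obtain ⟨T, hT⟩ := hG.exists_treeGrow r
    exact SimpleGraph.paired_of_treeGrow hT subset_rfl (Set.toFinite _) hT.subset_edgeSet
      (fun m _ => ⟨m.out.1, m.out_fst_mem, trivial⟩)
  have hsub : ∀ m ∈ edges G i, m ∈ edges G (i + 1) := by
    rintro m (⟨e, he, j, hj, rfl⟩ | ⟨x, j, hj, rfl⟩)
    exacts [Or.inl ⟨e, he, j, by omega, rfl⟩, Or.inr ⟨x, j, by omega, rfl⟩]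
  have hcov : ∀ m ∈ edges G (i + 1), m ∈ edges G i ∨ (∃ x, m = .inr (x, i)) ∨
      ∃ e ∈ G.edgeSet, m = .inl (e, i + 1) := by
    rintro m (⟨e, he, j, hj, rfl⟩ | ⟨x, j, hj, rfl⟩)
    · rcases hj.lt_or_eq with hj | rfl
      exacts [Or.inl (Or.inl ⟨e, he, j, by omega, rfl⟩), Or.inr (Or.inr ⟨e, he, rfl⟩)]
    · by_cases hji : j = i
      · subst hji; exact Or.inr (Or.inl ⟨x, rfl⟩)
      · exact Or.inl (Or.inr ⟨x, j, by omega, rfl⟩)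
  have plain : ∀ Q ⊆ G.edgeSet, Paired G.Link Q →
      ∃ F', Γ.Unicellular ε (verts p (i + 1)) F' ∧ F' ⊆ edges G (i + 1) ∧
        ∀ m, m ∈ F' ↔ m ∈ F ∨ (∃ x, m = .inr (x, i)) ∨ ∃ e ∈ Q, m = .inl (e, i + 1) := by
    intro Q hQG hQ
    -- With `Z = ∅` all vertices are attached vertically, and the values of `ℓ` and `q` are
    -- irrelevant.
    obtain ⟨F', hF', hmem⟩ := h.step hi hF hFi ∅ (fun x => s(x, x)) id (by simp) (by simp)
      (by simp) hQ hQG (by simp)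
    have hmem' : ∀ m, m ∈ F' ↔ m ∈ F ∨ (∃ x, m = .inr (x, i)) ∨
        ∃ e ∈ Q, m = .inl (e, i + 1) := fun m => by rw [hmem]; simp
    refine ⟨F', hF', ?_, hmem'⟩
    intro m hm
    rcases (hmem' m).1 hm with hm | ⟨x, rfl⟩ | ⟨e, he, rfl⟩
    exacts [hsub m (hFi hm), Or.inr ⟨x, i, by omega, rfl⟩, Or.inl ⟨e, hQG he, i + 1, le_rfl, rfl⟩]
  rcases Nat.even_or_odd G.edgeSet.ncard with he | ho
  · obtain ⟨r⟩ := hG.nonempty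
    obtain ⟨F', hF', hF'i, hmem⟩ := plain _ subset_rfl ((hce r).1 he)
    refine ⟨F', hF', hF'i, ?_⟩
    rcases hmiss with hfull | ⟨e, heG, j, hj, heF, hfull, -⟩
    · left
      intro m hm
      rw [hmem]
      exact (hcov m hm).imp_left fun h => hfull h
    · right
      refine ⟨e, heG, j, by omega, ?_, ?_, fun h' => absurd he (Nat.not_even_iff_odd.2 h')⟩
      · rw [hmem]
        rintro (h' | ⟨x, h'⟩ | ⟨e', he', h'⟩)
        · exact heF h'
        · simp at h'
        · simp only [Sum.inl.injEq, Prod.mk.injEq] at h'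
          omega
      · intro m hm
        rcases hcov m hm with h' | h'
        · exact (hfull h').imp_right fun h'' => (hmem m).2 (Or.inl h'')
        · exact Or.inr ((hmem m).2 (Or.inr h'))
  · rcases hmiss with hfull | ⟨e, heG, j, hj, heF, hfull, hji⟩
    · obtain ⟨r⟩ := hG.nonempty
      obtain ⟨m₀, hm₀, -, hQ⟩ := (hce r).2 ho
      obtain ⟨F', hF', hF'i, hmem⟩ := plain _ Set.sdiff_subset hQ
      refine ⟨F', hF', hF'i, Or.inr ⟨m₀, hm₀, i + 1, le_rfl, ?_, ?_, fun _ => rfl⟩⟩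
      · rw [hmem]
        rintro (h' | ⟨x, h'⟩ | ⟨e', he', h'⟩)
        · have := hFi h'
          simp [edges] at this
        · simp at h'
        · simp only [Sum.inl.injEq, Prod.mk.injEq, and_true] at h'
          exact he'.2 h'.symm
      · intro m hm
        rcases hcov m hm with h' | h' | ⟨e', he', rfl⟩
        · exact Or.inr ((hmem m).2 (Or.inl (hfull h')))
        · exact Or.inr ((hmem m).2 (Or.inr (Or.inl h')))
        · by_cases hee : e' = m₀
          · exact Or.inl (by rw [hee])
          · exact Or.inr ((hmem _).2 (Or.inr (Or.inr ⟨e', ⟨he', hee⟩, rfl⟩)))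
    · obtain rfl := hji ho
      -- The surplus edge of the new layer is prescribed to lie at an end `x` of the missing edge
      -- `e`. There it attaches `x`, so that the vertical edge at `x` can be paired with `e`.
      obtain ⟨m₀, hm₀, hr, hQ⟩ := (hce e.out.1).2 ho
      obtain ⟨y, hy⟩ := SimpleGraph.exists_link_of_mem hm₀ hr
      obtain ⟨F', hF', hmem⟩ := h.step hi hF hFi {e.out.1} (fun _ => e) (fun _ => y)
        (by rintro x rfl; exact ⟨heG, e.out_fst_mem, heF⟩) (by simp)
        (by rintro x rfl; exact ⟨hy.1, fun h' => hy.1.ne (Eq.symm h')⟩) hQ Set.sdiff_subset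
        (by rintro x rfl; rw [← hy.2]; simp)
      refine ⟨F', hF', ?_, Or.inl ?_⟩
      · intro m hm
        rcases (hmem m).1 hm with h' | ⟨x, rfl⟩ | ⟨x, hx, rfl⟩ | ⟨e', he', rfl⟩
        · exact hsub m (hFi h')
        · exact Or.inr ⟨x, j, by omega, rfl⟩
        · exact Or.inl ⟨e, heG, j, by omega, rfl⟩
        · refine Or.inl ⟨e', ?_, j + 1, le_rfl, rfl⟩
          rcases he' with he' | ⟨x, rfl, rfl⟩
          exacts [he'.1, hy.1]
      · intro m hm
        rw [hmem]
        rcases hcov m hm with h' | h' | ⟨e', he', rfl⟩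
        · rcases hfull h' with rfl | h'
          exacts [Or.inr (Or.inr (Or.inl ⟨_, rfl, rfl⟩)), Or.inl h']
        · exact Or.inr (Or.inl h')
        · refine Or.inr (Or.inr (Or.inr ⟨e', ?_, rfl⟩))
          by_cases hee : e' = m₀
          · exact Or.inr ⟨_, rfl, hee.trans hy.2⟩
          · exact Or.inl ⟨he', hee⟩

theorem upperEmbeddable (h : Layered G n Γ ε p) (hG : G.Connected) (hn : 1 ≤ n) :
    Γ.UpperEmbeddable := by
  obtain ⟨F, hF, -, hmiss⟩ : Nearly G Γ ε p n := by
    have key : ∀ i, 1 ≤ i → i ≤ n → Nearly G Γ ε p i := by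
      intro i hi
      induction i, hi using Nat.le_induction with
      | base => exact fun _ => h.nearly_one hG hn
      | succ i _ ih => exact fun hi => h.nearly_succ hG hi (ih (by omega))
    exact key n hn le_rfl
  have hU : verts p n = Set.univ := by
    ext u
    simp only [Set.mem_univ, iff_true]
    exact h.surj u
  rw [hU] at hF
  have hlab : ∀ d, ε d ∈ edges G n := h.labels
  refine hF.upperEmbeddable h.isEdgeLabel fun d d' hd hd' => ?_
  rcases hmiss with hfull | ⟨e, -, j, -, -, hfull, -⟩
  · exact absurd (hfull (hlab d)) hd
  · exact ((hfull (hlab d)).resolve_right hd).trans ((hfull (hlab d')).resolve_right hd').symm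

end Layered

/-! ### Products with paths, and cubes -/

namespace SimpleGraph

variable {V X : Type*} {G : SimpleGraph V} {n : ℕ}

/-- The label of the edge `{a, b}` of the product of a graph with a path. -/
def boxLabel (a b : V × Fin (n + 1)) : (Sym2 V × ℕ) ⊕ (V × ℕ) :=
  if a.2 = b.2 then .inl (s(a.1, b.1), a.2) else .inr (a.1, min a.2 b.2)

theorem boxLabel_eq_iff {a b c e : V × Fin (n + 1)} (hab : (G □ pathGraph (n + 1)).Adj a b)
    (hce : (G □ pathGraph (n + 1)).Adj c e) :
    boxLabel a b = boxLabel c e ↔ (a = c ∧ b = e) ∨ (a = e ∧ b = c) := by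
  obtain ⟨a, i⟩ := a
  obtain ⟨b, j⟩ := b
  obtain ⟨c, k⟩ := c
  obtain ⟨e, l⟩ := e
  simp only [boxProd_adj, pathGraph_adj] at hab hce
  simp only [boxLabel, Prod.mk.injEq]
  rcases hab with ⟨hab, rfl⟩ | ⟨hab, rfl⟩ <;> rcases hce with ⟨hce, rfl⟩ | ⟨hce, rfl⟩
  · simp only [if_true, Sum.inl.injEq, Prod.mk.injEq, Sym2.eq_iff, Fin.ext_iff]
    tauto
  · have h : k ≠ l := by rintro rfl; omega
    simp only [if_true, if_neg h, reduceCtorEq, false_iff]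
    rintro (⟨⟨-, h1⟩, ⟨-, h2⟩⟩ | ⟨⟨-, h1⟩, ⟨-, h2⟩⟩)
    exacts [h (h1.symm.trans h2), h (h2.symm.trans h1)]
  · have h : i ≠ j := by rintro rfl; omega
    simp only [if_true, if_neg h, reduceCtorEq, false_iff]
    rintro (⟨⟨-, h1⟩, ⟨-, h2⟩⟩ | ⟨⟨-, h1⟩, ⟨-, h2⟩⟩)
    exacts [h (h1.trans h2.symm), h (h1.trans h2.symm)]
  · have h : i ≠ j := by rintro rfl; omega
    have h' : k ≠ l := by rintro rfl; omega
    rw [if_neg h, if_neg h']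
    simp only [Sum.inr.injEq, Prod.mk.injEq, Fin.ext_iff]
    constructor
    · rintro ⟨rfl, h3⟩
      have : (i.val = k.val ∧ j.val = l.val) ∨ (i.val = l.val ∧ j.val = k.val) := by omega
      tauto
    · rintro (⟨⟨rfl, h1⟩, ⟨-, h2⟩⟩ | ⟨⟨rfl, h1⟩, ⟨-, h2⟩⟩)
      · exact ⟨rfl, by omega⟩
      · exact ⟨rfl, by omega⟩

/-- Stated up to isomorphism so that it also covers the cubes. `Fin.ofNat` wraps around beyond `n`,
but only layers up to `n` matter. -/
theorem layered_of_iso {Γ : SimpleGraph X} (φ : Γ ≃g G □ pathGraph (n + 1)) :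
    Layered G n (DartGraph.ofSimple Γ) (fun d => boxLabel (φ d.fst) (φ d.snd))
      (fun x i => φ.symm (x, Fin.ofNat (n + 1) i)) := by
  have hval : ∀ i ≤ n, (Fin.ofNat (n + 1) i).val = i := fun i hi =>
    Nat.mod_eq_of_lt (Nat.lt_succ_of_le hi)
  have hadj : ∀ d : Γ.Dart, (G □ pathGraph (n + 1)).Adj (φ d.fst) (φ d.snd) := fun d =>
    φ.map_adj_iff.2 d.adj
  have hjoin : ∀ a b, (G □ pathGraph (n + 1)).Adj a b →
      (DartGraph.ofSimple Γ).Joins (fun d => boxLabel (φ d.fst) (φ d.snd)) (boxLabel a b)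
        (φ.symm a) (φ.symm b) := by
    intro a b hab
    exact ⟨⟨(φ.symm a, φ.symm b), φ.symm.map_adj_iff.2 hab⟩, by simp, rfl, rfl⟩
  constructor
  · intro d d'
    show boxLabel _ _ = boxLabel _ _ ↔ _
    rw [boxLabel_eq_iff (hadj d) (hadj d')]
    simp only [φ.injective.eq_iff]
    show _ ↔ d = d' ∨ d = d'.symm
    rw [Dart.ext_iff, Dart.ext_iff, Prod.ext_iff, Prod.ext_iff]
    rfl
  · rintro i hi e a b ⟨hab, rfl⟩
    have := hjoin (a, Fin.ofNat (n + 1) i) (b, Fin.ofNat (n + 1) i) (by simp [hab])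
    simpa [boxLabel, Nat.mod_eq_of_lt (Nat.lt_succ_of_le hi)] using this
  · intro i hi x
    have h1 := hval i hi.le
    have h2 := hval (i + 1) hi
    have h3 := hjoin (x, Fin.ofNat (n + 1) i) (x, Fin.ofNat (n + 1) (i + 1)) (by
      rw [boxProd_adj, pathGraph_adj]
      right
      exact ⟨Or.inl (by rw [h1, h2]), rfl⟩)
    have h4 : boxLabel (x, Fin.ofNat (n + 1) i) (x, Fin.ofNat (n + 1) (i + 1)) =
        .inr (x, i) := by
      have h5 : Fin.ofNat (n + 1) i ≠ Fin.ofNat (n + 1) (i + 1) := fun h => by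
        have := congrArg Fin.val h
        omega
      simp only [boxLabel, if_neg h5, h1, h2]
      simp
    rwa [h4] at h3
  · intro i hi j hj x y hxy
    have h1 := φ.symm.injective hxy
    rw [Prod.mk.injEq] at h1
    refine ⟨h1.1, ?_⟩
    rw [← hval i hi, ← hval j hj, h1.2]
  · intro u
    refine ⟨(φ u).1, (φ u).2.val, by omega, ?_⟩
    simp
  · intro d
    have h := hadj d
    rw [boxProd_adj, pathGraph_adj] at h
    rcases h with ⟨h1, h2⟩ | ⟨h1, h2⟩
    · left
      refine ⟨s((φ d.fst).1, (φ d.snd).1), h1, (φ d.fst).2.val, by omega, ?_⟩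
      simp only [boxLabel, if_pos h2]
    · right
      have h3 : (φ d.fst).2 ≠ (φ d.snd).2 := fun h => by rw [h] at h1; omega
      refine ⟨(φ d.fst).1, min (φ d.fst).2.val (φ d.snd).2.val, by omega, ?_⟩
      simp only [boxLabel, if_neg h3]

theorem upperEmbeddable_of_iso_boxProd [Finite V] [Finite X] (hG : G.Connected) (hn : 1 ≤ n)
    {Γ : SimpleGraph X} (φ : Γ ≃g G □ pathGraph (n + 1)) :
    (DartGraph.ofSimple Γ).UpperEmbeddable := by
  have : Finite Γ.Dart := Finite.of_injective _ Dart.toProd_injective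
  exact (layered_of_iso φ).upperEmbeddable hG hn

theorem upperEmbeddable_of_subsingleton [Subsingleton V] [Nonempty V] (G : SimpleGraph V) :
    (DartGraph.ofSimple G).UpperEmbeddable := by
  obtain ⟨v⟩ := ‹Nonempty V›
  have : Finite G.Dart := Finite.of_injective _ Dart.toProd_injective
  have h := DartGraph.Unicellular.single (DartGraph.ofSimple G) (fun d : G.Dart => d.edge) v
  have hU : {v} = Set.univ := Set.eq_univ_of_forall fun u => Subsingleton.elim u v
  rw [hU] at h
  exact h.upperEmbeddable G.isEdgeLabel_edge fun d => (d.adj.ne (Subsingleton.elim _ _)).elim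

theorem hammingDist_succ {n : ℕ} (x y : Fin (n + 1) → Bool) :
    hammingDist x y = (if x 0 = y 0 then 0 else 1) + hammingDist (Fin.tail x) (Fin.tail y) := by
  unfold hammingDist
  rw [Fin.card_filter_univ_succ]
  by_cases h : x 0 = y 0
  · rw [if_neg (by simpa using h), if_pos h, zero_add]
    rfl
  · rw [if_pos h, if_neg h, add_comm]
    rfl

/-- The `n + 1`-cube is the product of the `n`-cube with an edge. -/
def nCubeSuccIso (n : ℕ) : nCube (n + 1) ≃g nCube n □ pathGraph 2 where
  toEquiv := (Fin.consEquiv fun _ => Bool).symm.trans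
    ((Equiv.prodComm _ _).trans (Equiv.prodCongr (Equiv.refl _) finTwoEquiv.symm))
  map_rel_iff' := by
    intro x y
    have h : ∀ a b : Bool, (pathGraph 2).Adj (finTwoEquiv.symm a) (finTwoEquiv.symm b) ↔ a ≠ b := by
      intro a b
      rw [pathGraph_adj]
      cases a <;> cases b <;> simp [finTwoEquiv]
    simp only [boxProd_adj, nCube, Equiv.trans_apply, Equiv.prodCongr_apply, Prod.map,
      Equiv.prodComm_apply, Fin.consEquiv_symm_apply, Prod.swap, Equiv.refl_apply, h,
      hammingDist_succ x y]
    by_cases h0 : x 0 = y 0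
    · simp [h0]
    · simp [h0]

theorem nCube_connected (n : ℕ) : (nCube n).Connected := by
  induction n with
  | zero => exact ⟨fun u v => by rw [Subsingleton.elim u v]⟩
  | succ n ih =>
    exact (nCubeSuccIso n).connected_iff.2 (ih.boxProd (pathGraph_connected 1))

theorem nCube_upperEmbeddable (n : ℕ) : (DartGraph.ofSimple (nCube n)).UpperEmbeddable := by
  cases n with
  | zero => exact upperEmbeddable_of_subsingleton _
  | succ n => exact upperEmbeddable_of_iso_boxProd (nCube_connected n) le_rfl (nCubeSuccIso n)

end SimpleGraph

/-! ### Paths of even length, and generalized Petersen graphs -/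

/-- The edges `e (2 q)` and `e (2 q + 1)` meet at `z (2 q + 1)`. -/
theorem paired_path {V E : Type*} {J : E → V → V → Prop} (e : ℕ → E) (z : ℕ → V) (L : ℕ)
    (hL : Even L) (hJ : ∀ t < L, J (e t) (z t) (z (t + 1)))
    (hJ' : ∀ t < L, J (e t) (z (t + 1)) (z t)) (he : Set.InjOn e (Set.Iio L)) :
    Paired J (e '' Set.Iio L) := by
  obtain ⟨M, rfl⟩ := hL
  have h := paired_family (J := J) (Set.finite_Iio M) (fun q => e (2 * q)) (fun q => e (2 * q + 1))
    (fun q => z (2 * q + 1)) (fun q => z (2 * q)) (fun q => z (2 * q + 2))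
    (fun q hq => hJ' _ (by simp only [Set.mem_Iio] at hq; omega))
    (fun q hq => hJ _ (by simp only [Set.mem_Iio] at hq; omega))
    (fun a ha b hb hab => by
      simp only [Set.mem_Iio] at ha hb
      have := he (Set.mem_Iio.2 (by omega)) (Set.mem_Iio.2 (by omega)) hab
      omega)
    (fun a ha b hb hab => by
      simp only [Set.mem_Iio] at ha hb
      have := he (Set.mem_Iio.2 (by omega)) (Set.mem_Iio.2 (by omega)) hab
      omega)
    (fun a ha b hb hab => by
      simp only [Set.mem_Iio] at ha hb
      have := he (Set.mem_Iio.2 (by omega)) (Set.mem_Iio.2 (by omega)) hab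
      omega)
  convert h using 1
  ext x
  constructor
  · rintro ⟨t, ht, rfl⟩
    simp only [Set.mem_Iio] at ht
    rcases Nat.even_or_odd' t with ⟨q, rfl | rfl⟩
    · exact Or.inl ⟨q, by simp only [Set.mem_Iio]; omega, rfl⟩
    · exact Or.inr ⟨q, by simp only [Set.mem_Iio]; omega, rfl⟩
  · rintro (⟨q, hq, rfl⟩ | ⟨q, hq, rfl⟩) <;> simp only [Set.mem_Iio] at hq
    · exact ⟨2 * q, by simp only [Set.mem_Iio]; omega, rfl⟩
    · exact ⟨2 * q + 1, by simp only [Set.mem_Iio]; omega, rfl⟩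

/-- The position `J i` of `i` in its cycle under the addition of `k` in `ZMod n`; the elements
below `d = gcd n k` have position zero. -/
theorem exists_cyclePosition {n k : ℕ} (hk : 1 ≤ k) (hkn : k < n) :
    ∃ (m d : ℕ) (J : ZMod n → ℕ), 0 < d ∧ d < n ∧ 2 ≤ m ∧ (m = 2 ↔ n = 2 * k) ∧
      (∀ i, J i < m) ∧ (∀ i, J (i + k) = (J i + 1) % m) ∧ ∀ i, J i = 0 ↔ i.val < d := by
  obtain ⟨d, m, k', hd, hcop, rfl, rfl⟩ : ∃ d m k', 0 < d ∧ Nat.Coprime m k' ∧ n = m * d ∧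
      k = k' * d := by
    obtain ⟨m, k', hcop, h1, h2⟩ := Nat.exists_coprime n k
    exact ⟨_, m, k', Nat.gcd_pos_of_pos_left _ (by omega), hcop, h1, h2⟩
  have hlt : k' < m := lt_of_mul_lt_mul_right hkn (Nat.zero_le d)
  have hk' : 1 ≤ k' := Nat.pos_of_mul_pos_right hk
  have hm : 2 ≤ m := by omega
  have : NeZero m := ⟨by omega⟩
  have : NeZero (m * d) := ⟨by omega⟩
  have hunit : (k' : ZMod m) * (k' : ZMod m)⁻¹ = 1 := ZMod.coe_mul_inv_eq_one _ hcop.symm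
  -- With `d = gcd n k`, there are `d` cycles, the residue classes modulo `d`. Adding `k = k' * d`
  -- raises `i / d` by `k'` modulo `m`, so dividing by the unit `k'` turns this into a step of one.
  refine ⟨m, d, fun i => (((i.val / d : ℕ) : ZMod m) * (k' : ZMod m)⁻¹).val, hd, by nlinarith, hm,
    ?_, fun i => ZMod.val_lt _, fun i => ?_, fun i => ?_⟩
  · constructor
    · rintro rfl
      have : k' = 1 := by omega
      rw [this, one_mul]
    · intro h
      have h' : m = 2 * k' := by
        apply Nat.eq_of_mul_eq_mul_right hd
        rw [h, mul_assoc]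
      have : k' = 1 := hcop.symm.eq_one_of_dvd ⟨2, by rw [h', mul_comm]⟩
      omega
  · have h1 : (i + ((k' * d : ℕ) : ZMod (m * d))).val = (i.val + k' * d) % (m * d) := by
      rw [ZMod.val_add, ZMod.val_natCast, Nat.add_mod_mod]
    have h2 : (((i + ((k' * d : ℕ) : ZMod (m * d))).val / d : ℕ) : ZMod m) =
        ((i.val / d : ℕ) : ZMod m) + k' := by
      rw [h1, Nat.mod_mul_left_div_self, ZMod.natCast_mod,
        Nat.add_mul_div_right _ _ hd, Nat.cast_add]
    show (_ * _ : ZMod m).val = _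
    rw [h2, add_mul, hunit, ZMod.val_add, ZMod.val_one'' (by omega)]
  · rw [ZMod.val_eq_zero]
    have h1 : ((i.val / d : ℕ) : ZMod m) * (k' : ZMod m)⁻¹ = 0 ↔
        ((i.val / d : ℕ) : ZMod m) = 0 := by
      constructor
      · intro h
        have := congrArg (· * (k' : ZMod m)) h
        rwa [mul_assoc, mul_comm _ (k' : ZMod m), hunit, mul_one, zero_mul] at this
      · intro h
        rw [h, zero_mul]
    have h2 : i.val / d < m := by
      rw [Nat.div_lt_iff_lt_mul hd]
      exact ZMod.val_lt i
    rw [h1, ZMod.natCast_eq_zero_iff]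
    constructor
    · intro h
      have h3 := Nat.eq_zero_of_dvd_of_lt h h2
      rcases (Nat.div_eq_zero_iff).1 h3 with h4 | h4
      · omega
      · exact h4
    · intro h
      rw [Nat.div_eq_of_lt h]
      exact dvd_zero _

namespace SimpleGraph

variable {n k : ℕ}

/-- The edge `u i, u (i + 1)` of a generalized Petersen graph. -/
def outer (i : ZMod n) : Sym2 (ZMod n ⊕ ZMod n) := s(.inl i, .inl (i + 1))

/-- The edge `u i, v i` of a generalized Petersen graph. -/
def spoke (i : ZMod n) : Sym2 (ZMod n ⊕ ZMod n) := s(.inl i, .inr i)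

/-- The edge `v i, v (i + k)` of a generalized Petersen graph. -/
def inner (k : ℕ) (i : ZMod n) : Sym2 (ZMod n ⊕ ZMod n) := s(.inr i, .inr (i + (k : ZMod n)))

theorem zmod_natCast_ne_zero {a : ℕ} (ha : 1 ≤ a) (han : a < n) : (a : ZMod n) ≠ 0 := by
  intro h
  have := Nat.le_of_dvd ha ((ZMod.natCast_eq_zero_iff a n).1 h)
  omega

theorem link_outer (hn : 3 ≤ n) (i : ZMod n) :
    (generalizedPetersen n k).Link (outer i) (.inl i) (.inl (i + 1)) := by
  have h := zmod_natCast_ne_zero (n := n) (a := 1) le_rfl (by omega)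
  refine ⟨⟨?_, Or.inl (Or.inl ⟨i, rfl, rfl⟩)⟩, rfl⟩
  simpa using h

theorem link_spoke (i : ZMod n) :
    (generalizedPetersen n k).Link (spoke i) (.inl i) (.inr i) :=
  ⟨⟨by simp, Or.inl (Or.inr (Or.inl ⟨i, rfl, rfl⟩))⟩, rfl⟩

theorem link_inner (hk : 1 ≤ k) (hkn : k < n) (i : ZMod n) :
    (generalizedPetersen n k).Link (inner k i) (.inr i) (.inr (i + k)) := by
  have h := zmod_natCast_ne_zero hk hkn
  refine ⟨⟨?_, Or.inl (Or.inr (Or.inr ⟨i, rfl, rfl⟩))⟩, rfl⟩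
  simpa using h

theorem Link.symm {V : Type*} {H : SimpleGraph V} {m : Sym2 V} {u w : V} (h : H.Link m u w) :
    H.Link m w u :=
  ⟨h.1.symm, h.2.trans Sym2.eq_swap⟩

theorem outer_injective (hn : 3 ≤ n) : Function.Injective (outer (n := n)) := by
  intro i j h
  have h2 := zmod_natCast_ne_zero (n := n) (a := 2) (by omega) (by omega)
  simp only [outer, Sym2.eq_iff, Sum.inl.injEq] at h
  rcases h with h | ⟨h, h'⟩
  · exact h.1
  · exact absurd (by push_cast; linear_combination -h + h') h2

theorem inner_eq_iff {i j : ZMod n} :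
    inner k i = inner k j ↔ i = j ∨ (i = j + k ∧ i + k = j) := by
  simp only [inner, Sym2.eq_iff, Sum.inr.injEq]
  constructor
  · rintro (h | h)
    exacts [Or.inl h.1, Or.inr h]
  · rintro (rfl | h)
    exacts [Or.inl ⟨rfl, rfl⟩, Or.inr h]

theorem inner_injective (hk : 1 ≤ k) (hkn : k < n) (h2 : n ≠ 2 * k) :
    Function.Injective (inner (n := n) k) := by
  intro i j h
  rcases inner_eq_iff.1 h with h | ⟨h, h'⟩
  · exact h
  · exfalso
    have h3 : ((2 * k : ℕ) : ZMod n) = 0 := by push_cast; linear_combination -h + h'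
    obtain ⟨c, hc⟩ := (ZMod.natCast_eq_zero_iff _ n).1 h3
    have : c = 1 := by
      have : c < 2 := by by_contra hc'; nlinarith
      have : c ≠ 0 := by rintro rfl; omega
      omega
    subst this
    omega

theorem outer_ne_spoke (i j : ZMod n) : outer i ≠ spoke j := by simp [outer, spoke]

theorem outer_ne_inner (i j : ZMod n) : outer i ≠ inner k j := by
  simp [outer, inner]

theorem spoke_ne_inner (i j : ZMod n) : spoke i ≠ inner k j := by
  simp [spoke, inner]

theorem mem_edgeSet_generalizedPetersen {e : Sym2 (ZMod n ⊕ ZMod n)}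
    (he : e ∈ (generalizedPetersen n k).edgeSet) :
    (∃ i, e = outer i) ∨ (∃ i, e = spoke i) ∨ ∃ i, e = inner k i := by
  induction e using Sym2.inductionOn with
  | hf x y =>
    have h : (generalizedPetersen n k).Adj x y := he
    rw [generalizedPetersen, fromRel_adj] at h
    rcases h.2 with (⟨i, rfl, rfl⟩ | ⟨i, rfl, rfl⟩ | ⟨i, rfl, rfl⟩) |
      (⟨i, rfl, rfl⟩ | ⟨i, rfl, rfl⟩ | ⟨i, rfl, rfl⟩)
    · exact Or.inl ⟨i, rfl⟩
    · exact Or.inr (Or.inl ⟨i, rfl⟩)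
    · exact Or.inr (Or.inr ⟨i, rfl⟩)
    · exact Or.inl ⟨i, Sym2.eq_swap⟩
    · exact Or.inr (Or.inl ⟨i, Sym2.eq_swap⟩)
    · exact Or.inr (Or.inr ⟨i, Sym2.eq_swap⟩)

/-- The edges of the inner cycles can be paired, apart from one edge of each cycle if the cycles
have odd length. -/
theorem paired_inner (hk : 1 ≤ k) (hkn : k < n) (h2 : n ≠ 2 * k) {m c : ℕ} {J : ZMod n → ℕ}
    (hJ : ∀ i, J i < m) (hJk : ∀ i, J (i + k) = (J i + 1) % m) (hc : c < 2) (hcm : m % 2 = c) :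
    Paired (generalizedPetersen n k).Link (inner k '' {i | c ≤ J i}) := by
  have : NeZero n := ⟨by omega⟩
  have hinj := inner_injective hk hkn h2
  -- The last position `m - 1` has the other parity, so a pair that starts at a position of parity
  -- `c` never wraps around.
  have hJ1 : ∀ i, J i % 2 = c → J (i + k) = J i + 1 := fun i hi => by
    rw [hJk, Nat.mod_eq_of_lt]
    have := hJ i
    omega
  have h := paired_family (J := (generalizedPetersen n k).Link)
    (Set.toFinite {i : ZMod n | J i % 2 = c}) (inner k) (fun i => inner k (i + k))
    (fun i => .inr (i + k)) (fun i => .inr i) (fun i => .inr (i + k + k))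
    (fun i _ => (link_inner hk hkn i).symm) (fun i _ => link_inner hk hkn (i + k))
    hinj.injOn (fun i _ j _ hij => by simpa using hinj hij) (fun i hi j hj hij => by
      have h1 := hJ1 j hj
      rw [← hinj hij] at h1
      simp only [Set.mem_ofPred_eq] at hi hj
      omega)
  convert h using 1
  ext e
  constructor
  · rintro ⟨i, hi, rfl⟩
    simp only [Set.mem_ofPred_eq] at hi
    by_cases hic : J i % 2 = c
    · exact Or.inl ⟨i, hic, rfl⟩
    · refine Or.inr ⟨i - k, ?_, by simp⟩
      have h1 := hJk (i - k)
      have h3 := hJ (i - k)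
      rw [sub_add_cancel] at h1
      rcases (Nat.succ_le_of_lt h3).lt_or_eq with h4 | h4
      · rw [Nat.mod_eq_of_lt h4] at h1
        simp only [Set.mem_ofPred_eq]
        omega
      · rw [← Nat.succ_eq_add_one, h4, Nat.mod_self] at h1
        omega
  · rintro (⟨i, hi, rfl⟩ | ⟨i, hi, rfl⟩) <;> simp only [Set.mem_ofPred_eq] at hi
    · exact ⟨i, by simp only [Set.mem_ofPred_eq]; omega, rfl⟩
    · exact ⟨i + k, by have := hJ1 i hi; simp only [Set.mem_ofPred_eq]; omega, rfl⟩

theorem val_add_one_eq (hn : 3 ≤ n) {i : ZMod n} (hi : i.val + 1 < n) :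
    (i + 1).val = i.val + 1 := by
  have : NeZero n := ⟨by omega⟩
  have : Fact (1 < n) := ⟨by omega⟩
  rw [ZMod.val_add, ZMod.val_one, Nat.mod_eq_of_lt hi]

instance [NeZero n] : Finite (generalizedPetersen n k).Dart :=
  Finite.of_injective _ Dart.toProd_injective

/-- The tree consisting of the path from `u a` to `u (n - 1)` and the spokes at its vertices. -/
theorem unicellular_comb (hn : 3 ≤ n) {a : ℕ} (ha : a < n) :
    (DartGraph.ofSimple (generalizedPetersen n k)).Unicellular (fun d => d.edge)
      (Sum.inl '' {i | a ≤ i.val} ∪ Sum.inr '' {i | a ≤ i.val})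
      (outer '' {i | a ≤ i.val ∧ i.val < n - 1} ∪ spoke '' {i | a ≤ i.val}) := by
  have : NeZero n := ⟨by omega⟩
  have hε := (generalizedPetersen n k).isEdgeLabel_edge
  have key : ∀ t, a ≤ t → t < n →
      (DartGraph.ofSimple (generalizedPetersen n k)).Unicellular (fun d => d.edge)
        (Sum.inl '' {i : ZMod n | a ≤ i.val ∧ i.val ≤ t})
        (outer '' {i : ZMod n | a ≤ i.val ∧ i.val < t}) := by
    intro t hat
    induction t, hat using Nat.le_induction with
    | base =>
      intro _
      have h := DartGraph.Unicellular.single (DartGraph.ofSimple (generalizedPetersen n k))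
        (fun d : (generalizedPetersen n k).Dart => d.edge) (.inl (a : ZMod n))
      have h1 : {i : ZMod n | a ≤ i.val ∧ i.val ≤ a} = {(a : ZMod n)} := by
        ext i
        simp only [Set.mem_ofPred_eq, Set.mem_singleton_iff]
        constructor
        · intro hi
          apply ZMod.val_injective
          rw [ZMod.val_natCast, Nat.mod_eq_of_lt ha]
          omega
        · rintro rfl
          rw [ZMod.val_natCast, Nat.mod_eq_of_lt ha]
          omega
      have h2 : {i : ZMod n | a ≤ i.val ∧ i.val < a} = ∅ := by
        ext i
        simp only [Set.mem_ofPred_eq, Set.mem_empty_iff_false, iff_false]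
        omega
      rw [h1, h2, Set.image_singleton, Set.image_empty]
      exact h
    | succ t hat ih =>
      intro ht
      have hval : ((t : ℕ) : ZMod n).val = t := by
        rw [ZMod.val_natCast, Nat.mod_eq_of_lt (by omega)]
      have hval' : ((t : ℕ) + 1 : ZMod n).val = t + 1 := by
        rw [val_add_one_eq hn (by omega), hval]
      have h := (ih (by omega)).pendant hε (link_outer hn (t : ZMod n)).joins
        ⟨_, ⟨by omega, by omega⟩, rfl⟩ (by
          rintro ⟨i, hi, h⟩
          simp only [Set.mem_ofPred_eq, Sum.inl.injEq] at hi h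
          rw [h] at hi
          omega)
      convert h using 1
      · rw [← Set.image_insert_eq]
        congr 1
        ext i
        simp only [Set.mem_ofPred_eq, Set.mem_insert_iff]
        rw [← (ZMod.val_injective n).eq_iff, hval']
        omega
      · rw [← Set.image_insert_eq]
        congr 1
        ext i
        simp only [Set.mem_ofPred_eq, Set.mem_insert_iff]
        rw [← (ZMod.val_injective n).eq_iff, hval]
        omega
  have hU : {i : ZMod n | a ≤ i.val ∧ i.val ≤ n - 1} = {i | a ≤ i.val} := by
    ext i
    have := ZMod.val_lt i
    simp only [Set.mem_ofPred_eq]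
    omega
  have h := key (n - 1) (by omega) (by omega)
  rw [hU] at h
  exact h.pendants hε (Set.toFinite {i : ZMod n | a ≤ i.val}) spoke Sum.inl Sum.inr
    (fun i _ => (link_spoke i).joins) (fun i hi => ⟨i, hi, rfl⟩) (fun i _ => by simp)
    Sum.inr_injective.injOn

theorem _root_.Paired.joins {V : Type*} {H : SimpleGraph V} {M : Set (Sym2 V)}
    (hM : Paired H.Link M) : Paired ((DartGraph.ofSimple H).Joins fun d : H.Dart => d.edge) M :=
  hM.mono fun _ _ _ h => h.joins

/-- The spanning tree is the outer path with all spokes. The inner cycles have even length and are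
paired completely, so only the outer edge from `u (n - 1)` to `u 0` is missing. -/
theorem generalizedPetersen_upperEmbeddable_of_even (hn : 3 ≤ n) (hk : 1 ≤ k) (hkn : k < n)
    (h2 : n ≠ 2 * k) {m : ℕ} {J : ZMod n → ℕ} (hJ : ∀ i, J i < m)
    (hJk : ∀ i, J (i + k) = (J i + 1) % m) (hm : m % 2 = 0) :
    (DartGraph.ofSimple (generalizedPetersen n k)).UpperEmbeddable := by
  have : NeZero n := ⟨by omega⟩
  have hε := (generalizedPetersen n k).isEdgeLabel_edge
  have h := unicellular_comb (n := n) (k := k) hn (a := 0) (by omega)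
  have hU : (Sum.inl '' {i : ZMod n | 0 ≤ i.val} ∪ Sum.inr '' {i : ZMod n | 0 ≤ i.val}) =
      (Set.univ : Set (ZMod n ⊕ ZMod n)) := by
    ext (i | i) <;> simp
  rw [hU] at h
  have hP := Paired.joins (paired_inner hk hkn h2 hJ hJk (c := 0) (by omega) hm)
  have h' := h.union_paired hε hP (by
    rw [Set.disjoint_left]
    rintro _ ⟨i, -, rfl⟩ (⟨j, -, hj⟩ | ⟨j, -, hj⟩)
    exacts [outer_ne_inner _ _ hj, spoke_ne_inner _ _ hj]) (fun _ _ _ _ _ => trivial)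
  have hmiss : ∀ d : (generalizedPetersen n k).Dart, d.edge ∉ (outer '' {i : ZMod n | 0 ≤ i.val ∧
      i.val < n - 1} ∪ spoke '' {i : ZMod n | 0 ≤ i.val}) ∪ inner k '' {i | 0 ≤ J i} →
      d.edge = outer ((n - 1 : ℕ) : ZMod n) := by
    intro d hd
    rcases mem_edgeSet_generalizedPetersen d.edge_mem with ⟨i, hi⟩ | ⟨i, hi⟩ | ⟨i, hi⟩ <;>
      rw [hi] at hd ⊢
    · congr 1
      apply ZMod.val_injective
      rw [ZMod.val_natCast, Nat.mod_eq_of_lt (by omega)]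
      by_contra hne
      have := ZMod.val_lt i
      exact hd (Or.inl (Or.inl ⟨i, ⟨by omega, by omega⟩, rfl⟩))
    · exact absurd (Or.inl (Or.inr ⟨i, Nat.zero_le _, rfl⟩)) hd
    · exact absurd (Or.inr ⟨i, Nat.zero_le _, rfl⟩) hd
  exact h'.upperEmbeddable hε fun d d' hd hd' => (hmiss d hd).trans (hmiss d' hd').symm

/-- For `i < d`, the tree reaches `v i` by the inner edge from `v (i + k)`, and then `u i` by the
spoke. This takes one edge from each inner cycle; an even number remains, or none if `m = 2`. The
outer edges outside the tree form the path from `u (n - 1)` through `u 0` to `u d`, whose edges are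
paired up to at most one. -/
theorem generalizedPetersen_upperEmbeddable_of_odd (hn : 3 ≤ n) (hk : 1 ≤ k) (hkn : k < n)
    {m d : ℕ} {J : ZMod n → ℕ} (hdn : d < n) (hm2 : 2 ≤ m) (hmn : m = 2 ↔ n = 2 * k)
    (hJ : ∀ i, J i < m) (hJk : ∀ i, J (i + k) = (J i + 1) % m)
    (hJd : ∀ i, J i = 0 ↔ i.val < d) (hm : m = 2 ∨ m % 2 = 1) :
    (DartGraph.ofSimple (generalizedPetersen n k)).UpperEmbeddable := by
  have : NeZero n := ⟨by omega⟩
  have hε := (generalizedPetersen n k).isEdgeLabel_edge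
  -- The position goes from zero to one, so `i + k` belongs to the comb that is already there.
  have hbig : ∀ i : ZMod n, i.val < d → d ≤ (i + k).val := by
    intro i hi
    by_contra hlt
    have h1 := hJk i
    rw [(hJd i).2 hi, (hJd _).2 (not_le.1 hlt), Nat.mod_eq_of_lt (by omega)] at h1
    omega
  have h1 := (unicellular_comb (n := n) (k := k) hn hdn).pendants hε
    (Set.toFinite {i : ZMod n | i.val < d}) (inner k) (fun i => .inr (i + k)) Sum.inr
    (fun i _ => (link_inner hk hkn i).symm.joins) (fun i hi => Or.inr ⟨_, hbig i hi, rfl⟩)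
    (by
      rintro i hi (⟨j, hj, h⟩ | ⟨j, hj, h⟩)
      · cases h
      · cases h
        simp only [Set.mem_ofPred_eq] at hi hj
        omega) Sum.inr_injective.injOn
  have h2 := h1.pendants hε (Set.toFinite {i : ZMod n | i.val < d}) spoke Sum.inr Sum.inl
    (fun i _ => (link_spoke i).symm.joins) (fun i hi => Or.inr ⟨_, hi, rfl⟩)
    (by
      rintro i hi ((⟨j, hj, h⟩ | ⟨j, hj, h⟩) | ⟨j, hj, h⟩)
      · cases h
        simp only [Set.mem_ofPred_eq] at hi hj
        omega
      · cases h
      · cases h) Sum.inl_injective.injOn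
  obtain ⟨F, hF, hin, hsp, hout⟩ : ∃ F, (DartGraph.ofSimple (generalizedPetersen n k)).Unicellular
      (fun d => d.edge) Set.univ F ∧ (∀ i, inner k i ∈ F) ∧ (∀ i, spoke i ∈ F) ∧
      ∀ i, outer i ∈ F ↔ d ≤ i.val ∧ i.val < n - 1 := by
    have hU : (Sum.inl '' {i : ZMod n | d ≤ i.val} ∪ Sum.inr '' {i : ZMod n | d ≤ i.val}) ∪
        Sum.inr '' {i : ZMod n | i.val < d} ∪ Sum.inl '' {i : ZMod n | i.val < d} =
        (Set.univ : Set (ZMod n ⊕ ZMod n)) := by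
      ext (i | i) <;> simp [le_or_gt]
    rw [hU] at h2
    have hsp : ∀ i : ZMod n, spoke i ∈ (outer '' {i : ZMod n | d ≤ i.val ∧ i.val < n - 1} ∪
        spoke '' {i : ZMod n | d ≤ i.val}) ∪ inner k '' {i : ZMod n | i.val < d} ∪
        spoke '' {i : ZMod n | i.val < d} := by
      intro i
      rcases le_or_gt d i.val with hi | hi
      · exact Or.inl (Or.inl (Or.inr ⟨i, hi, rfl⟩))
      · exact Or.inr ⟨i, hi, rfl⟩
    have hout : ∀ i : ZMod n, outer i ∈ (outer '' {i : ZMod n | d ≤ i.val ∧ i.val < n - 1} ∪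
        spoke '' {i : ZMod n | d ≤ i.val}) ∪ inner k '' {i : ZMod n | i.val < d} ∪
        spoke '' {i : ZMod n | i.val < d} ↔ d ≤ i.val ∧ i.val < n - 1 := by
      intro i
      constructor
      · rintro (((⟨j, hj, h⟩ | ⟨j, hj, h⟩) | ⟨j, hj, h⟩) | ⟨j, hj, h⟩)
        · rwa [outer_injective hn h] at hj
        · exact absurd h.symm (outer_ne_spoke _ _)
        · exact absurd h.symm (outer_ne_inner _ _)
        · exact absurd h.symm (outer_ne_spoke _ _)
      · exact fun hi => Or.inl (Or.inl (Or.inl ⟨i, hi, rfl⟩))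
    -- If `n = 2 k`, the inner edges at `i` and `i + k` coincide, so the tree already contains them
    -- all.
    by_cases hnk : n = 2 * k
    · refine ⟨_, h2, fun i => ?_, hsp, hout⟩
      obtain rfl := hmn.2 hnk
      rcases lt_or_ge i.val d with hi | hi
      · exact Or.inl (Or.inr ⟨i, hi, rfl⟩)
      · refine Or.inl (Or.inr ⟨i + k, ?_, ?_⟩)
        · have h3 := hJ i
          have h4 : J i ≠ 0 := fun h => by have := (hJd i).1 h; omega
          rw [Set.mem_ofPred_eq, ← hJd, hJk]
          have : J i = 1 := by omega
          rw [this]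
        · rw [inner_eq_iff]
          refine Or.inr ⟨rfl, ?_⟩
          have : ((2 * k : ℕ) : ZMod n) = 0 := by rw [← hnk]; exact ZMod.natCast_self n
          push_cast at this
          linear_combination this
    · have hm' : m % 2 = 1 := hm.resolve_left fun h => hnk (hmn.1 h)
      have hP := Paired.joins (paired_inner hk hkn hnk hJ hJk (c := 1) (by omega) hm')
      have hJd' : ∀ i, 1 ≤ J i ↔ d ≤ i.val := fun i => by
        have := hJd i
        omega
      have h3 := h2.union_paired hε hP (by
        rw [Set.disjoint_left]
        rintro _ ⟨i, hi, rfl⟩ (((⟨j, hj, h⟩ | ⟨j, hj, h⟩) | ⟨j, hj, h⟩) | ⟨j, hj, h⟩)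
        · exact outer_ne_inner _ _ h
        · exact spoke_ne_inner _ _ h
        · obtain rfl := inner_injective hk hkn hnk h
          have := (hJd' j).1 hi
          simp only [Set.mem_ofPred_eq] at hj
          omega
        · exact spoke_ne_inner _ _ h) (fun _ _ _ _ _ => trivial)
      refine ⟨_, h3, fun i => ?_, fun i => Or.inl (hsp i), fun i => ?_⟩
      · rcases lt_or_ge i.val d with hi | hi
        · exact Or.inl (Or.inl (Or.inr ⟨i, hi, rfl⟩))
        · exact Or.inr ⟨i, (hJd' i).2 hi, rfl⟩
      · rw [← hout i]
        constructor
        · rintro (h | ⟨j, -, h⟩)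
          exacts [h, absurd h.symm (outer_ne_inner _ _)]
        · exact Or.inl
  have hval : ∀ t < n, ((t : ℕ) : ZMod n).val = t := fun t ht => by
    rw [ZMod.val_natCast, Nat.mod_eq_of_lt ht]
  have hval0 : ((0 : ℕ) - 1 : ZMod n).val = n - 1 := by
    have h3 : ((0 : ℕ) - 1 : ZMod n) = ((n - 1 : ℕ) : ZMod n) := by
      rw [Nat.cast_sub (by omega), ZMod.natCast_self]
      simp
    rw [h3, hval _ (by omega)]
  have hval1 : ∀ t < n, (((t + 1 : ℕ) : ZMod n) - 1).val = t := fun t ht => by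
    rw [Nat.cast_add, Nat.cast_one, add_sub_cancel_right, hval t ht]
  -- The remaining outer path has `d + 1` edges; `L` is the largest even number up to that. The
  -- indices are shifted by one so that `t = 0` gives the edge from `u (n - 1)` to `u 0`.
  set L := 2 * ((d + 1) / 2) with hL
  have hPath := paired_path (J := (generalizedPetersen n k).Link)
    (fun t : ℕ => outer ((t : ZMod n) - 1)) (fun t : ℕ => Sum.inl ((t : ZMod n) - 1)) L
    (even_two_mul _)
    (fun t _ => by
      have := link_outer (k := k) hn ((t : ZMod n) - 1)
      simpa using this)
    (fun t _ => by
      have := (link_outer (k := k) hn ((t : ZMod n) - 1)).symm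
      simpa using this)
    (by
      intro a ha b hb hab
      simp only [Set.mem_Iio] at ha hb
      have h3 : (a : ZMod n) = b := by simpa using outer_injective hn hab
      have h4 := congrArg ZMod.val h3
      rwa [hval _ (by omega), hval _ (by omega)] at h4)
  have h3 := hF.union_paired hε hPath.joins (by
    rw [Set.disjoint_left]
    rintro _ ⟨t, ht, rfl⟩ hm
    have h4 := (hout _).1 hm
    simp only [Set.mem_Iio] at ht
    rcases t with _ | t
    · rw [hval0] at h4; omega
    · rw [hval1 _ (by omega)] at h4; omega) (fun _ _ _ _ _ => trivial)
  have hmiss : ∀ e : (generalizedPetersen n k).Dart,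
      e.edge ∉ F ∪ (fun t : ℕ => outer ((t : ZMod n) - 1)) '' Set.Iio L →
      e.edge = outer (((d : ℕ) : ZMod n) - 1) := by
    intro e he
    rcases mem_edgeSet_generalizedPetersen e.edge_mem with ⟨i, hi⟩ | ⟨i, hi⟩ | ⟨i, hi⟩ <;>
      rw [hi] at he ⊢
    · obtain ⟨t, ht, rfl⟩ : ∃ t ≤ d, i = (t : ZMod n) - 1 := by
        have h4 : ¬ (d ≤ i.val ∧ i.val < n - 1) := fun h => he (Or.inl ((hout i).2 h))
        have h5 := ZMod.val_lt i
        by_cases h6 : i.val < d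
        · refine ⟨i.val + 1, h6, ?_⟩
          push_cast
          simp
        · refine ⟨0, Nat.zero_le _, ZMod.val_injective n ?_⟩
          rw [hval0]
          omega
      have h4 : t = d := by
        by_contra hne
        exact he (Or.inr ⟨t, by simp only [Set.mem_Iio]; omega, rfl⟩)
      rw [h4]
    · exact absurd (Or.inl (hsp i)) he
    · exact absurd (Or.inl (hin i)) he
  exact h3.upperEmbeddable hε fun e e' he he' => (hmiss e he).trans (hmiss e' he').symm

theorem generalizedPetersen_upperEmbeddable (hn : 3 ≤ n) (hk : 1 ≤ k) (hkn : k < n) :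
    (DartGraph.ofSimple (generalizedPetersen n k)).UpperEmbeddable := by
  obtain ⟨m, d, J, -, hdn, hm2, hmn, hJ, hJk, hJd⟩ := exists_cyclePosition hk hkn
  by_cases hm : m = 2 ∨ m % 2 = 1
  · exact generalizedPetersen_upperEmbeddable_of_odd hn hk hkn hdn hm2 hmn hJ hJk hJd hm
  · push Not at hm
    exact generalizedPetersen_upperEmbeddable_of_even hn hk hkn (fun h => hm.1 (hmn.2 h)) hJ hJk
      (by omega)

end SimpleGraph

/-! ### Halin graphs -/

namespace SimpleGraph

open Equiv.Perm

variable {V : Type*} {T H : SimpleGraph V}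

theorem IsAcyclic.not_reachable_deleteEdges (hT : T.IsAcyclic) {x y : V} (h : T.Adj x y) :
    ¬ (T.deleteEdges {s(x, y)}).Reachable x y :=
  isBridge_iff.1 (isAcyclic_iff_forall_adj_isBridge.1 hT h)

/-- A tree embedding has a single face. -/
theorem IsTree.sameCycle_facePerm [Finite V] (hT : T.IsTree) {σ : Equiv.Perm T.Dart}
    (hσ : (DartGraph.ofSimple T).IsRotation σ) (d d' : T.Dart) :
    SameCycle ((DartGraph.ofSimple T).facePerm σ) d d' := by
  have : Finite T.Dart := Finite.of_injective _ Dart.toProd_injective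
  set φ := (DartGraph.ofSimple T).facePerm σ with hφ
  have hfst : ∀ d : T.Dart, (φ d).fst = d.snd := fun d => hσ.src_apply d.symm
  -- Every edge of a tree is a bridge. A facial walk that crosses it along `d` can return to its
  -- start only by crossing back along `d.symm`.
  have hsymm : ∀ d : T.Dart, SameCycle φ d d.symm := by
    intro d
    by_contra hd
    have hbr := hT.isAcyclic.not_reachable_deleteEdges d.adj
    have key : ∀ j, (T.deleteEdges {s(d.fst, d.snd)}).Reachable d.snd ((φ ^ (j + 1)) d).fst := by
      intro j
      induction j with
      | zero => simp [hfst]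
      | succ j ih =>
        set x := (φ ^ (j + 1)) d with hx
        rw [pow_succ', mul_apply, ← hx, hfst]
        refine ih.trans (Adj.reachable ?_)
        rw [deleteEdges_adj]
        refine ⟨x.adj, fun he => ?_⟩
        have he' : x.edge = d.edge := he
        rcases (dart_edge_eq_iff _ _).1 he' with h | h
        · rw [h] at ih
          exact hbr ih.symm
        · apply hd
          rw [← h, hx, sameCycle_pow_right]
    have h1 := key (orderOf φ - 1)
    rw [Nat.sub_add_cancel (orderOf_pos φ), pow_orderOf_eq_one] at h1
    exact hbr h1.symm
  -- The rotation is reversal followed by `φ`, and both stay within a face by `hsymm`.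
  have hvert : ∀ d d' : T.Dart, d.fst = d'.fst → SameCycle φ d d' := by
    intro d d' h
    have hs : ∀ x : T.Dart, SameCycle φ x (σ x) := by
      intro x
      have h1 : φ x.symm = σ x := by
        show σ x.symm.symm = σ x
        rw [Dart.symm_symm]
      rw [← h1, sameCycle_apply_right]
      exact hsymm x
    obtain ⟨n, rfl⟩ := ((hσ d d').2 h).exists_nat_pow_eq
    clear h
    induction n with
    | zero => exact .refl _ _
    | succ n ih => rw [pow_succ', mul_apply]; exact ih.trans (hs _)
  have hwalk : ∀ u v (p : T.Walk u v) (d d' : T.Dart), d.fst = u → d'.fst = v →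
      SameCycle φ d d' := by
    intro u v p
    induction p with
    | nil => exact fun d d' h h' => hvert d d' (h.trans h'.symm)
    | @cons u w v huw p ih =>
      intro d d' h h'
      exact (hvert d ⟨(u, w), huw⟩ h).trans ((hsymm _).trans (ih _ d' rfl h'))
  obtain ⟨p⟩ := hT.connected.preconnected d.fst d'.fst
  exact hwalk _ _ p d d' rfl rfl

theorem IsLeafVertex.dart_eq {d d' : T.Dart} (h : T.IsLeafVertex d.fst) (hd : d.fst = d'.fst) :
    d = d' := by
  refine Dart.ext _ _ (Prod.ext hd ?_)
  have h1 : T.Adj d.fst d'.snd := by rw [hd]; exact d'.adj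
  exact h.unique d.adj h1

/-- In a tree there is a leaf on either side of every edge. -/
theorem IsTree.exists_leaf [Finite V] (hT : T.IsTree) {x y : V} (hxy : T.Adj x y) :
    ∃ z, T.IsLeafVertex z ∧ (T.deleteEdges {s(x, y)}).Reachable y z := by
  obtain ⟨k, hk⟩ : ∃ k, {z | (T.deleteEdges {s(x, y)}).Reachable y z}.ncard < k :=
    ⟨_, Nat.lt_succ_self _⟩
  induction k generalizing x y with
  | zero => omega
  | succ k ih =>
    by_cases hy : T.IsLeafVertex y
    · exact ⟨y, hy, .refl y⟩
    -- Stepping on from `y` to `w`, away from `x`, strictly shrinks the side in which a leaf is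
    -- sought.
    obtain ⟨w, hyw, hwx⟩ : ∃ w, T.Adj y w ∧ w ≠ x := by
      by_contra hno
      push Not at hno
      exact hy ⟨x, hxy.symm, hno⟩
    have hnot := hT.isAcyclic.not_reachable_deleteEdges hyw
    have hsub : ∀ z, (T.deleteEdges {s(y, w)}).Reachable w z →
        (T.deleteEdges {s(x, y)}).Reachable y z := by
      intro z hz
      rw [reachable_iff_reflTransGen] at hz
      induction hz with
      | refl =>
        refine Adj.reachable ?_
        rw [deleteEdges_adj]
        refine ⟨hyw, fun h => hwx ?_⟩
        rcases Sym2.eq_iff.1 h with h | h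
        exacts [absurd h.1.symm hxy.ne, h.2]
      | @tail a b ha hab ih' =>
        rw [← reachable_iff_reflTransGen] at ha
        refine ih'.trans (Adj.reachable ?_)
        have hb := ha.trans hab.reachable
        rw [deleteEdges_adj] at hab ⊢
        refine ⟨hab.1, fun h => ?_⟩
        rcases Sym2.eq_iff.1 h with h | h
        exacts [hnot (h.2 ▸ hb.symm), hnot (h.1 ▸ ha.symm)]
    obtain ⟨z, hz, hwz⟩ := ih hyw (by
      refine lt_of_lt_of_le (Set.ncard_lt_ncard (t := {z | (T.deleteEdges {s(x, y)}).Reachable y z})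
        ⟨hsub, fun h => hnot ?_⟩ (Set.toFinite _)) (Nat.le_of_lt_succ hk)
      exact (h (Reachable.refl y)).symm)
    exact ⟨z, hz, hsub z hwz⟩

/-- `H` arises from `T` by joining the leaves of `T` by a cycle, on which `ν` is the successor. -/
structure IsLeafCycle (T H : SimpleGraph V) (ν : V → V) : Prop where
  isTree : T.IsTree
  three_le : 3 ≤ {v | T.IsLeafVertex v}.ncard
  leaf_apply : ∀ a, T.IsLeafVertex a → T.IsLeafVertex (ν a)
  exists_iterate : ∀ a b, T.IsLeafVertex a → T.IsLeafVertex b → ∃ j, ν^[j] a = b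
  adj_iff : ∀ u v, H.Adj u v ↔ T.Adj u v ∨ (T.IsLeafVertex u ∧ v = ν u) ∨
    (T.IsLeafVertex v ∧ u = ν v)

/-- A leaf has only one dart, so the next leaf on the facial walk is unique and defines `ν`. All
leaves form one orbit because a plane tree has a single face. -/
theorem IsHalin.exists_leafCycle [Finite V] (hH : H.IsHalin) : ∃ T ν, IsLeafCycle T H ν := by
  obtain ⟨T, σ, hT, hσ, h3, hadj⟩ := hH
  have : Finite T.Dart := Finite.of_injective _ Dart.toProd_injective
  set φ := (DartGraph.ofSimple T).facePerm σ with hφ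
  have hdart : ∀ a, T.IsLeafVertex a → ∃ d : T.Dart, d.fst = a := fun a ⟨w, hw, _⟩ =>
    ⟨⟨(a, w), hw⟩, rfl⟩
  have hnext : ∀ a, T.IsLeafVertex a → ∃ b, T.IsNextLeaf σ a b := by
    classical
    intro a ha
    obtain ⟨d, rfl⟩ := hdart a ha
    have hex : ∃ m, 0 < m ∧ T.IsLeafVertex ((φ ^ m) d).fst :=
      ⟨orderOf φ, orderOf_pos φ, by rw [pow_orderOf_eq_one]; exact ha⟩
    refine ⟨_, ha, (Nat.find_spec hex).2, d, Nat.find hex, rfl, (Nat.find_spec hex).1, rfl,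
      fun j hj hjm hl => Nat.find_min hex hjm ⟨hj, hl⟩⟩
  have huniq : ∀ a b c, T.IsNextLeaf σ a b → T.IsNextLeaf σ a c → b = c := by
    rintro a b c ⟨ha, hb, d, m, rfl, hm, rfl, hmin⟩ ⟨-, hc, d', m', hd', hm', rfl, hmin'⟩
    obtain rfl := ha.dart_eq hd'.symm
    rcases lt_trichotomy m m' with h | rfl | h
    · exact absurd hb (hmin' m hm h)
    · rfl
    · exact absurd hc (hmin m' hm' h)
  have hν : ∀ a, ∃ b, T.IsLeafVertex a → T.IsNextLeaf σ a b := by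
    intro a
    by_cases ha : T.IsLeafVertex a
    · obtain ⟨b, hb⟩ := hnext a ha
      exact ⟨b, fun _ => hb⟩
    · exact ⟨a, fun h => absurd h ha⟩
  choose ν hν using hν
  have hiff : ∀ a b, T.IsNextLeaf σ a b ↔ T.IsLeafVertex a ∧ b = ν a := by
    intro a b
    constructor
    · exact fun h => ⟨h.1, huniq a b _ h (hν a h.1)⟩
    · rintro ⟨ha, rfl⟩
      exact hν a ha
  refine ⟨T, ν, hT, h3, fun a ha => (hν a ha).2.1, ?_, fun u v => by rw [hadj, hiff, hiff]⟩
  intro a b ha hb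
  obtain ⟨d, rfl⟩ := hdart a ha
  obtain ⟨e, rfl⟩ := hdart b hb
  obtain ⟨M, hM⟩ := (hT.sameCycle_facePerm hσ d e).exists_nat_pow_eq
  induction M using Nat.strong_induction_on generalizing d with
  | _ M ih =>
    rcases Nat.eq_zero_or_pos M with rfl | hM0
    · exact ⟨0, congrArg (fun d : T.Dart => d.fst) hM⟩
    obtain ⟨-, hl, d', m, hd', hm, hνd, hmin⟩ := hν _ ha
    obtain rfl := ha.dart_eq hd'.symm
    have hmM : m ≤ M := by
      by_contra hlt
      exact hmin M hM0 (not_le.1 hlt) (by rw [hM]; exact hb)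
    obtain ⟨j, hj⟩ := ih (M - m) (by omega) ((φ ^ m) d) (by rw [hνd]; exact hl) (by
      rw [← mul_apply, ← pow_add, Nat.sub_add_cancel hmM, hM])
    exact ⟨j + 1, by rw [Function.iterate_succ_apply, ← hνd, hj]⟩

namespace IsLeafCycle

open Function

variable {ν : V → V} {a b : V}

theorem iterate_leaf (h : IsLeafCycle T H ν) (ha : T.IsLeafVertex a) (j : ℕ) :
    T.IsLeafVertex (ν^[j] a) := by
  induction j with
  | zero => exact ha
  | succ j ih => rw [iterate_succ_apply']; exact h.leaf_apply _ ih

theorem mem_periodicPts (h : IsLeafCycle T H ν) (ha : T.IsLeafVertex a) : a ∈ periodicPts ν := by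
  obtain ⟨j, hj⟩ := h.exists_iterate (ν a) a (h.leaf_apply a ha) ha
  exact ⟨j + 1, Nat.succ_pos j, hj⟩

theorem image_iterate (h : IsLeafCycle T H ν) (ha : T.IsLeafVertex a) :
    (fun t => ν^[t] a) '' Set.Iio (minimalPeriod ν a) = {v | T.IsLeafVertex v} := by
  ext b
  constructor
  · rintro ⟨t, -, rfl⟩
    exact h.iterate_leaf ha t
  · intro hb
    obtain ⟨j, rfl⟩ := h.exists_iterate a b ha hb
    exact ⟨j % minimalPeriod ν a,
      Nat.mod_lt _ (minimalPeriod_pos_of_mem_periodicPts (h.mem_periodicPts ha)),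
      iterate_mod_minimalPeriod_eq⟩

theorem minimalPeriod_eq (h : IsLeafCycle T H ν) (ha : T.IsLeafVertex a) :
    minimalPeriod ν a = {v | T.IsLeafVertex v}.ncard := by
  rw [← h.image_iterate ha, iterate_injOn_Iio_minimalPeriod.ncard_image,
    ← Finset.coe_Iio, Set.ncard_coe_finset, Nat.card_Iio]

/-- The edge of the leaf cycle from the `t`-th successor of the leaf `a` to the next leaf. -/
def edge (ν : V → V) (a : V) (t : ℕ) : Sym2 V := s(ν^[t] a, ν^[t + 1] a)

/-- Traversing the same edge in both directions would force period at most two, but there are at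
least three leaves. -/
theorem injOn_edge (h : IsLeafCycle T H ν) (ha : T.IsLeafVertex a) :
    Set.InjOn (edge ν a) (Set.Iio {v | T.IsLeafVertex v}.ncard) := by
  rw [← h.minimalPeriod_eq ha]
  intro t ht s hs hts
  rcases Sym2.eq_iff.1 hts with h1 | h1
  · exact iterate_injOn_Iio_minimalPeriod ht hs h1.1
  · exfalso
    have h2 : IsPeriodicPt ν 2 (ν^[s] a) := by
      show ν (ν (ν^[s] a)) = _
      rw [← iterate_succ_apply' ν s, ← h1.1, ← iterate_succ_apply' ν t, h1.2]
    have h3 := h2.minimalPeriod_le two_pos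
    rw [minimalPeriod_apply_iterate (h.mem_periodicPts ha), h.minimalPeriod_eq ha] at h3
    have := h.three_le
    omega

/-- Two adjacent leaves would be the whole tree, which has at least three leaves. -/
theorem not_adj (h : IsLeafCycle T H ν) (ha : T.IsLeafVertex a) : ¬ T.Adj a (ν a) := by
  intro hadj
  have hb := h.leaf_apply a ha
  have key : ∀ j, ν^[j] a = a ∨ ν^[j] a = ν a → ∀ v, T.Reachable a v → v = a ∨ v = ν a := by
    intro _ _ v hv
    rw [reachable_iff_reflTransGen] at hv
    induction hv with
    | refl => exact Or.inl rfl
    | tail _ hvw ih =>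
      rcases ih with rfl | rfl
      · exact Or.inr (ha.unique hvw hadj)
      · exact Or.inl (hb.unique hvw hadj.symm)
  have hsub : {v | T.IsLeafVertex v} ⊆ {a, ν a} := fun v _ =>
    key 0 (Or.inl rfl) v (h.isTree.connected.preconnected a v)
  have h1 := Set.ncard_le_ncard hsub (Set.toFinite _)
  have h2 := Set.ncard_insert_le a {ν a}
  rw [Set.ncard_singleton] at h2
  have := h.three_le
  omega

theorem adj_apply (h : IsLeafCycle T H ν) (ha : T.IsLeafVertex a) : H.Adj a (ν a) :=
  (h.adj_iff _ _).2 (Or.inr (Or.inl ⟨ha, rfl⟩))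

theorem link_edge (h : IsLeafCycle T H ν) (ha : T.IsLeafVertex a) (t : ℕ) :
    H.Link (edge ν a t) (ν^[t] a) (ν^[t + 1] a) := by
  refine ⟨?_, rfl⟩
  rw [iterate_succ_apply']
  exact h.adj_apply (h.iterate_leaf ha t)

theorem edge_notMem (h : IsLeafCycle T H ν) (ha : T.IsLeafVertex a) (t : ℕ) :
    edge ν a t ∉ T.edgeSet := by
  rw [edge, iterate_succ_apply']
  exact h.not_adj (h.iterate_leaf ha t)

theorem edgeSet_eq (h : IsLeafCycle T H ν) (ha : T.IsLeafVertex a) :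
    H.edgeSet = T.edgeSet ∪ edge ν a '' Set.Iio {v | T.IsLeafVertex v}.ncard := by
  ext e
  induction e using Sym2.inductionOn with
  | hf u v =>
    have key : ∀ u, T.IsLeafVertex u →
        s(u, ν u) ∈ edge ν a '' Set.Iio {v | T.IsLeafVertex v}.ncard := by
      intro u hu
      have h1 : u ∈ {v | T.IsLeafVertex v} := hu
      rw [← h.image_iterate ha, h.minimalPeriod_eq ha] at h1
      obtain ⟨t, ht, rfl⟩ := h1
      exact ⟨t, ht, by rw [edge, iterate_succ_apply']⟩
    rw [mem_edgeSet, h.adj_iff]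
    constructor
    · rintro (h1 | ⟨h1, rfl⟩ | ⟨h1, rfl⟩)
      · exact Or.inl h1
      · exact Or.inr (key u h1)
      · rw [Sym2.eq_swap]
        exact Or.inr (key v h1)
    · rintro (h1 | ⟨t, -, h1⟩)
      · exact Or.inl h1
      · rw [edge, iterate_succ_apply'] at h1
        have hl := h.iterate_leaf ha t
        rcases Sym2.eq_iff.1 h1 with ⟨rfl, rfl⟩ | ⟨rfl, rfl⟩
        · exact Or.inr (Or.inl ⟨hl, rfl⟩)
        · exact Or.inr (Or.inr ⟨hl, rfl⟩)

theorem exists_leaf (h : IsLeafCycle T H ν) : ∃ a, T.IsLeafVertex a := by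
  have h1 := h.three_le
  exact Set.nonempty_of_ncard_ne_zero (s := {v | T.IsLeafVertex v}) (by omega)

theorem paired_path_edge (h : IsLeafCycle T H ν) (ha : T.IsLeafVertex a) {L : ℕ} (hL : Even L)
    (hLN : L ≤ {v | T.IsLeafVertex v}.ncard) : Paired H.Link (edge ν a '' Set.Iio L) :=
  paired_path (edge ν a) (fun t => ν^[t] a) L hL (fun t _ => h.link_edge ha t)
    (fun t _ => (h.link_edge ha t).symm)
    ((h.injOn_edge ha).mono fun _ ht => lt_of_lt_of_le ht hLN)

/-- The leaf cycle without the edge `{a, ν a}`, which has even length. -/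
theorem exists_paired_of_odd (h : IsLeafCycle T H ν) (ha : T.IsLeafVertex a)
    (ho : Odd {v | T.IsLeafVertex v}.ncard) :
    ∃ M, Paired H.Link M ∧ s(a, ν a) ∉ M ∧ Disjoint T.edgeSet M ∧
      H.edgeSet = T.edgeSet ∪ insert s(a, ν a) M := by
  set N := {v | T.IsLeafVertex v}.ncard with hN
  have hN0 : N - 1 + 1 = N := Nat.sub_add_cancel ho.pos
  have hb := h.leaf_apply a ha
  have hNa : ν^[N - 1] (ν a) = a := by
    rw [← iterate_succ_apply, Nat.succ_eq_add_one, hN0, hN, ← h.minimalPeriod_eq ha,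
      iterate_minimalPeriod]
  have he : edge ν (ν a) (N - 1) = s(a, ν a) := by
    rw [edge, iterate_succ_apply', hNa]
  refine ⟨edge ν (ν a) '' Set.Iio (N - 1), h.paired_path_edge hb ?_ (Nat.sub_le _ _), ?_, ?_, ?_⟩
  · rw [← hN0] at ho
    simpa [Nat.odd_add_one] using ho
  · rintro ⟨t, ht, h1⟩
    rw [← he] at h1
    have := h.injOn_edge hb (show t < N from lt_of_lt_of_le ht (Nat.sub_le _ _))
      (show N - 1 < N by omega) h1
    simp only [Set.mem_Iio] at ht
    omega
  · rw [Set.disjoint_right]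
    rintro _ ⟨t, -, rfl⟩
    exact h.edge_notMem hb t
  · rw [h.edgeSet_eq hb, ← he, ← Set.image_insert_eq, ← hN]
    congr 2
    ext t
    simp only [Set.mem_Iio, Set.mem_insert_iff]
    omega

end IsLeafCycle

/-- A Halin graph has a spanning tree whose complement consists of pairs of adjacent edges, or, for
every vertex `x`, such a spanning tree after the removal of some edge at `x`. -/
theorem IsHalin.exists_isTree [Finite V] (hH : H.IsHalin) :
    (∃ K M, K.IsTree ∧ K ≤ H ∧ Paired H.Link M ∧ Disjoint K.edgeSet M ∧
      H.edgeSet = K.edgeSet ∪ M) ∨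
    ∀ x, ∃ K M b, K.IsTree ∧ K ≤ H ∧ Paired H.Link M ∧ Disjoint K.edgeSet M ∧ b ∉ K.edgeSet ∧
      b ∉ M ∧ x ∈ b ∧ H.edgeSet = K.edgeSet ∪ insert b M := by
  obtain ⟨T, ν, h⟩ := hH.exists_leafCycle
  have hTH : T ≤ H := fun u v huv => (h.adj_iff u v).2 (Or.inl huv)
  rcases Nat.even_or_odd {v | T.IsLeafVertex v}.ncard with he | ho
  · left
    obtain ⟨a, ha⟩ := h.exists_leaf
    refine ⟨T, _, h.isTree, hTH, h.paired_path_edge ha he le_rfl, ?_, h.edgeSet_eq ha⟩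
    rw [Set.disjoint_right]
    rintro _ ⟨t, -, rfl⟩
    exact h.edge_notMem ha t
  right
  intro x
  by_cases hx : T.IsLeafVertex x
  · obtain ⟨M, hM, hbM, hdis, heq⟩ := h.exists_paired_of_odd hx ho
    exact ⟨T, M, _, h.isTree, hTH, hM, hdis, h.not_adj hx, hbM, by simp, heq⟩
  obtain ⟨y, hxy⟩ : ∃ y, T.Adj x y := by
    obtain ⟨a, ha⟩ := h.exists_leaf
    have hax : x ≠ a := fun h' => hx (h' ▸ ha)
    obtain ⟨p⟩ := h.isTree.connected.preconnected x a
    cases p with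
    | nil => exact absurd rfl hax
    | cons hadj _ => exact ⟨_, hadj⟩
  have hbr := h.isTree.isAcyclic.not_reachable_deleteEdges hxy
  obtain ⟨q, hq, hyq⟩ := h.isTree.exists_leaf hxy
  obtain ⟨p, hp, hxp⟩ := h.isTree.exists_leaf hxy.symm
  rw [Sym2.eq_swap] at hxp
  set S := T.deleteEdges {s(x, y)} with hS
  -- Both sides of the tree edge `xy` contain leaves, so the leaf cycle crosses from the side of `x`
  -- to the side of `y` somewhere.
  obtain ⟨a, ha, hxa, hxa'⟩ : ∃ a, T.IsLeafVertex a ∧ S.Reachable x a ∧ ¬ S.Reachable x (ν a) := by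
    obtain ⟨j, rfl⟩ := h.exists_iterate p q hp hq
    by_contra hno
    push Not at hno
    have key : ∀ j, S.Reachable x (ν^[j] p) := by
      intro j
      induction j with
      | zero => exact hxp
      | succ j ih =>
        rw [Function.iterate_succ_apply']
        exact hno _ (h.iterate_leaf hp j) ih
    exact hbr ((key j).trans hyq.symm)
  obtain ⟨M, hM, hbM, hdis, heq⟩ := h.exists_paired_of_odd ha ho
  have hside : ∀ v, S.Reachable x v ∨ S.Reachable y v := by
    intro v
    have hv := (reachable_iff_reflTransGen x v).1 (h.isTree.connected.preconnected x v)
    induction hv with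
    | refl => exact Or.inl (.refl x)
    | @tail u w _ huw ih =>
      by_cases hmem : s(u, w) = s(x, y)
      · rcases Sym2.eq_iff.1 hmem with ⟨rfl, rfl⟩ | ⟨rfl, rfl⟩
        exacts [Or.inr (.refl _), Or.inl (.refl _)]
      · have hadj : S.Adj u w := by
          rw [hS, deleteEdges_adj]
          exact ⟨huw, hmem⟩
        exact ih.imp (fun h => h.trans hadj.reachable) fun h => h.trans hadj.reachable
  have hane : a ≠ ν a := (h.adj_apply ha).ne
  -- The crossing edge replaces `xy` in the tree. The rest of the leaf cycle is an even path as
  -- before, and the leftover edge is now `xy`, at the desired vertex.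
  set K := S ⊔ SimpleGraph.edge a (ν a) with hK
  have hSK : S ≤ K := le_sup_left
  have hKadj : K.Adj a (ν a) := by
    rw [hK, sup_adj, edge_adj]
    exact Or.inr ⟨Or.inl ⟨rfl, rfl⟩, hane⟩
  have hKe : K.edgeSet = insert s(a, ν a) (T.edgeSet \ {s(x, y)}) := by
    rw [hK, edgeSet_sup, hS, edgeSet_deleteEdges, edgeSet_edge_of_ne hane, Set.union_comm,
      Set.singleton_union]
  have hxyT : s(x, y) ∈ T.edgeSet := hxy
  have haT : s(a, ν a) ∉ T.edgeSet := h.not_adj ha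
  have hKtree : K.IsTree := by
    have hne : Nonempty V := ⟨x⟩
    rw [isTree_iff_connected_and_card]
    constructor
    · have hya : S.Reachable y (ν a) := (hside _).resolve_left hxa'
      have hxy' : K.Reachable x y :=
        ((hxa.mono hSK).trans hKadj.reachable).trans (hya.mono hSK).symm
      have hall : ∀ v, K.Reachable x v := fun v => (hside v).elim (fun h => h.mono hSK)
        fun h => hxy'.trans (h.mono hSK)
      exact ⟨fun u v => (hall u).symm.trans (hall v)⟩
    · have h1 := (isTree_iff_connected_and_card.1 h.isTree).2
      rw [← h1, Nat.card_coe_set_eq, Nat.card_coe_set_eq, hKe,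
        Set.ncard_insert_of_notMem (fun h' => haT h'.1) (Set.toFinite _),
        Set.ncard_sdiff_singleton_add_one hxyT (Set.toFinite _)]
  refine ⟨K, M, s(x, y), hKtree, ?_, hM, ?_, ?_, ?_, by simp, ?_⟩
  · rw [← edgeSet_subset_edgeSet, hKe, heq]
    rintro e (rfl | he)
    exacts [Or.inr (Or.inl rfl), Or.inl he.1]
  · rw [hKe, Set.disjoint_insert_left]
    exact ⟨hbM, hdis.mono_left Set.sdiff_subset⟩
  · rw [hKe]
    rintro (h1 | h1)
    exacts [haT (h1 ▸ hxyT), h1.2 rfl]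
  · exact Set.disjoint_left.1 hdis hxyT
  · rw [heq, hKe]
    ext e
    simp only [Set.mem_union, Set.mem_insert_iff, Set.mem_sdiff, Set.mem_singleton_iff]
    by_cases h1 : e = s(x, y)
    · subst h1; simp [hxyT]
    · tauto

end SimpleGraph

/-! ### Attaching a tree along several edges -/

namespace DartGraph

set_option maxHeartbeats 1000000 in
/-- A tree is attached to a unicellular embedding, given a set `P` of further edges between the
tree and `U`: these edges can be added as well, apart from a prescribed edge `m₀` at the root if
their number is even. -/
theorem Unicellular.attach_tree {V D E V' : Type*} [Finite V] [Finite D] {G : DartGraph V D}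
    {ε : D → E} (hε : G.IsEdgeLabel ε) {K : SimpleGraph V'} {r : V'} {W : Set V'}
    {T : Set (Sym2 V')} (hT : TreeGrow K.Link r W T) (p : V' → V) (φ : Sym2 V' → E)
    (hp : Function.Injective p) (hφ : Function.Injective φ)
    (hJ : ∀ m u w, K.Link m u w → G.Joins ε (φ m) (p u) (p w)) {U : Set V} {F P : Set E} {m₀ : E}
    (h : G.Unicellular ε U F) (hU : ∀ x ∈ W, p x ∉ U) (hfin : P.Finite) (hPF : Disjoint P F)
    (hP : ∀ m ∈ P, ∃ y ∈ W, ∃ u ∈ U, G.Joins ε m (p y) u) (hPT : Disjoint P (φ '' T))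
    (hm₀ : m₀ ∈ P) (hr : ∃ u ∈ U, G.Joins ε m₀ (p r) u) :
    (Odd P.ncard → G.Unicellular ε (U ∪ p '' W) (F ∪ P ∪ φ '' T)) ∧
      (Even P.ncard → G.Unicellular ε (U ∪ p '' W) (F ∪ P \ {m₀} ∪ φ '' T)) := by
  have hends : ∀ {m a b c d}, G.Joins ε m a b → G.Joins ε m c d →
      (a = c ∧ b = d) ∨ (a = d ∧ b = c) := by
    rintro m _ _ _ _ ⟨d, rfl, rfl, rfl⟩ ⟨d', hd', rfl, rfl⟩
    rcases (hε d' d).1 hd' with rfl | rfl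
    · exact Or.inl ⟨rfl, rfl⟩
    · exact Or.inr ⟨by rw [G.rev_rev], rfl⟩
  induction hT generalizing U F P with
  | root =>
    have hstar : ∀ m ∈ P, ∃ u ∈ U, G.Joins ε m (p r) u := by
      intro m hm
      obtain ⟨y, rfl, u, hu, hJm⟩ := hP m hm
      exact ⟨u, hu, hJm⟩
    have hadd : ∀ m ∈ P, ∀ Q ⊆ P \ {m}, Even Q.ncard →
        G.Unicellular ε (insert (p r) U) (insert m F ∪ Q) := by
      intro m hm Q hQ he
      obtain ⟨u, hu, hmu⟩ := hstar m hm
      have h1 := h.pendant hε (hmu.symm hε) hu (hU r rfl)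
      refine h1.union_paired hε (paired_star (p r) (hfin.subset fun a ha => (hQ ha).1)
        (fun a ha => (hstar a (hQ ha).1).imp fun _ h => h.2) he) ?_ ?_
      · rw [Set.disjoint_insert_right]
        exact ⟨fun hmQ => (hQ hmQ).2 rfl, hPF.mono_left fun a ha => (hQ ha).1⟩
      · intro a ha u w huw
        obtain ⟨v, hv, hav⟩ := hstar a (hQ ha).1
        rcases hends huw hav with ⟨rfl, -⟩ | ⟨rfl, -⟩
        exacts [Or.inl rfl, Or.inr hv]
    have hc := Set.ncard_sdiff_singleton_add_one hm₀ hfin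
    rw [Set.image_singleton, Set.union_singleton, Set.image_empty, Set.union_empty,
      Set.union_empty]
    constructor
    · intro ho
      have h1 := hadd m₀ hm₀ _ subset_rfl (by rw [← hc] at ho; simpa [Nat.odd_add_one] using ho)
      rwa [Set.insert_union, ← Set.union_insert, Set.insert_sdiff_singleton,
        Set.insert_eq_of_mem hm₀] at h1
    -- Another edge `m₁` attaches the root; without `m₀` and `m₁`, an even star remains.
    · intro he
      rw [← hc, Nat.even_add_one, Nat.not_even_iff_odd] at he
      obtain ⟨m₁, hm₁⟩ := (Set.ncard_pos hfin.sdiff).1 he.pos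
      have hc' := Set.ncard_sdiff_singleton_add_one hm₁ hfin.sdiff
      have h1 := hadd m₁ hm₁.1 ((P \ {m₀}) \ {m₁}) (fun a ha => ⟨ha.1.1, ha.2⟩)
        (by rw [← hc'] at he; simpa [Nat.odd_add_one] using he)
      rwa [Set.insert_union, ← Set.union_insert, Set.insert_sdiff_singleton,
        Set.insert_eq_of_mem hm₁] at h1
  | @insert W T m x y hT hm hx hy ih =>
    have hpx : p x ∉ U := hU x (Set.mem_insert _ _)
    have hpr : p r ∉ U := hU r (Or.inr hT.mem_root)
    have hmT : m ∉ T := fun h' => hx (hT.mem_of_mem h' (by rw [hm.2]; simp))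
    have hφm : φ m ∉ P := fun h' => Set.disjoint_left.1 hPT h' ⟨m, Or.inl rfl, rfl⟩
    have hφmT : φ m ∉ φ '' T := by
      rintro ⟨m', hm', he⟩
      exact hmT (hφ he ▸ hm')
    have hPT' : Disjoint P (φ '' T) := hPT.mono_right (Set.image_mono (Set.subset_insert _ _))
    have hJm := hJ _ _ _ hm
    set S : Set E := {c ∈ P | ∃ u ∈ U, G.Joins ε c (p x) u} with hS
    have hSP : S ⊆ P := fun c hc => hc.1
    have hSfin : S.Finite := hfin.subset hSP
    have hcard : (P \ S).ncard + S.ncard = P.ncard := Set.ncard_sdiff_add_ncard_of_subset hSP hfin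
    have hm₀S : m₀ ∉ S := by
      rintro ⟨-, u, hu, hxu⟩
      obtain ⟨u', hu', hru⟩ := hr
      rcases hends hru hxu with ⟨h1, -⟩ | ⟨h1, -⟩
      · exact hx (hp h1 ▸ hT.mem_root)
      · exact hpr (h1 ▸ hu)
    have hrest : ∀ c ∈ P \ S, ∃ y ∈ W, ∃ u ∈ U, G.Joins ε c (p y) u := by
      rintro c ⟨hc, hcS⟩
      obtain ⟨z, rfl | hz, u, hu, hcz⟩ := hP c hc
      · exact absurd ⟨hc, u, hu, hcz⟩ hcS
      · exact ⟨z, hz, u, hu, hcz⟩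
    have hW : ∀ z ∈ W, p z ∉ U := fun z hz => hU z (Or.inr hz)
    have himg : U ∪ p '' insert x W = insert (p x) (U ∪ p '' W) := by
      rw [Set.image_insert_eq, Set.union_insert]
    rw [himg, Set.image_insert_eq]
    have hSU : ∀ c ∈ S, ∀ u w, G.Joins ε c u w → u ∈ insert (p x) (U ∪ p '' W) := by
      rintro c ⟨-, v, hv, hcv⟩ u w huw
      rcases hends huw hcv with ⟨rfl, -⟩ | ⟨rfl, -⟩
      exacts [Or.inl rfl, Or.inr (Or.inl hv)]
    have hstar : ∀ Q ⊆ S, Even Q.ncard → Paired (G.Joins ε) Q := fun Q hQ he =>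
      paired_star (p x) (hSfin.subset hQ) (fun c hc => (hQ hc).2.imp fun _ h => h.2) he
    -- If the last leaf `x` has an even number of edges to `U`, it is hung on the smaller tree by
    -- `m` and these edges are paired at `x`.
    by_cases hSe : Even S.ncard
    · obtain ⟨ih1, ih2⟩ := ih (P := P \ S) h hW hfin.sdiff (hPF.mono_left Set.sdiff_subset) hrest
        (hPT'.mono_left Set.sdiff_subset) ⟨hm₀, hm₀S⟩ hr
      have hstep : ∀ Q ⊆ P \ S, G.Unicellular ε (U ∪ p '' W) (F ∪ Q ∪ φ '' T) →
          G.Unicellular ε (insert (p x) (U ∪ p '' W)) (F ∪ (Q ∪ S) ∪ insert (φ m) (φ '' T)) := by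
        intro Q hQ hu
        have h1 := (hu.pendant hε (hJm.symm hε) (Or.inr ⟨y, hy, rfl⟩) (by
          rintro (h' | ⟨z, hz, h'⟩)
          · exact hpx h'
          · exact hx (hp h' ▸ hz))).union_paired hε (hstar S subset_rfl hSe) (by
          rw [Set.disjoint_left]
          rintro c hc (rfl | (h' | h') | h')
          · exact hφm (hSP hc)
          · exact Set.disjoint_left.1 hPF (hSP hc) h'
          · exact (hQ h').2 hc
          · exact Set.disjoint_left.1 hPT' (hSP hc) h') hSU
        convert h1 using 1
        clear * -
        ext c
        simp only [Set.mem_union, Set.mem_insert_iff]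
        tauto
      constructor
      · intro ho
        have h1 := hstep _ subset_rfl (ih1 (by
          rw [← hcard, Nat.odd_add] at ho
          exact ho.2 hSe))
        rwa [Set.sdiff_union_of_subset hSP] at h1
      · intro he
        have h1 := hstep _ Set.sdiff_subset (ih2 (by
          rw [← hcard, Nat.even_add] at he
          exact he.2 hSe))
        convert h1 using 3
        ext c
        simp only [Set.mem_union, Set.mem_sdiff, Set.mem_singleton_iff]
        have h2 : c ∈ S → c ∈ P := fun h' => hSP h'
        have h3 : c ∈ S → c ≠ m₀ := fun h' h'' => hm₀S (h'' ▸ h')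
        clear * - h2 h3
        tauto
    -- If the number is odd, `x` is first hung on `U` by one of these edges, `c`, and the others are
    -- paired at `x` in the end. The tree edge `m` then counts as one more edge between the smaller
    -- tree and the enlarged `U`, which preserves the parity of `P`.
    · rw [Nat.not_even_iff_odd] at hSe
      obtain ⟨c, hc⟩ := (Set.ncard_pos hSfin).1 hSe.pos
      have hcc := Set.ncard_sdiff_singleton_add_one hc hSfin
      obtain ⟨u, hu, hcu⟩ := hc.2
      have h0 := h.pendant hε (hcu.symm hε) hu hpx
      have hφmF : φ m ∉ F := by
        obtain ⟨d, hd, hd', -⟩ := hJm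
        intro h'
        exact hpx (hd' ▸ h.src_mem d (hd ▸ h'))
      have hφmc : φ m ≠ c := fun h' => hφm (h' ▸ hSP hc)
      have hm₀m : m₀ ≠ φ m := fun h' => hφm (h' ▸ hm₀)
      have hP' : (insert (φ m) (P \ S)).ncard = (P \ S).ncard + 1 :=
        Set.ncard_insert_of_notMem (fun h' => hφm h'.1) hfin.sdiff
      obtain ⟨ih1, ih2⟩ := ih (P := insert (φ m) (P \ S)) h0
        (by
          rintro z hz (h' | h')
          · exact hx (hp h' ▸ hz)
          · exact hW z hz h')
        (hfin.sdiff.insert _)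
        (by
          rw [Set.disjoint_left]
          rintro a (rfl | ⟨ha, haS⟩) (rfl | h')
          · exact hφmc rfl
          · exact hφmF h'
          · exact haS hc
          · exact Set.disjoint_left.1 hPF ha h')
        (by
          rintro a (rfl | ha)
          · exact ⟨y, hy, p x, Or.inl rfl, hJm.symm hε⟩
          · obtain ⟨z, hz, u, hu, hau⟩ := hrest a ha
            exact ⟨z, hz, u, Or.inr hu, hau⟩)
        (by
          rw [Set.disjoint_insert_left]
          exact ⟨hφmT, hPT'.mono_left Set.sdiff_subset⟩)
        (Or.inr ⟨hm₀, hm₀S⟩) (hr.imp fun _ h' => ⟨Or.inr h'.1, h'.2⟩)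
      have hU' : insert (p x) U ∪ p '' W = insert (p x) (U ∪ p '' W) := Set.insert_union ..
      rw [hU'] at ih1 ih2
      have hstep : ∀ Q ⊆ insert (φ m) (P \ S),
          G.Unicellular ε (insert (p x) (U ∪ p '' W)) (insert c F ∪ Q ∪ φ '' T) →
          G.Unicellular ε (insert (p x) (U ∪ p '' W))
            (insert c F ∪ Q ∪ φ '' T ∪ S \ {c}) := by
        intro Q hQ hu
        refine hu.union_paired hε (hstar _ Set.sdiff_subset ?_) ?_ fun a ha => hSU a ha.1
        · rw [← hcc] at hSe
          simpa [Nat.odd_add_one] using hSe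
        · rw [Set.disjoint_left]
          rintro a ⟨haS, hac⟩ (((h' | h') | h') | h')
          · exact hac h'
          · exact Set.disjoint_left.1 hPF (hSP haS) h'
          · rcases hQ h' with rfl | h'
            exacts [hφm (hSP haS), h'.2 haS]
          · exact Set.disjoint_left.1 hPT' (hSP haS) h'
      constructor
      · intro ho
        have h1 := hstep _ subset_rfl (ih1 (by
          rw [← hcard, Nat.odd_add] at ho
          rw [hP', Nat.odd_add_one, ho, Nat.not_even_iff_odd]
          exact hSe))
        convert h1 using 1
        ext a
        simp only [Set.mem_union, Set.mem_insert_iff, Set.mem_sdiff, Set.mem_singleton_iff]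
        have h2 : a ∈ S → a ∈ P := fun h' => hSP h'
        have h3 : a = c → a ∈ S := fun h' => h' ▸ hc
        clear * - h2 h3
        tauto
      · intro he
        have h1 := hstep _ Set.sdiff_subset (ih2 (by
          rw [← hcard, Nat.even_add] at he
          rw [hP', Nat.even_add_one, he, Nat.not_even_iff_odd]
          exact hSe))
        convert h1 using 1
        ext a
        simp only [Set.mem_union, Set.mem_insert_iff, Set.mem_sdiff, Set.mem_singleton_iff]
        have h2 : a ∈ S → a ∈ P := fun h' => hSP h'
        have h3 : a = c → a ∈ S := fun h' => h' ▸ hc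
        have h4 : a ∈ S → a ≠ m₀ := fun h' h'' => hm₀S (h'' ▸ h')
        have h5 : a = φ m → a ≠ m₀ := fun h' h'' => hm₀m (h''.symm.trans h')
        clear * - h2 h3 h4 h5
        tauto

end DartGraph

/-! ### Two Halin graphs joined by edges -/

namespace SimpleGraph

/-- `A` consists of the edges of a spanning tree of `H` and of pairs of adjacent edges. -/
def IsPairedTree {V : Type*} (H : SimpleGraph V) (A : Set (Sym2 V)) : Prop :=
  ∃ K M, K.IsTree ∧ K ≤ H ∧ Paired H.Link M ∧ Disjoint K.edgeSet M ∧ A = K.edgeSet ∪ M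

theorem IsHalin.isPairedTree {V : Type*} [Finite V] {H : SimpleGraph V} (hH : H.IsHalin) :
    H.IsPairedTree H.edgeSet ∨
      ∀ x, ∃ A b, H.IsPairedTree A ∧ b ∉ A ∧ x ∈ b ∧ H.edgeSet = insert b A := by
  rcases hH.exists_isTree with h | h
  · exact Or.inl h
  · refine Or.inr fun x => ?_
    obtain ⟨K, M, b, h1, h2, h3, h4, h5, h6, h7, h8⟩ := h x
    refine ⟨_, b, ⟨K, M, h1, h2, h3, h4, rfl⟩, ?_, h7, by rw [h8, Set.union_insert]⟩
    rintro (h | h)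
    exacts [h5 h, h6 h]

end SimpleGraph

namespace DartGraph

variable {V₁ V₂ : Type*} {H₁ : SimpleGraph V₁} {H₂ : SimpleGraph V₂} {k : ℕ}
  {e : Fin k → V₁ × V₂} {A₁ : Set (Sym2 V₁)} {A₂ : Set (Sym2 V₂)}

/-- Labels for the edges of `join (ofSimple H₁) (ofSimple H₂) e`. -/
def joinLabel (H₁ : SimpleGraph V₁) (H₂ : SimpleGraph V₂) (k : ℕ) :
    H₁.Dart ⊕ H₂.Dart ⊕ (Fin k × Bool) → Sym2 V₁ ⊕ Sym2 V₂ ⊕ Fin k :=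
  Sum.map (fun d => d.edge) (Sum.map (fun d => d.edge) Prod.fst)

/-- The labels of the edges in `A₁`, the edges in `A₂`, and the joining edges with index in `Q`. -/
def joinSet (A₁ : Set (Sym2 V₁)) (A₂ : Set (Sym2 V₂)) (Q : Set (Fin k)) :
    Set (Sym2 V₁ ⊕ Sym2 V₂ ⊕ Fin k) :=
  {l | l.elim (· ∈ A₁) (Sum.elim (· ∈ A₂) (· ∈ Q))}

@[simp] theorem inl_mem_joinSet {Q : Set (Fin k)} {m : Sym2 V₁} :
    Sum.inl m ∈ joinSet A₁ A₂ Q ↔ m ∈ A₁ := Iff.rfl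

@[simp] theorem inr_inl_mem_joinSet {Q : Set (Fin k)} {m : Sym2 V₂} :
    Sum.inr (Sum.inl m) ∈ joinSet A₁ A₂ Q ↔ m ∈ A₂ := Iff.rfl

@[simp] theorem inr_inr_mem_joinSet {Q : Set (Fin k)} {i : Fin k} :
    Sum.inr (Sum.inr i) ∈ joinSet A₁ A₂ Q ↔ i ∈ Q := Iff.rfl

theorem isEdgeLabel_joinLabel (e : Fin k → V₁ × V₂) :
    (join (ofSimple H₁) (ofSimple H₂) e).IsEdgeLabel (joinLabel H₁ H₂ k) := by
  have h₁ := H₁.isEdgeLabel_edge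
  have h₂ := H₂.isEdgeLabel_edge
  rintro (d | d | ⟨i, b⟩) (d' | d' | ⟨i', b'⟩)
  · simpa [joinLabel, join] using h₁ d d'
  · simp [joinLabel, join]
  · simp [joinLabel, join]
  · simp [joinLabel, join]
  · simpa [joinLabel, join] using h₂ d d'
  · simp [joinLabel, join]
  · simp [joinLabel, join]
  · simp [joinLabel, join]
  · cases b <;> cases b' <;> simp [joinLabel, join]

theorem joins_join_left {m : Sym2 V₁} {u w : V₁} (h : H₁.Link m u w) :
    (join (ofSimple H₁) (ofSimple H₂) e).Joins (joinLabel H₁ H₂ k) (.inl m) (.inl u) (.inl w) := by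
  obtain ⟨d, rfl, rfl, rfl⟩ := h.joins
  exact ⟨.inl d, rfl, rfl, rfl⟩

theorem joins_join_right {m : Sym2 V₂} {u w : V₂} (h : H₂.Link m u w) :
    (join (ofSimple H₁) (ofSimple H₂) e).Joins (joinLabel H₁ H₂ k) (.inr (.inl m)) (.inr u)
      (.inr w) := by
  obtain ⟨d, rfl, rfl, rfl⟩ := h.joins
  exact ⟨.inr (.inl d), rfl, rfl, rfl⟩

theorem joins_join_cross (i : Fin k) :
    (join (ofSimple H₁) (ofSimple H₂) e).Joins (joinLabel H₁ H₂ k) (.inr (.inr i))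
      (.inl (e i).1) (.inr (e i).2) :=
  ⟨.inr (.inr (i, false)), rfl, rfl, rfl⟩

theorem joinLabel_mem (d : H₁.Dart ⊕ H₂.Dart ⊕ (Fin k × Bool)) :
    joinLabel H₁ H₂ k d ∈ joinSet H₁.edgeSet H₂.edgeSet Set.univ := by
  rcases d with d | d | i
  exacts [d.edge_mem, d.edge_mem, trivial]

variable [Finite V₁] [Finite V₂]

theorem finite_joinDart : Finite (H₁.Dart ⊕ H₂.Dart ⊕ (Fin k × Bool)) := by
  have : Finite H₁.Dart := Finite.of_injective _ SimpleGraph.Dart.toProd_injective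
  have : Finite H₂.Dart := Finite.of_injective _ SimpleGraph.Dart.toProd_injective
  infer_instance

/-- The edges of paired spanning trees on the two sides, and an odd number of joining edges, have
a unicellular embedding; if the number of joining edges is even, one of them has to be left out. -/
theorem unicellular_join (h₁ : H₁.IsPairedTree A₁) (h₂ : H₂.IsPairedTree A₂) {I : Set (Fin k)}
    {i₀ : Fin k} (hi₀ : i₀ ∈ I) :
    (Odd I.ncard → (join (ofSimple H₁) (ofSimple H₂) e).Unicellular (joinLabel H₁ H₂ k) Set.univ
      (joinSet A₁ A₂ I)) ∧
    (Even I.ncard → (join (ofSimple H₁) (ofSimple H₂) e).Unicellular (joinLabel H₁ H₂ k) Set.univ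
      (joinSet A₁ A₂ (I \ {i₀}))) := by
  have := finite_joinDart (H₁ := H₁) (H₂ := H₂) (k := k)
  have hε := isEdgeLabel_joinLabel (H₁ := H₁) (H₂ := H₂) e
  obtain ⟨K₁, M₁, hK₁, hKH₁, hM₁, hd₁, rfl⟩ := h₁
  obtain ⟨K₂, M₂, hK₂, hKH₂, hM₂, hd₂, rfl⟩ := h₂
  have hinj : Function.Injective
      fun i : Fin k => (Sum.inr (Sum.inr i) : Sym2 V₁ ⊕ Sym2 V₂ ⊕ Fin k) :=
    fun i j h => by simpa using h
  have hinj' : Function.Injective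
      fun m : Sym2 V₂ => (Sum.inr (Sum.inl m) : Sym2 V₁ ⊕ Sym2 V₂ ⊕ Fin k) :=
    fun i j h => by simpa using h
  have hbase := (Unicellular.single (join (ofSimple H₁) (ofSimple H₂) e) (joinLabel H₁ H₂ k)
    (.inl (e i₀).1)).treeGrow hε (hK₁.treeGrow (e i₀).1) Sum.inl Sum.inl Sum.inl_injective
    (fun m u w h => joins_join_left ⟨hKH₁ h.1, h.2⟩) rfl (fun x _ hx h => hx (Sum.inl_injective h))
  have hatt := hbase.attach_tree hε (hK₂.treeGrow (e i₀).2) Sum.inr (fun m => .inr (.inl m))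
    Sum.inr_injective hinj' (fun m u w h => joins_join_right ⟨hKH₂ h.1, h.2⟩)
    (P := (fun i => .inr (.inr i)) '' I) (m₀ := .inr (.inr i₀))
    (by rintro x - (h | ⟨y, -, h⟩) <;> simp at h) (Set.toFinite _)
    (by
      rw [Set.disjoint_left]
      rintro _ ⟨i, -, rfl⟩ (h | ⟨m, -, h⟩) <;> simp at h)
    (by
      rintro _ ⟨i, -, rfl⟩
      exact ⟨(e i).2, trivial, .inl (e i).1, Or.inr ⟨_, trivial, rfl⟩,
        (joins_join_cross i).symm hε⟩)
    (by
      rw [Set.disjoint_left]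
      rintro _ ⟨i, -, rfl⟩ ⟨m, -, h⟩
      simp at h)
    ⟨i₀, hi₀, rfl⟩ ⟨.inl (e i₀).1, Or.inl rfl, (joins_join_cross i₀).symm hε⟩
  rw [Set.ncard_image_of_injective _ hinj] at hatt
  have hU : ({.inl (e i₀).1} ∪ Sum.inl '' Set.univ ∪ Sum.inr '' Set.univ : Set (V₁ ⊕ V₂)) =
      Set.univ := by
    ext (v | v) <;> simp
  rw [hU] at hatt
  have hfin : ∀ {F : Set (Sym2 V₁ ⊕ Sym2 V₂ ⊕ Fin k)} (Q : Set (Fin k)),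
      F = joinSet K₁.edgeSet K₂.edgeSet Q →
      (join (ofSimple H₁) (ofSimple H₂) e).Unicellular (joinLabel H₁ H₂ k) Set.univ F →
      (join (ofSimple H₁) (ofSimple H₂) e).Unicellular (joinLabel H₁ H₂ k) Set.univ
        (joinSet (K₁.edgeSet ∪ M₁) (K₂.edgeSet ∪ M₂) Q) := by
    rintro F Q rfl h
    have hp₁ : Paired ((join (ofSimple H₁) (ofSimple H₂) e).Joins (joinLabel H₁ H₂ k))
        (Sum.inl '' M₁) :=
      hM₁.image Sum.inl Sum.inl Sum.inl_injective.injOn fun _ _ _ _ h => joins_join_left h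
    have hp₂ : Paired ((join (ofSimple H₁) (ofSimple H₂) e).Joins (joinLabel H₁ H₂ k))
        ((fun m => .inr (.inl m)) '' M₂) :=
      hM₂.image _ Sum.inr hinj'.injOn fun _ _ _ _ h => joins_join_right h
    have h1 := h.union_paired hε (hp₁.union hp₂ (by
      rw [Set.disjoint_left]
      rintro _ ⟨m, -, rfl⟩ ⟨m', -, h⟩
      simp at h)) (by
      rw [Set.disjoint_left]
      rintro _ (⟨m, hm, rfl⟩ | ⟨m, hm, rfl⟩) h
      · exact Set.disjoint_left.1 hd₁ h hm
      · exact Set.disjoint_left.1 hd₂ h hm) fun _ _ _ _ _ => trivial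
    convert h1 using 1
    ext (m | m | i) <;> simp
  refine ⟨fun ho => hfin I ?_ (hatt.1 ho), fun he => hfin (I \ {i₀}) ?_ (hatt.2 he)⟩
  · ext (m | m | i) <;> simp
  · ext (m | m | i) <;> simp

theorem upperEmbeddable_join_of_unicellular {F : Set (Sym2 V₁ ⊕ Sym2 V₂ ⊕ Fin k)}
    (h : (join (ofSimple H₁) (ofSimple H₂) e).Unicellular (joinLabel H₁ H₂ k) Set.univ F)
    (hF : (joinSet H₁.edgeSet H₂.edgeSet Set.univ \ F).Subsingleton) :
    (join (ofSimple H₁) (ofSimple H₂) e).UpperEmbeddable := by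
  have := finite_joinDart (H₁ := H₁) (H₂ := H₂) (k := k)
  exact h.upperEmbeddable (isEdgeLabel_joinLabel e) fun d d' hd hd' =>
    hF ⟨joinLabel_mem d, hd⟩ ⟨joinLabel_mem d', hd'⟩

theorem Unicellular.join_pair_left
    {F : Set (Sym2 V₁ ⊕ Sym2 V₂ ⊕ Fin k)}
    (h : (join (ofSimple H₁) (ofSimple H₂) e).Unicellular (joinLabel H₁ H₂ k) Set.univ F)
    {b : Sym2 V₁} {i : Fin k} (hb : b ∈ H₁.edgeSet) (hbi : (e i).1 ∈ b) (hbF : .inl b ∉ F)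
    (hiF : .inr (.inr i) ∉ F) :
    (join (ofSimple H₁) (ofSimple H₂) e).Unicellular (joinLabel H₁ H₂ k) Set.univ
      (insert (.inl b) (insert (.inr (.inr i)) F)) := by
  have := finite_joinDart (H₁ := H₁) (H₂ := H₂) (k := k)
  obtain ⟨z, hz⟩ := SimpleGraph.exists_link_of_mem hb hbi
  exact h.pair (isEdgeLabel_joinLabel e) (joins_join_left hz) (joins_join_cross i) (by simp) hbF
    hiF trivial trivial trivial

theorem Unicellular.join_pair_right
    {F : Set (Sym2 V₁ ⊕ Sym2 V₂ ⊕ Fin k)}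
    (h : (join (ofSimple H₁) (ofSimple H₂) e).Unicellular (joinLabel H₁ H₂ k) Set.univ F)
    {b : Sym2 V₂} {i : Fin k} (hb : b ∈ H₂.edgeSet) (hbi : (e i).2 ∈ b) (hbF : .inr (.inl b) ∉ F)
    (hiF : .inr (.inr i) ∉ F) :
    (join (ofSimple H₁) (ofSimple H₂) e).Unicellular (joinLabel H₁ H₂ k) Set.univ
      (insert (.inr (.inl b)) (insert (.inr (.inr i)) F)) := by
  have := finite_joinDart (H₁ := H₁) (H₂ := H₂) (k := k)
  have hε := isEdgeLabel_joinLabel (H₁ := H₁) (H₂ := H₂) e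
  obtain ⟨z, hz⟩ := SimpleGraph.exists_link_of_mem hb hbi
  exact h.pair hε (joins_join_right hz) ((joins_join_cross i).symm hε) (by simp) hbF hiF trivial
    trivial trivial

/-- Each Halin graph leaves over at most one edge, whose position can be steered to an end of a
chosen joining edge. If `k` is even, the joining edge that is left out is paired with such a
leftover edge, if there is one. If `k` is odd, all joining edges fit, and intervention is needed
only when both sides have a leftover edge. -/
theorem _root_.SimpleGraph.IsHalin.upperEmbeddable_join (h₁ : H₁.IsHalin) (h₂ : H₂.IsHalin)
    (hk : 2 ≤ k) (e : Fin k → V₁ × V₂) :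
    (join (ofSimple H₁) (ofSimple H₂) e).UpperEmbeddable := by
  obtain ⟨i₀, hi₀⟩ : ∃ i : Fin k, i.val = 0 := ⟨⟨0, by omega⟩, rfl⟩
  obtain ⟨j₀, hj₀⟩ : ∃ j : Fin k, j.val = 1 := ⟨⟨1, by omega⟩, rfl⟩
  have hij : i₀ ≠ j₀ := fun h => by rw [h] at hi₀; omega
  have hcard : (Set.univ : Set (Fin k)).ncard = k := by simp [Set.ncard_univ]
  have hsub : ∀ {F : Set (Sym2 V₁ ⊕ Sym2 V₂ ⊕ Fin k)} (a : Sym2 V₁ ⊕ Sym2 V₂ ⊕ Fin k),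
      (∀ l ∈ joinSet H₁.edgeSet H₂.edgeSet Set.univ, l ∈ F ∨ l = a) →
      (joinSet H₁.edgeSet H₂.edgeSet Set.univ \ F).Subsingleton := fun a h x hx y hy =>
    ((h x hx.1).resolve_left hx.2).trans ((h y hy.1).resolve_left hy.2).symm
  rcases Nat.even_or_odd k with he | ho
  · have hu : ∀ {A₁ A₂}, H₁.IsPairedTree A₁ → H₂.IsPairedTree A₂ → _ := fun g₁ g₂ =>
      (unicellular_join (e := e) g₁ g₂ (Set.mem_univ i₀)).2 (hcard.symm ▸ he)
    rcases h₁.isPairedTree with g₁ | g₁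
    · rcases h₂.isPairedTree with g₂ | g₂
      · refine upperEmbeddable_join_of_unicellular (hu g₁ g₂) (hsub (.inr (.inr i₀)) ?_)
        rintro (m | m | i) hm
        · exact Or.inl hm
        · exact Or.inl hm
        · by_cases h : i = i₀ <;> simp [h]
      · obtain ⟨A, b, g₂, hbA, hb, hA⟩ := g₂ (e i₀).2
        refine upperEmbeddable_join_of_unicellular ((hu g₁ g₂).join_pair_right (b := b) (i := i₀)
          (by simp [hA]) hb hbA (by simp)) (hsub (.inr (.inr i₀)) ?_)
        rintro (m | m | i) hm
        · exact Or.inl (Or.inr (Or.inr hm))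
        · simpa [hA] using hm
        · by_cases h : i = i₀ <;> simp [h]
    · obtain ⟨A, b, g₁, hbA, hb, hA⟩ := g₁ (e i₀).1
      rcases h₂.isPairedTree with g₂ | g₂
      · refine upperEmbeddable_join_of_unicellular ((hu g₁ g₂).join_pair_left (b := b) (i := i₀)
          (by simp [hA]) hb hbA (by simp)) (hsub (.inr (.inr i₀)) ?_)
        rintro (m | m | i) hm
        · simpa [hA] using hm
        · exact Or.inl (Or.inr (Or.inr hm))
        · by_cases h : i = i₀ <;> simp [h]
      · obtain ⟨A', b', g₂, hbA', hb', hA'⟩ := g₂ (e i₀).2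
        refine upperEmbeddable_join_of_unicellular ((hu g₁ g₂).join_pair_left (b := b) (i := i₀)
          (by simp [hA]) hb hbA (by simp)) (hsub (.inr (.inl b')) ?_)
        rintro (m | m | i) hm
        · simpa [hA] using hm
        · simpa [hA', or_comm] using hm
        · by_cases h : i = i₀ <;> simp [h]
  · have hu : ∀ {A₁ A₂}, H₁.IsPairedTree A₁ → H₂.IsPairedTree A₂ → _ := fun g₁ g₂ =>
      (unicellular_join (e := e) g₁ g₂ (Set.mem_univ i₀)).1 (hcard.symm ▸ ho)
    rcases h₁.isPairedTree with g₁ | g₁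
    · rcases h₂.isPairedTree with g₂ | g₂
      · exact upperEmbeddable_join_of_unicellular (hu g₁ g₂)
          (hsub (.inr (.inr i₀)) fun l hl => Or.inl hl)
      · obtain ⟨A, b, g₂, -, -, hA⟩ := g₂ (e i₀).2
        refine upperEmbeddable_join_of_unicellular (hu g₁ g₂) (hsub (.inr (.inl b)) ?_)
        rintro (m | m | i) hm
        · exact Or.inl hm
        · simpa [hA, or_comm] using hm
        · exact Or.inl trivial
    · obtain ⟨A, b, g₁, hbA, hb, hA⟩ := g₁ (e i₀).1
      rcases h₂.isPairedTree with g₂ | g₂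
      · refine upperEmbeddable_join_of_unicellular (hu g₁ g₂) (hsub (.inl b) ?_)
        rintro (m | m | i) hm
        · simpa [hA, or_comm] using hm
        · exact Or.inl hm
        · exact Or.inl trivial
      -- Both joining edges `i₀` and `j₀` are held back: without `j₀` the number is even, so `i₀` is
      -- left out as well. They are paired with the leftover edges `b` and `b'`, which is where a
      -- second joining edge is needed.
      · obtain ⟨A', b', g₂, hbA', hb', hA'⟩ := g₂ (e j₀).2
        have hc := Set.ncard_sdiff_singleton_add_one (Set.mem_univ j₀) (Set.toFinite _)
        rw [hcard] at hc
        have h1 := (unicellular_join (e := e) g₁ g₂ (I := Set.univ \ {j₀}) (i₀ := i₀)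
          ⟨trivial, hij⟩).2 (by rw [← hc] at ho; simpa [Nat.odd_add_one] using ho)
        have h2 := h1.join_pair_left (b := b) (i := i₀) (by simp [hA]) hb hbA (by simp)
        refine upperEmbeddable_join_of_unicellular (h2.join_pair_right (b := b') (i := j₀)
          (by simp [hA']) hb' (by simp [hbA']) (by simp [hij.symm])) (hsub (.inr (.inr i₀)) ?_)
        rintro (m | m | i) hm
        · simpa [hA] using hm
        · simpa [hA'] using hm
        · by_cases h : i = i₀
          · simp [h]
          · by_cases h' : i = j₀ <;> simp [h, h']

end DartGraph

theorem theorem8 :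
    -- Cartesian product of a connected simple graph with the path with `n` edges
    (∀ (V : Type*) [Finite V] (G : SimpleGraph V), G.Connected → ∀ n : ℕ, 1 ≤ n →
      (DartGraph.ofSimple (SimpleGraph.boxProd G (SimpleGraph.pathGraph (n + 1)))).UpperEmbeddable) ∧
    -- two disjoint Halin graphs with at least two edges connecting them
    (∀ (V₁ V₂ : Type*) [Finite V₁] [Finite V₂] (H₁ : SimpleGraph V₁) (H₂ : SimpleGraph V₂),
      H₁.IsHalin → H₂.IsHalin → ∀ (k : ℕ) (e : Fin k → V₁ × V₂), 2 ≤ k →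
      (DartGraph.join (DartGraph.ofSimple H₁) (DartGraph.ofSimple H₂) e).UpperEmbeddable) ∧
    -- the cubes
    (∀ n : ℕ, (DartGraph.ofSimple (SimpleGraph.nCube n)).UpperEmbeddable) ∧
    -- the generalized Petersen graphs
    (∀ n k : ℕ, 3 ≤ n → 1 ≤ k → k < n →
      (DartGraph.ofSimple (SimpleGraph.generalizedPetersen n k)).UpperEmbeddable) := by
  refine ⟨fun V _ G hG n hn => ?_,
    fun V₁ V₂ _ _ H₁ H₂ h₁ h₂ k e hk => h₁.upperEmbeddable_join h₂ hk e,
    SimpleGraph.nCube_upperEmbeddable,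
    fun n k hn hk hkn => SimpleGraph.generalizedPetersen_upperEmbeddable hn hk hkn⟩
  exact SimpleGraph.upperEmbeddable_of_iso_boxProd hG hn SimpleGraph.Iso.refl
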